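/- Let $\Delta(s)=2^s\pi^{s-1}\Gamma(1-s)\sin(\pi s/2)$, so that $\zeta(s)=\Delta(s)\zeta(1-s)$. For $\phi\in[0,\pi)$ let $t_n(\phi)$, $n=1,2,\dots$, denote the positive roots $t$ of the equation $\Delta(\tfrac12+it)=e^{2i\phi}$ in ascending order; only finitely many of them are $\le T$. For real numbers $X,Y\le T$ and complex coefficients $x_n,y_m$ put $$X(s)=\sum_{n\le X}\frac{x_n}{n^s},\qquad Y(s)=\sum_{m\le Y}\frac{y_m}{m^s},$$ $$\mathcal X_0=\max_{n\le X}|x_n|,\quad \mathcal Y_0=\max_{m\le Y}|y_m|,\quad \mathcal X_1=\sum_{n\le X}\frac{|x_n|}{n},\quad \mathcal Y_1=\sum_{m\le Y}\frac{|y_m|}{m},$$ where all summation variables run over positive integers (and an empty maximum is $0$). Then, for any $\phi\in[0,\pi)$, as $T\to\infty$, $$\sum_{0<t_n(\phi)\le T}\zeta\bigl(\tfrac12-it_n(\phi)\bigr)X\bigl(\tfrac12+it_n(\phi)\bigr)Y\bigl(\tfrac12-it_n(\phi)\bigr)=\frac{T}{2\pi}\Bigl(\log\frac{T}{2\pi e}\Bigr)\biggl(e^{-2i\phi}\sum_{\substack{m\le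 X\\ mn\le Y}}\frac{x_m y_{mn}}{mn}+\sum_{\substack{m\le Y\\ mn\le X}}\frac{y_m x_{mn}}{mn}\biggr)+O(R_1),$$ where $$R_1=(X+Y)\sqrt T(\log T)^2\mathcal X_1\mathcal Y_1+(X+Y)(\log T)^4\mathcal X_0\mathcal Y_0;$$ moreover, $$\sum_{0<t_n(\phi)\le T}\bigl|X\bigl(\tfrac12+it_n(\phi)\bigr)\bigr|^2=\frac{T}{2\pi}\Bigl(\log\frac{T}{2\pi e}\Bigr)\sum_{n\le X}\frac{|x_n|^2}{n}+O(R_2),$$ where $$R_2=X\sqrt T(\log T)^2\sum_{n\le X}\frac{|x_n|^2}{n}+X(\log T)^3\mathcal X_0^2.$$ The implicit constants, and the bound beyond which $T$ has to lie, are absolute: they do not depend on $\phi$, $X$, $Y$ or the coefficients $x_n$, $y_m$ (all of which may vary with $T$). -/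

import Mathlib

open scoped NNReal

noncomputable section

namespace ZetaMoments

/-- The factor `Δ(s) = 2^s π^(s-1) Γ(1-s) sin(πs/2)` of the functional equation
`ζ(s) = Δ(s) ζ(1-s)`. -/
def Delta (s : ℂ) : ℂ :=
  (2 : ℂ) ^ s * (Real.pi : ℂ) ^ (s - 1) * Complex.Gamma (1 - s) * Complex.sin (Real.pi * s / 2)

/-- The set of the points `t_n(φ)` with `0 < t_n(φ) ≤ T`, i.e. of the roots `t ∈ (0, T]` of
`Δ(1/2 + it) = e^{2iφ}`. -/
def gramPoints (φ T : ℝ) : Set ℝ :=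
  {t : ℝ | 0 < t ∧ t ≤ T ∧
    Delta (1 / 2 + Complex.I * t) = Complex.exp (2 * Complex.I * φ)}

/-- The Dirichlet polynomial `∑_{n ≤ X} x_n n^{-s}` (over positive integers `n`). -/
def dirPoly (X : ℝ) (x : ℕ → ℂ) (s : ℂ) : ℂ :=
  ∑ n ∈ Finset.Icc 1 ⌊X⌋₊, x n / (n : ℂ) ^ s

/-- `max_{n ≤ X} |x_n|` (it is `0` if there is no positive integer `n ≤ X`). -/
def coeffMax (X : ℝ) (x : ℕ → ℂ) : ℝ :=
  (((Finset.Icc 1 ⌊X⌋₊).sup fun n => ‖x n‖₊ : ℝ≥0) : ℝ)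

/-- `∑_{n ≤ X} |x_n| / n`. -/
def coeffSum (X : ℝ) (x : ℕ → ℂ) : ℝ :=
  ∑ n ∈ Finset.Icc 1 ⌊X⌋₊, ‖x n‖ / n

/-- `∑_{n ≤ X} |x_n|² / n`. -/
def coeffSqSum (X : ℝ) (x : ℕ → ℂ) : ℝ :=
  ∑ n ∈ Finset.Icc 1 ⌊X⌋₊, ‖x n‖ ^ 2 / n

/-- `∑_{m ≤ X, mn ≤ Y} x_m y_{mn} / (mn)`, over positive integers `m` and `n`. -/
def diagSum (X Y : ℝ) (x y : ℕ → ℂ) : ℂ :=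
  ∑ m ∈ Finset.Icc 1 ⌊X⌋₊, ∑ n ∈ (Finset.Icc 1 ⌊Y⌋₊).filter (fun n => m * n ≤ ⌊Y⌋₊),
    x m * y (m * n) / ((m : ℂ) * (n : ℂ))

/-- `S₁(T) = ∑_{0 < t_n(φ) ≤ T} ζ(1/2 - it_n(φ)) X(1/2 + it_n(φ)) Y(1/2 - it_n(φ))`. -/
def S₁ (φ T X Y : ℝ) (x y : ℕ → ℂ) : ℂ :=
  ∑ᶠ t ∈ gramPoints φ T,
    riemannZeta (1 / 2 - Complex.I * t) * dirPoly X x (1 / 2 + Complex.I * t) *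
      dirPoly Y y (1 / 2 - Complex.I * t)

/-- `S₂(T) = ∑_{0 < t_n(φ) ≤ T} |X(1/2 + it_n(φ))|²`. -/
def S₂ (φ T X : ℝ) (x : ℕ → ℂ) : ℝ :=
  ∑ᶠ t ∈ gramPoints φ T, ‖dirPoly X x (1 / 2 + Complex.I * t)‖ ^ 2

/-- The error term of the formula for `S₁`. -/
def R₁ (T X Y : ℝ) (x y : ℕ → ℂ) : ℝ :=
  (X + Y) * Real.sqrt T * Real.log T ^ 2 * coeffSum X x * coeffSum Y y +
    (X + Y) * Real.log T ^ 4 * coeffMax X x * coeffMax Y y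

/-- The error term of the formula for `S₂`. -/
def R₂ (T X : ℝ) (x : ℕ → ℂ) : ℝ :=
  X * Real.sqrt T * Real.log T ^ 2 * coeffSqSum X x + X * Real.log T ^ 3 * coeffMax X x ^ 2

end ZetaMoments

end

/-!
Put `w = e^{2iφ}` and `Λ = -Δ'/Δ`. The sum of `f(1/2 + it)` over the roots of `Δ(1/2 + it) = w` is a
sum of residues of `f Δ' / (Δ - w)`, since off the critical line `|Δ| ≠ 1` at large height. It is
computed by integrating over the rectangle with vertical sides `Re s = 1 + 1 / log T` and
`Re s = -1 / log T` (`rectIntegral_eq_sum_gramPoints`, `norm_sum_gramPoints_sub_le`).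

On the right side `|Δ| ≤ 3 / √t`, and the kernel is `w⁻¹ Λ Δ` up to a factor `1 + O(|Δ|)`; on the left
side `|Δ| ≥ √t / 3`, and the kernel is `-Λ` up to a factor `1 + O(1 / |Δ|)`. For
`f(s) = ζ(1 - s) X(s) Y(1 - s)` the functional equation turns `f Δ` on the right side into
`ζ(s) X(s) Y(1 - s)`. The left side becomes an integral of the same shape over the right side through
`s ↦ 1 - conj s`, with `X` and `Y` exchanged and the coefficients conjugated. For
`f(s) = X(s) conj X(1 - s)`, which gives the second formula, the right side is negligible.

There `ζ` may be expanded into its Dirichlet series, and what remains are the integrals of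
`Λ(s) (nm)^{-s} l^{s-1}` (`twistedIntegral`). As `Λ(s) = log (t / 2π) + O(1 / t)`, which is Stirling's
formula for the digamma function, the terms with `nm = l` give `T log (T / 2πe)` and the others
oscillate; only the pairs with `nm` close to `l` need care, and they are summed as a harmonic series
(`norm_zetaMoment_sub_le`, `norm_moment_sub_le`).

For the horizontal sides heights are chosen where `Δ(1/2 + iτ) = -w`: as `Λ` is nearly real and
constant on a horizontal line, `Δ` keeps away from `w` there (`max_le_norm_Delta_sub`), uniformly in
`φ`. The bound `ζ(s) ≪ √t` for `Re s ≥ 1/2` then suffices. These heights differ from `0` and `T` by a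
bounded amount, and only boundedly many roots lie between, again uniformly in `φ`
(`exists_encard_le`, `exists_Delta_half_eq_neg`).
-/

namespace ZetaMoments

/-! ### Asymptotics of the digamma function -/

/-- The solution of the linear equation `h' = k h`. -/
theorem eq_mul_exp_integral {h k : ℝ → ℂ} (hk : Continuous k)
    (hh : ∀ u, HasDerivAt h (k u * h u) u) (a b : ℝ) :
    h b = h a * Complex.exp (∫ u in a..b, k u) := by
  have hI : ∀ u, HasDerivAt (fun v => ∫ x in a..v, k x) (k u) u := fun u =>
    intervalIntegral.integral_hasDerivAt_right (hk.intervalIntegrable _ _)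
      (hk.stronglyMeasurableAtFilter _ _) hk.continuousAt
  have hd : ∀ u, HasDerivAt (fun v => h v * Complex.exp (-∫ x in a..v, k x)) 0 u := by
    intro u
    have := (hh u).fun_mul ((hI u).fun_neg.cexp)
    refine HasDerivAt.congr_deriv this ?_
    ring
  have hc := is_const_of_deriv_eq_zero (fun u => (hd u).differentiableAt) (fun u => (hd u).deriv) b a
  simp only [intervalIntegral.integral_same, neg_zero, Complex.exp_zero, mul_one] at hc
  rw [← hc, mul_assoc, ← Complex.exp_add]
  simp

theorem norm_log_add_one_sub_log_sub_inv_le {z : ℂ} (hre : 0 ≤ z.re) (him : z.im ≠ 0) :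
    ‖Complex.log (z + 1) - Complex.log z - 1 / z‖ ≤ 1 / ‖z‖ ^ 2 := by
  have hz : z ≠ 0 := by rintro rfl; simp at him
  have hzu : ∀ u : ℝ, z + u ≠ 0 := fun u h => him (by simpa using congrArg Complex.im h)
  have hd : ∀ u ∈ Set.Icc (0 : ℝ) 1, HasDerivWithinAt
      (fun u : ℝ => Complex.log (z + u) - u / z) (1 / (z + u) - 1 / z) (Set.Icc 0 1) u := by
    intro u _
    have h1 : HasDerivAt (fun u : ℝ => z + (u : ℂ)) 1 u := by
      simpa using (Complex.ofRealCLM.hasDerivAt (x := u)).const_add z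
    have h2 := h1.clog_real (show z + u ∈ Complex.slitPlane from Or.inr (by simpa using him))
    have h3 : HasDerivAt (fun u : ℝ => (u : ℂ) / z) (1 / z) u := by
      simpa using (Complex.ofRealCLM.hasDerivAt (x := u)).div_const z
    exact (h2.fun_sub h3).hasDerivWithinAt
  have := norm_image_sub_le_of_norm_deriv_le_segment_01' (C := 1 / ‖z‖ ^ 2) hd ?_
  · refine le_trans (le_of_eq (congrArg norm ?_)) this
    push_cast
    simp
    ring
  · intro u hu
    have hle : ‖z‖ ≤ ‖z + u‖ := by
      rw [← sq_le_sq₀ (norm_nonneg _) (norm_nonneg _), Complex.sq_norm, Complex.sq_norm,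
        Complex.normSq_apply, Complex.normSq_apply]
      simp only [Complex.add_re, Complex.ofReal_re, Complex.add_im, Complex.ofReal_im, add_zero]
      nlinarith [hu.1, mul_nonneg hre hu.1]
    have hpos : 0 < ‖z‖ := norm_pos_iff.2 hz
    have he : 1 / (z + u) - 1 / z = -(u : ℂ) / (z * (z + u)) := by
      have := hzu u
      field_simp
      ring
    rw [he, norm_div, norm_neg, norm_mul, Complex.norm_real, Real.norm_of_nonneg hu.1]
    apply div_le_div₀ zero_le_one hu.2.le (by positivity)
    rw [sq]
    gcongr

/-- Euler–Maclaurin for `∑ 1 / (z + j)` with an error that is uniform in `n`: the error of the single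
step is `O(1 / |z + j|²)` and telescopes. -/
theorem norm_log_sub_sum_inv_le {z : ℂ} (hre : 0 ≤ z.re) (him : 1 ≤ |z.im|) (n : ℕ) :
    ‖Complex.log (z + n) - Complex.log z - ∑ j ∈ Finset.range n, 1 / (z + j)‖ ≤
      4 * (1 / |z.im| - 1 / (|z.im| + n)) := by
  induction n with
  | zero => simp
  | succ n ih =>
    have him0 : z.im ≠ 0 := by
      intro h; rw [h] at him; simp at him; linarith
    have h1 := norm_log_add_one_sub_log_sub_inv_le (z := z + n) (by simp; positivity)
      (by simpa using him0)
    have hn : (0 : ℝ) ≤ n := Nat.cast_nonneg n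
    have h2 : 1 / ‖z + n‖ ^ 2 ≤ 4 * (1 / (|z.im| + n) - 1 / (|z.im| + (n + 1))) := by
      have e : 4 * (1 / (|z.im| + n) - 1 / (|z.im| + (n + 1))) =
          4 / ((|z.im| + n) * (|z.im| + (n + 1))) := by
        have : 0 < |z.im| + n := by linarith
        field_simp
        ring
      rw [e, Complex.sq_norm, Complex.normSq_apply]
      simp only [Complex.add_re, Complex.natCast_re, Complex.add_im, Complex.natCast_im, add_zero]
      have hy : z.im * z.im = |z.im| * |z.im| := (abs_mul_abs_self _).symm
      rw [hy, div_le_div_iff₀ (by nlinarith) (by positivity)]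
      nlinarith [sq_nonneg (|z.im| - n), mul_nonneg hre hn]
    rw [Finset.sum_range_succ]
    push_cast
    calc ‖Complex.log (z + (n + 1)) - Complex.log z -
          (∑ j ∈ Finset.range n, 1 / (z + j) + 1 / (z + n))‖
        = ‖(Complex.log (z + n) - Complex.log z - ∑ j ∈ Finset.range n, 1 / (z + j)) +
          (Complex.log (z + n + 1) - Complex.log (z + n) - 1 / (z + n))‖ := by
          congr 1; rw [← add_assoc]; ring
      _ ≤ _ := norm_add_le _ _
      _ ≤ 4 * (1 / |z.im| - 1 / (|z.im| + n)) +
          4 * (1 / (|z.im| + n) - 1 / (|z.im| + (n + 1))) := add_le_add ih (h1.trans h2)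
      _ = _ := by ring

theorem norm_log_natCast_add_sub_le {n : ℕ} (hn : 0 < n) {v : ℂ} (hv : 0 ≤ v.re) :
    ‖Complex.log (n + v) - Complex.log n‖ ≤ ‖v‖ / n := by
  have hn' : (0 : ℝ) < n := Nat.cast_pos.2 hn
  have hd : ∀ u ∈ Set.Icc (0 : ℝ) 1, HasDerivWithinAt
      (fun u : ℝ => Complex.log (n + u * v)) (v / (n + u * v)) (Set.Icc 0 1) u := by
    intro u hu
    have h1 : HasDerivAt (fun u : ℝ => (n : ℂ) + u * v) v u := by
      simpa using ((Complex.ofRealCLM.hasDerivAt (x := u)).mul_const v).const_add (n : ℂ)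
    refine (h1.clog_real (Or.inl ?_)).hasDerivWithinAt
    simp
    have := mul_nonneg hu.1 hv
    linarith
  have := norm_image_sub_le_of_norm_deriv_le_segment_01' (C := ‖v‖ / n) hd ?_
  · simpa using this
  · intro u hu
    rw [norm_div]
    gcongr
    refine le_trans ?_ (Complex.re_le_norm _)
    simp
    exact mul_nonneg hu.1 hv

/-- The logarithmic derivative of the `n`-th approximant of `Γ` in Euler's limit formula. -/
theorem hasDerivAt_GammaSeq {n : ℕ} (hn : 0 < n) {s : ℂ} (hs : s.im ≠ 0) :
    HasDerivAt (fun z => Complex.GammaSeq z n)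
      ((Complex.log n - ∑ j ∈ Finset.range (n + 1), 1 / (s + j)) * Complex.GammaSeq s n) s := by
  have hne : ∀ j : ℕ, s + j ≠ 0 := fun j h => hs (by simpa using congrArg Complex.im h)
  have hn0 : (n : ℂ) ≠ 0 := Nat.cast_ne_zero.2 hn.ne'
  have hd1 : HasDerivAt (fun z : ℂ => (n : ℂ) ^ z) (n ^ s * Complex.log n) s := by
    simpa using (hasDerivAt_id s).const_cpow (Or.inl hn0)
  have hP : (∏ j ∈ Finset.range (n + 1), (s + (j : ℂ))) ≠ 0 :=
    Finset.prod_ne_zero_iff.2 fun j _ => hne j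
  have hPd : HasDerivAt (fun z : ℂ => ∏ j ∈ Finset.range (n + 1), (z + (j : ℂ)))
      ((∑ j ∈ Finset.range (n + 1), 1 / (s + j)) * ∏ j ∈ Finset.range (n + 1), (s + (j : ℂ))) s := by
    have hdiff : DifferentiableAt ℂ (fun z : ℂ => ∏ j ∈ Finset.range (n + 1), (z + (j : ℂ))) s := by
      fun_prop
    have hl := logDeriv_prod (s := Finset.range (n + 1)) (f := fun (j : ℕ) (z : ℂ) => z + (j : ℂ))
      (x := s) (fun j _ => hne j) (fun j _ => by fun_prop)
    have : deriv (fun z : ℂ => ∏ j ∈ Finset.range (n + 1), (z + (j : ℂ))) s =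
        (∑ j ∈ Finset.range (n + 1), 1 / (s + j)) * ∏ j ∈ Finset.range (n + 1), (s + (j : ℂ)) := by
      rw [← div_eq_iff hP]
      rw [logDeriv_apply] at hl
      rw [hl]
      refine Finset.sum_congr rfl fun j _ => ?_
      simp [logDeriv_apply]
    rw [← this]
    exact hdiff.hasDerivAt
  have := (hd1.mul_const (n.factorial : ℂ)).fun_div hPd hP
  unfold Complex.GammaSeq
  refine HasDerivAt.congr_deriv this ?_
  field_simp

/-- Stirling's formula `ψ(s) = log s + O(1 / |Im s|)`. The function `u ↦ Γ(s + u) exp(-p(u))`, with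
`p` a primitive of `log (s + u)`, is a limit of functions with small logarithmic derivative. That
makes its increments small, hence its derivative at `0`, without differentiating the limit. -/
theorem norm_digamma_sub_log_le {s : ℂ} (hre : 0 < s.re) (him : 1 ≤ |s.im|) :
    ‖Complex.digamma s - Complex.log s‖ ≤ 8 / |s.im| := by
  have him0 : s.im ≠ 0 := by
    intro h; rw [h] at him; simp at him; linarith
  have hsu : ∀ u : ℝ, s + u ∈ Complex.slitPlane := fun u => Or.inr (by simpa using him0)
  have hsu0 : ∀ u : ℝ, s + u ≠ 0 := fun u => Complex.slitPlane_ne_zero (hsu u)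
  -- a primitive of the logarithm
  set p : ℝ → ℂ := fun u => (s + u) * Complex.log (s + u) - (s + u) with hp
  have hadd : ∀ u : ℝ, HasDerivAt (fun u : ℝ => s + (u : ℂ)) 1 u := fun u => by
    simpa using (Complex.ofRealCLM.hasDerivAt (x := u)).const_add s
  have hpd : ∀ u : ℝ, HasDerivAt p (Complex.log (s + u)) u := by
    intro u
    have := ((hadd u).fun_mul ((hadd u).clog_real (hsu u))).fun_sub (hadd u)
    refine HasDerivAt.congr_deriv this ?_
    have := hsu0 u
    field_simp
    ring
  set g : ℕ → ℝ → ℂ := fun n u => Complex.GammaSeq (s + u) n * Complex.exp (-p u) with hg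
  set k : ℕ → ℝ → ℂ := fun n u => Complex.log n - ∑ j ∈ Finset.range (n + 1), 1 / (s + u + j)
    - Complex.log (s + u) with hk
  have hkc : ∀ n, Continuous (k n) := by
    intro n
    refine (continuous_const.sub (continuous_finsetSum _ fun j _ => ?_)).sub ?_
    · refine continuous_const.div (by fun_prop) fun u h => ?_
      exact hsu0 (u + j) (by push_cast; rw [← h]; ring)
    · exact (by fun_prop : Continuous fun u : ℝ => s + (u : ℂ)).clog hsu
  have hgd : ∀ n, 0 < n → ∀ u, HasDerivAt (g n) (k n u * g n u) u := by
    intro n hn u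
    have h1 := (hasDerivAt_GammaSeq hn (s := s + u) (by simpa using him0)).comp u (hadd u)
    have := h1.fun_mul (hpd u).fun_neg.cexp
    refine HasDerivAt.congr_deriv this ?_
    simp only [hk, hg, Function.comp]
    ring
  have hkb : ∀ n, 0 < n → ∀ u : ℝ, |u| ≤ s.re → ‖k n u‖ ≤ 4 / |s.im| + (2 * ‖s‖ + 1) / n := by
    intro n hn u hu
    have hre' : 0 ≤ (s + u).re := by simp; linarith [neg_abs_le u]
    have h1 := norm_log_sub_sum_inv_le (z := s + u) hre' (by simpa using him) (n + 1)
    have h2 := norm_log_natCast_add_sub_le hn (v := s + u + 1) (by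
      rw [Complex.add_re, Complex.one_re]; linarith)
    have e : k n u = (Complex.log (s + u + (n + 1 : ℕ)) - Complex.log (s + u) -
        ∑ j ∈ Finset.range (n + 1), 1 / (s + u + j)) -
        (Complex.log (n + (s + u + 1)) - Complex.log n) := by
      have : (n : ℂ) + (s + u + 1) = s + u + (n + 1 : ℕ) := by push_cast; ring
      rw [this]
      simp only [hk]
      ring
    have h3 : ‖s + u + 1‖ ≤ 2 * ‖s‖ + 1 := by
      calc ‖s + u + 1‖ ≤ ‖s‖ + ‖(u : ℂ)‖ + ‖(1 : ℂ)‖ :=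
            (norm_add_le _ _).trans (by gcongr; exact norm_add_le _ _)
        _ ≤ _ := by
          rw [Complex.norm_real, norm_one, Real.norm_eq_abs]
          have := Complex.re_le_norm s
          linarith
    have h4 : (0 : ℝ) ≤ 1 / (|s.im| + (n + 1 : ℕ)) := by positivity
    simp only [Complex.add_im, Complex.ofReal_im, add_zero] at h1
    rw [e]
    calc _ ≤ _ := norm_sub_le _ _
      _ ≤ 4 * (1 / |s.im| - 1 / (|s.im| + (n + 1 : ℕ))) + ‖s + u + 1‖ / n := add_le_add h1 h2
      _ ≤ 4 * (1 / |s.im| - 0) + (2 * ‖s‖ + 1) / n := by gcongr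
      _ = _ := by ring
  set G : ℝ → ℂ := fun u => Complex.Gamma (s + u) * Complex.exp (-p u) with hG
  have hlim : ∀ u, Filter.Tendsto (fun n => g n u) Filter.atTop (nhds (G u)) := fun u =>
    (Complex.GammaSeq_tendsto_Gamma (s + u)).mul_const _
  have hy : 0 < |s.im| := by linarith
  -- near `u = 0` the increments of `G` are controlled by those of its approximants
  have hinc : ∀ᶠ u : ℝ in nhds 0, ‖G u - G 0‖ ≤ 8 / |s.im| * ‖G 0‖ * ‖u - 0‖ := by
    have hev : ∀ᶠ u : ℝ in nhds 0, |u| < min s.re (1 / 5) := by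
      have : Filter.Tendsto (fun u : ℝ => |u|) (nhds 0) (nhds |0|) := continuous_abs.tendsto 0
      rw [abs_zero] at this
      exact this.eventually_lt_const (lt_min hre (by norm_num))
    filter_upwards [hev] with u hu
    have hu1 : |u| ≤ s.re := (hu.trans_le (min_le_left _ _)).le
    have hu2 : |u| ≤ 1 / 5 := (hu.trans_le (min_le_right _ _)).le
    set B : ℕ → ℝ := fun n => 4 / |s.im| + (2 * ‖s‖ + 1) / n with hB
    have hBlim : Filter.Tendsto B Filter.atTop (nhds (4 / |s.im|)) := by
      have := (tendsto_const_div_atTop_nhds_zero_nat (2 * ‖s‖ + 1)).const_add (4 / |s.im|)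
      rwa [add_zero] at this
    have hB5 : ∀ᶠ n in Filter.atTop, B n < 5 := by
      refine hBlim.eventually_lt_const ?_
      rw [div_lt_iff₀ hy]
      linarith
    have hle : ∀ᶠ n in Filter.atTop, ‖g n u - g n 0‖ ≤ 2 * (B n * |u|) * ‖g n 0‖ := by
      filter_upwards [hB5, Filter.eventually_gt_atTop 0] with n hn5 hn
      rw [eq_mul_exp_integral (hkc n) (hgd n hn) 0 u]
      have hint : ‖∫ x in (0 : ℝ)..u, k n x‖ ≤ B n * |u| := by
        have := intervalIntegral.norm_integral_le_of_norm_le_const (a := 0) (b := u) (f := k n)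
          (C := B n) (fun x hx => hkb n hn x ?_)
        · simpa using this
        · refine le_trans ?_ hu1
          rw [Set.mem_uIoc] at hx
          rcases hx with hx | hx
          · rw [abs_of_pos hx.1, abs_of_pos (hx.1.trans_le hx.2)]; exact hx.2
          · rw [abs_of_nonpos hx.2, abs_of_neg (hx.1.trans_le hx.2)]; linarith [hx.1]
      have hsm : ‖∫ x in (0 : ℝ)..u, k n x‖ ≤ 1 := hint.trans (by
        have : 0 ≤ |u| := abs_nonneg u
        nlinarith)
      rw [← mul_sub_one, norm_mul, mul_comm]
      gcongr
      exact (Complex.norm_exp_sub_one_le hsm).trans (by gcongr)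
    have h1 : Filter.Tendsto (fun n => ‖g n u - g n 0‖) Filter.atTop (nhds ‖G u - G 0‖) :=
      ((hlim u).sub (hlim 0)).norm
    have h2 : Filter.Tendsto (fun n => 2 * (B n * |u|) * ‖g n 0‖) Filter.atTop
        (nhds (2 * (4 / |s.im| * |u|) * ‖G 0‖)) :=
      ((hBlim.mul_const _).const_mul 2).mul (hlim 0).norm
    have := le_of_tendsto_of_tendsto h1 h2 hle
    rw [sub_zero, Real.norm_eq_abs]
    exact this.trans (le_of_eq (by ring))
  have hΓ : Complex.Gamma s ≠ 0 := Complex.Gamma_ne_zero_of_re_pos hre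
  have hGd : HasDerivAt G ((Complex.digamma s - Complex.log s) * G 0) 0 := by
    have hs0 : s + ((0 : ℝ) : ℂ) = s := by simp
    have hdG : HasDerivAt Complex.Gamma (deriv Complex.Gamma s) (s + ((0 : ℝ) : ℂ)) := by
      rw [hs0]
      refine (Complex.differentiableAt_Gamma s fun m h => ?_).hasDerivAt
      rw [h] at him0
      simp at him0
    have := (hdG.comp (0 : ℝ) (hadd 0)).fun_mul (hpd 0).fun_neg.cexp
    refine HasDerivAt.congr_deriv this ?_
    simp only [hG, Complex.digamma_def, logDeriv_apply, hs0, Function.comp]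
    field_simp
    ring
  have hfin := hGd.le_of_lip' (by positivity) hinc
  have hG0 : 0 < ‖G 0‖ := by
    simp only [hG, Complex.ofReal_zero, add_zero, norm_mul]
    exact mul_pos (norm_pos_iff.2 hΓ) (norm_pos_iff.2 (Complex.exp_ne_zero _))
  rw [norm_mul] at hfin
  exact le_of_mul_le_mul_right hfin hG0

/-! ### The factor of the functional equation -/

/-- An open set, stable under `s ↦ 1 - s` and complex conjugation, on which `Δ` is holomorphic and
has no zeros: the points off the real axis together with the open critical strip. -/
def regularSet : Set ℂ := {s | s.im ≠ 0 ∨ (0 < s.re ∧ s.re < 1)}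

theorem isOpen_regularSet : IsOpen regularSet :=
  (isOpen_ne_fun Complex.continuous_im continuous_const).union
    ((isOpen_lt continuous_const Complex.continuous_re).inter
      (isOpen_lt Complex.continuous_re continuous_const))

theorem one_sub_mem_regularSet {s : ℂ} (hs : s ∈ regularSet) : 1 - s ∈ regularSet := by
  rcases hs with h | ⟨h1, h2⟩
  · exact Or.inl (by simpa using h)
  · exact Or.inr (by simpa using ⟨h2, h1⟩)

theorem conj_mem_regularSet {s : ℂ} (hs : s ∈ regularSet) :
    (starRingEnd ℂ) s ∈ regularSet := by
  rcases hs with h | h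
  · exact Or.inl (by simpa using h)
  · exact Or.inr (by simpa using h)

theorem ne_intCast_of_mem_regularSet {s : ℂ} (hs : s ∈ regularSet) (k : ℤ) : s ≠ k := by
  rintro rfl
  rcases hs with h | ⟨h1, h2⟩
  · simp at h
  · simp only [Complex.intCast_re] at h1 h2
    have : (0 : ℤ) < k := by exact_mod_cast h1
    have : k < (1 : ℤ) := by exact_mod_cast h2
    omega

theorem half_add_mem_regularSet (t : ℝ) : 1 / 2 + Complex.I * t ∈ regularSet :=
  Or.inr (by norm_num)

theorem ne_neg_natCast_of_mem_regularSet {s : ℂ} (hs : s ∈ regularSet) (m : ℕ) : s ≠ -m := by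
  simpa using ne_intCast_of_mem_regularSet hs (-m)

theorem sin_pi_mul_ne_zero {s : ℂ} (hs : s ∈ regularSet) : Complex.sin (Real.pi * s) ≠ 0 := by
  rw [Complex.sin_ne_zero_iff]
  intro k hk
  refine ne_intCast_of_mem_regularSet hs k ?_
  have : (Real.pi : ℂ) ≠ 0 := by exact_mod_cast Real.pi_ne_zero
  exact mul_left_cancel₀ this (by rw [hk]; ring)

theorem sin_pi_mul_eq (s : ℂ) : Complex.sin (Real.pi * s) =
    2 * Complex.sin (Real.pi * s / 2) * Complex.cos (Real.pi * s / 2) := by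
  rw [← Complex.sin_two_mul]
  congr 1
  ring

theorem sin_pi_mul_half_ne_zero {s : ℂ} (hs : s ∈ regularSet) :
    Complex.sin (Real.pi * s / 2) ≠ 0 := by
  have := sin_pi_mul_ne_zero hs
  rw [sin_pi_mul_eq] at this
  intro h
  simp [h] at this

theorem hasDerivAt_Delta {s : ℂ} (hs : s ∈ regularSet) :
    HasDerivAt Delta ((Complex.log 2 + Complex.log Real.pi - Complex.digamma (1 - s) +
      Real.pi / 2 * Complex.cot (Real.pi * s / 2)) * Delta s) s := by
  have hpi : (Real.pi : ℂ) ≠ 0 := by exact_mod_cast Real.pi_ne_zero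
  have hs1 := one_sub_mem_regularSet hs
  have h1 : HasDerivAt (fun z : ℂ => (2 : ℂ) ^ z) (2 ^ s * Complex.log 2) s := by
    simpa using (hasDerivAt_id s).const_cpow (Or.inl (two_ne_zero (α := ℂ)))
  have h2 : HasDerivAt (fun z : ℂ => (Real.pi : ℂ) ^ (z - 1))
      ((Real.pi : ℂ) ^ (s - 1) * Complex.log Real.pi) s := by
    simpa using ((hasDerivAt_id s).sub_const 1).const_cpow (Or.inl hpi)
  have hΓ : Complex.Gamma (1 - s) ≠ 0 :=
    Complex.Gamma_ne_zero (ne_neg_natCast_of_mem_regularSet hs1)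
  have h3 : HasDerivAt (fun z : ℂ => Complex.Gamma (1 - z))
      (-(Complex.digamma (1 - s) * Complex.Gamma (1 - s))) s := by
    have hd := (Complex.differentiableAt_Gamma _
      (ne_neg_natCast_of_mem_regularSet hs1)).hasDerivAt
    have := hd.comp s ((hasDerivAt_id s).const_sub 1)
    refine HasDerivAt.congr_deriv this ?_
    rw [Complex.digamma_def, logDeriv_apply]
    field_simp
  have h4 : HasDerivAt (fun z : ℂ => Complex.sin (Real.pi * z / 2))
      (Complex.cos (Real.pi * s / 2) * (Real.pi / 2)) s := by
    have : HasDerivAt (fun z : ℂ => Real.pi * z / 2) (Real.pi / 2 : ℂ) s := by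
      simpa using ((hasDerivAt_id s).const_mul (Real.pi : ℂ)).div_const 2
    exact this.csin
  have hsin := sin_pi_mul_half_ne_zero hs
  have := ((h1.fun_mul h2).fun_mul h3).fun_mul h4
  refine HasDerivAt.congr_deriv this ?_
  rw [Complex.cot_eq_cos_div_sin]
  unfold Delta
  generalize Complex.sin (Real.pi * s / 2) = S at hsin ⊢
  generalize Complex.cos (Real.pi * s / 2) = C
  field_simp
  ring

theorem Delta_ne_zero {s : ℂ} (hs : s ∈ regularSet) : Delta s ≠ 0 := by
  have hpi : (Real.pi : ℂ) ≠ 0 := by exact_mod_cast Real.pi_ne_zero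
  unfold Delta
  refine mul_ne_zero (mul_ne_zero (mul_ne_zero ?_ ?_) ?_) (sin_pi_mul_half_ne_zero hs)
  · rw [Complex.cpow_ne_zero_iff]; exact Or.inl two_ne_zero
  · rw [Complex.cpow_ne_zero_iff]; exact Or.inl hpi
  · exact Complex.Gamma_ne_zero (ne_neg_natCast_of_mem_regularSet (one_sub_mem_regularSet hs))

theorem Delta_mul_Delta_one_sub {s : ℂ} (hs : s ∈ regularSet) :
    Delta s * Delta (1 - s) = 1 := by
  have hpi : (Real.pi : ℂ) ≠ 0 := by exact_mod_cast Real.pi_ne_zero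
  have hsin := sin_pi_mul_ne_zero hs
  have e1 : Complex.sin (Real.pi * (1 - s) / 2) = Complex.cos (Real.pi * s / 2) := by
    rw [← Complex.sin_pi_div_two_sub]
    congr 1
    ring
  have e2 : (2 : ℂ) ^ (1 - s) = 2 * (2 ^ s)⁻¹ := by
    rw [Complex.cpow_sub _ _ two_ne_zero, Complex.cpow_one]; rfl
  have e3 : (Real.pi : ℂ) ^ (1 - s - 1) = ((Real.pi : ℂ) ^ (s - 1))⁻¹ * (Real.pi : ℂ)⁻¹ := by
    rw [← Complex.cpow_neg, ← Complex.cpow_neg_one, ← Complex.cpow_add _ _ hpi]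
    congr 1
    ring
  have h2 : (2 : ℂ) ^ s ≠ 0 := by rw [Complex.cpow_ne_zero_iff]; exact Or.inl two_ne_zero
  have h3 : (Real.pi : ℂ) ^ (s - 1) ≠ 0 := by rw [Complex.cpow_ne_zero_iff]; exact Or.inl hpi
  have hr := Complex.Gamma_mul_Gamma_one_sub s
  rw [sin_pi_mul_eq] at hr hsin
  unfold Delta
  rw [e1, e2, e3, sub_sub_cancel]
  calc _ = (2 ^ s * ((2 : ℂ) ^ s)⁻¹) * ((Real.pi : ℂ) ^ (s - 1) * ((Real.pi : ℂ) ^ (s - 1))⁻¹) *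
        (Complex.Gamma s * Complex.Gamma (1 - s)) * (2 * Complex.sin (Real.pi * s / 2) *
          Complex.cos (Real.pi * s / 2)) * (Real.pi : ℂ)⁻¹ := by ring
    _ = 1 := by
      rw [hr, mul_inv_cancel₀ h2, mul_inv_cancel₀ h3, one_mul, one_mul, div_mul_cancel₀ _ hsin,
        mul_inv_cancel₀ hpi]

theorem Delta_conj (s : ℂ) : Delta ((starRingEnd ℂ) s) = (starRingEnd ℂ) (Delta s) := by
  have h2 : (2 : ℂ).arg ≠ Real.pi := by
    rw [show (2 : ℂ) = ((2 : ℝ) : ℂ) by norm_num, Complex.arg_ofReal_of_nonneg (by norm_num)]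
    exact Real.pi_ne_zero.symm
  have hp : (Real.pi : ℂ).arg ≠ Real.pi := by
    rw [Complex.arg_ofReal_of_nonneg Real.pi_nonneg]
    exact Real.pi_ne_zero.symm
  have c2 := Complex.cpow_conj 2 s h2
  have cp := Complex.cpow_conj Real.pi (s - 1) hp
  have e2 : (starRingEnd ℂ) (2 : ℂ) = 2 := Complex.conj_ofNat 2
  rw [e2] at c2
  rw [Complex.conj_ofReal] at cp
  unfold Delta
  simp only [map_mul]
  rw [← Complex.Gamma_conj, ← Complex.sin_conj, ← c2, ← cp]
  simp only [map_sub, map_mul, map_div₀, map_one, Complex.conj_ofReal, e2]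

theorem conj_half_add (t : ℝ) : (starRingEnd ℂ) (1 / 2 + Complex.I * t) = 1 / 2 - Complex.I * t := by
  simp [Complex.conj_ofNat, sub_eq_add_neg]

theorem norm_Delta_half (t : ℝ) : ‖Delta (1 / 2 + Complex.I * t)‖ = 1 := by
  have h := Delta_mul_Delta_one_sub (half_add_mem_regularSet t)
  have e : 1 - (1 / 2 + Complex.I * t) = (starRingEnd ℂ) (1 / 2 + Complex.I * t) := by
    rw [conj_half_add]; ring
  rw [e, Delta_conj, Complex.mul_conj, Complex.normSq_eq_norm_sq] at h
  have : ‖Delta (1 / 2 + Complex.I * t)‖ ^ 2 = 1 := by exact_mod_cast h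
  exact (pow_eq_one_iff_of_nonneg (norm_nonneg _) two_ne_zero).1 this

theorem riemannZeta_eq_Delta_mul {s : ℂ} (hs : s ∈ regularSet) :
    riemannZeta s = Delta s * riemannZeta (1 - s) := by
  have hpi : (Real.pi : ℂ) ≠ 0 := by exact_mod_cast Real.pi_ne_zero
  have hs1 := one_sub_mem_regularSet hs
  have h := riemannZeta_one_sub (s := 1 - s) (ne_neg_natCast_of_mem_regularSet hs1)
    (by simpa using ne_intCast_of_mem_regularSet hs1 1)
  rw [sub_sub_cancel] at h
  have e1 : Complex.cos (Real.pi * (1 - s) / 2) = Complex.sin (Real.pi * s / 2) := by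
    rw [← Complex.cos_pi_div_two_sub]
    congr 1
    ring
  have e2 : (2 * (Real.pi : ℂ)) ^ (-(1 - s)) = 2 ^ s * 2⁻¹ * (Real.pi : ℂ) ^ (s - 1) := by
    have : (2 * (Real.pi : ℂ)) = ((2 : ℝ) : ℂ) * ((Real.pi : ℝ) : ℂ) := by norm_num
    rw [this, Complex.mul_cpow_ofReal_nonneg (by norm_num) Real.pi_nonneg]
    congr 1
    · rw [show -(1 - s) = s + (-1) by ring, Complex.cpow_add _ _ (by norm_num),
        Complex.cpow_neg_one]
      norm_num
    · congr 1
      ring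
  rw [h, e1, e2]
  unfold Delta
  ring

/-- `Λ = -Δ'/Δ`, the negative logarithmic derivative of `Δ`. -/
noncomputable def Lam (s : ℂ) : ℂ := -logDeriv Delta s

theorem hasDerivAt_Delta' {s : ℂ} (hs : s ∈ regularSet) :
    HasDerivAt Delta (-Lam s * Delta s) s := by
  have := (hasDerivAt_Delta hs).differentiableAt.hasDerivAt
  refine HasDerivAt.congr_deriv this ?_
  have := Delta_ne_zero hs
  rw [Lam, logDeriv_apply]
  field_simp

theorem Lam_eq {s : ℂ} (hs : s ∈ regularSet) :
    Lam s = -(Complex.log 2 + Complex.log Real.pi - Complex.digamma (1 - s) +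
      Real.pi / 2 * Complex.cot (Real.pi * s / 2)) := by
  rw [Lam, logDeriv_apply, (hasDerivAt_Delta hs).deriv, mul_div_assoc, div_self (Delta_ne_zero hs),
    mul_one]

theorem Lam_one_sub {s : ℂ} (hs : s ∈ regularSet) : Lam (1 - s) = Lam s := by
  have hs1 := one_sub_mem_regularSet hs
  have h1 := (hasDerivAt_Delta' hs1).comp s ((hasDerivAt_id s).const_sub 1)
  have h2 := (hasDerivAt_Delta' hs).fun_mul h1
  have h3 : HasDerivAt (fun z => Delta z * (Delta ∘ fun z => 1 - id z) z) 0 s := by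
    refine HasDerivAt.congr_of_eventuallyEq (hasDerivAt_const s (1 : ℂ)) ?_
    filter_upwards [isOpen_regularSet.mem_nhds hs] with z hz
    exact Delta_mul_Delta_one_sub hz
  have h4 := h2.unique h3
  have e := Delta_mul_Delta_one_sub hs
  simp only [Function.comp] at h4
  have : (Lam (1 - s) - Lam s) * (Delta s * Delta (1 - s)) = 0 := by rw [← h4]; ring
  rw [e, mul_one] at this
  exact sub_eq_zero.1 this

theorem Lam_conj {s : ℂ} (hs : s ∈ regularSet) :
    Lam ((starRingEnd ℂ) s) = (starRingEnd ℂ) (Lam s) := by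
  have h1 := (hasDerivAt_Delta' hs).conj_conj
  have e : (starRingEnd ℂ ∘ Delta ∘ starRingEnd ℂ) = Delta := by
    funext z
    simp [Delta_conj]
  rw [e] at h1
  have h2 := h1.unique (hasDerivAt_Delta' (conj_mem_regularSet hs))
  rw [Delta_conj, map_mul, map_neg] at h2
  have := mul_right_cancel₀ ((map_ne_zero _).2 (Delta_ne_zero hs)) h2
  exact (neg_injective this).symm

theorem differentiableOn_Delta : DifferentiableOn ℂ Delta regularSet := fun _ hs =>
  (hasDerivAt_Delta hs).differentiableAt.differentiableWithinAt

theorem differentiableOn_Lam : DifferentiableOn ℂ Lam regularSet :=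
  ((differentiableOn_Delta.deriv isOpen_regularSet).div differentiableOn_Delta
    fun _ hs => Delta_ne_zero hs).neg

theorem continuousOn_Lam : ContinuousOn Lam regularSet := differentiableOn_Lam.continuousOn

/-- `Λ` is real on the critical line. -/
theorem Lam_half_eq_re (t : ℝ) :
    Lam (1 / 2 + Complex.I * t) = ((Lam (1 / 2 + Complex.I * t)).re : ℂ) := by
  have hs := half_add_mem_regularSet t
  have h := Lam_conj hs
  rw [conj_half_add, show 1 / 2 - Complex.I * t = 1 - (1 / 2 + Complex.I * t) by ring,
    Lam_one_sub hs] at h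
  exact (Complex.conj_eq_iff_re.1 h.symm).symm

/-! ### Asymptotics of `Λ` and the size of `Δ` in a vertical strip -/

/-- The cotangent tends to `-i` in the upper half-plane. -/
theorem norm_cot_add_I_le {z : ℂ} (hz : 0 < z.im) : ‖Complex.cot z + Complex.I‖ ≤ 1 / z.im := by
  set y := z.im with hy
  have hE : ‖Complex.exp (z * Complex.I)‖ = Real.exp (-y) := by
    rw [Complex.norm_exp]; simp [hy]
  have hE' : ‖Complex.exp (-z * Complex.I)‖ = Real.exp y := by
    rw [Complex.norm_exp]; simp [hy]
  have hlt : Real.exp (-y) < Real.exp y := Real.exp_lt_exp.2 (by linarith)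
  have hsin : (Real.exp y - Real.exp (-y)) / 2 ≤ ‖Complex.sin z‖ := by
    have : Complex.sin z = (Complex.exp (-z * Complex.I) - Complex.exp (z * Complex.I)) *
        Complex.I / 2 := rfl
    rw [this, norm_div, norm_mul, Complex.norm_I, mul_one, Complex.norm_ofNat]
    gcongr
    rw [← hE, ← hE']
    exact norm_sub_norm_le _ _
  have hs0 : Complex.sin z ≠ 0 := by
    intro h
    rw [h, norm_zero] at hsin
    linarith
  have e : Complex.cot z + Complex.I = Complex.exp (z * Complex.I) / Complex.sin z := by
    rw [Complex.cot_eq_cos_div_sin, Complex.exp_mul_I]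
    field_simp
  rw [e, norm_div, hE, div_le_div_iff₀ (norm_pos_iff.2 hs0) hz, one_mul]
  refine le_trans ?_ hsin
  have h2 : 2 * y + 1 ≤ Real.exp y * Real.exp y := by
    rw [← Real.exp_add, ← two_mul]; exact Real.add_one_le_exp _
  have h3 : Real.exp y = Real.exp y * Real.exp y * Real.exp (-y) := by
    rw [mul_assoc, ← Real.exp_add, add_neg_cancel, Real.exp_zero, mul_one]
  nlinarith [Real.exp_pos (-y)]

theorem norm_log_sub_mul_I_sub_le {a t : ℝ} (ha : 0 ≤ a) (ht : 0 < t) :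
    ‖Complex.log (a - t * Complex.I) - (Real.log t - Real.pi / 2 * Complex.I)‖ ≤ a / t := by
  have h0 : Complex.log (-(t * Complex.I)) = Real.log t - Real.pi / 2 * Complex.I := by
    rw [← mul_neg, Complex.log_ofReal_mul ht (neg_ne_zero.2 Complex.I_ne_zero), Complex.log_neg_I]
    ring
  have hsl : ∀ u : ℝ, -(t * Complex.I) + u * a ∈ Complex.slitPlane := fun u =>
    Or.inr (by simpa using ht.ne')
  have hd : ∀ u ∈ Set.Icc (0 : ℝ) 1, HasDerivWithinAt
      (fun u : ℝ => Complex.log (-(t * Complex.I) + u * a)) (a / (-(t * Complex.I) + u * a))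
      (Set.Icc 0 1) u := by
    intro u _
    have h1 : HasDerivAt (fun u : ℝ => -(t * Complex.I) + (u : ℂ) * a) a u := by
      simpa using ((Complex.ofRealCLM.hasDerivAt (x := u)).mul_const (a : ℂ)).const_add
        (-(t * Complex.I))
    exact (h1.clog_real (hsl u)).hasDerivWithinAt
  have := norm_image_sub_le_of_norm_deriv_le_segment_01' (C := a / t) hd ?_
  · rw [← h0]
    refine le_trans (le_of_eq (congrArg norm ?_)) this
    simp only [Complex.ofReal_one, one_mul, Complex.ofReal_zero, zero_mul, add_zero]
    congr 2
    ring
  · intro u _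
    rw [norm_div, Complex.norm_real, Real.norm_of_nonneg ha]
    gcongr
    refine le_trans ?_ (Complex.abs_im_le_norm _)
    simp [abs_of_pos ht]

theorem add_mul_I_mem_regularSet (σ : ℝ) {t : ℝ} (ht : t ≠ 0) :
    (σ : ℂ) + t * Complex.I ∈ regularSet := Or.inl (by simpa using ht)

theorem norm_Lam_sub_log_le_of_le_half {σ t : ℝ} (h1 : -1 / 2 ≤ σ) (h2 : σ ≤ 1 / 2) (ht : 1 ≤ t) :
    ‖Lam (σ + t * Complex.I) - Real.log (t / (2 * Real.pi))‖ ≤ 11 / t := by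
  have ht0 : 0 < t := by linarith
  have hpi := Real.pi_pos
  rw [Lam_eq (add_mul_I_mem_regularSet σ ht0.ne')]
  set s : ℂ := σ + t * Complex.I with hs
  have e1 : 1 - s = ((1 - σ : ℝ) : ℂ) - t * Complex.I := by rw [hs]; push_cast; ring
  have him : |(1 - s).im| = t := by rw [e1]; simp [abs_of_pos ht0]
  have hre : 0 < (1 - s).re := by rw [e1]; simp; linarith
  have hψ := norm_digamma_sub_log_le hre (by rw [him]; exact ht)
  rw [him] at hψ
  have hlog := norm_log_sub_mul_I_sub_le (a := 1 - σ) (by linarith) ht0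
  rw [← e1] at hlog
  have hzim : (Real.pi * s / 2).im = Real.pi * t / 2 := by
    rw [hs, show (Real.pi : ℂ) * (σ + t * Complex.I) / 2 =
      ((Real.pi * σ / 2 : ℝ) : ℂ) + ((Real.pi * t / 2 : ℝ) : ℂ) * Complex.I by push_cast; ring]
    simp only [Complex.add_im, Complex.ofReal_im, Complex.mul_im, Complex.ofReal_re, Complex.I_im,
      Complex.I_re, mul_one, mul_zero, zero_add, add_zero]
  have hcot := norm_cot_add_I_le (z := Real.pi * s / 2) (by rw [hzim]; positivity)
  rw [hzim] at hcot
  have hL : (Real.log (t / (2 * Real.pi)) : ℂ) =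
      Real.log t - (Complex.log 2 + Complex.log Real.pi) := by
    rw [Real.log_div ht0.ne' (by positivity), Real.log_mul two_ne_zero hpi.ne']
    push_cast [Complex.ofReal_log hpi.le]
    rw [show Complex.log 2 = ((Real.log 2 : ℝ) : ℂ) by
      rw [Complex.ofReal_log (by norm_num)]; norm_num]
  have e2 : -(Complex.log 2 + Complex.log Real.pi - Complex.digamma (1 - s) +
      Real.pi / 2 * Complex.cot (Real.pi * s / 2)) - Real.log (t / (2 * Real.pi)) =
      (Complex.digamma (1 - s) - Complex.log (1 - s)) +
      (Complex.log (1 - s) - (Real.log t - Real.pi / 2 * Complex.I)) -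
      Real.pi / 2 * (Complex.cot (Real.pi * s / 2) + Complex.I) := by
    rw [hL]; ring
  have hcot' : ‖(Real.pi / 2 : ℂ) * (Complex.cot (Real.pi * s / 2) + Complex.I)‖ ≤ 1 / t := by
    rw [norm_mul, norm_div, Complex.norm_real, Complex.norm_ofNat, Real.norm_of_nonneg hpi.le]
    calc _ ≤ Real.pi / 2 * (1 / (Real.pi * t / 2)) := by gcongr
      _ = 1 / t := by field_simp
  rw [e2]
  calc _ ≤ 8 / t + (1 - σ) / t + 1 / t :=
        (norm_sub_le _ _).trans (add_le_add ((norm_add_le _ _).trans (add_le_add hψ hlog)) hcot')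
    _ = (8 + (1 - σ) + 1) / t := by ring
    _ ≤ 11 / t := by gcongr; linarith

theorem conj_one_sub (σ t : ℝ) : (starRingEnd ℂ) (1 - (σ + t * Complex.I)) =
    ((1 - σ : ℝ) : ℂ) + t * Complex.I := by
  simp
  ring

theorem Lam_one_sub_add_mul_I (σ : ℝ) {t : ℝ} (ht : t ≠ 0) :
    Lam (((1 - σ : ℝ) : ℂ) + t * Complex.I) = (starRingEnd ℂ) (Lam (σ + t * Complex.I)) := by
  have hs := add_mul_I_mem_regularSet σ ht
  rw [← conj_one_sub, Lam_conj (one_sub_mem_regularSet hs), Lam_one_sub hs]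

/-- `Λ(σ + it) = log (t / 2π) + O(1 / t)`. The symmetry `Λ(1 - s) = Λ(s)` reduces this to `σ ≤ 1/2`,
where `1 - s` lies in the right half-plane. -/
theorem norm_Lam_sub_log_le {σ t : ℝ} (h1 : -1 / 2 ≤ σ) (h2 : σ ≤ 3 / 2) (ht : 1 ≤ t) :
    ‖Lam (σ + t * Complex.I) - Real.log (t / (2 * Real.pi))‖ ≤ 11 / t := by
  rcases le_total σ (1 / 2) with h | h
  · exact norm_Lam_sub_log_le_of_le_half h1 h ht
  · have := norm_Lam_sub_log_le_of_le_half (σ := 1 - σ) (by linarith) (by linarith) ht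
    rw [Lam_one_sub_add_mul_I σ (by linarith), ← Complex.norm_conj] at this
    simpa using this

theorem five_half_le_log_div {t : ℝ} (ht : 100 ≤ t) : 5 / 2 ≤ Real.log (t / (2 * Real.pi)) := by
  have hpi := Real.pi_pos
  have hpi' := Real.pi_lt_d2
  rw [Real.le_log_iff_exp_le (by positivity), le_div_iff₀ (by positivity)]
  have h1 : Real.exp (5 / 2) < 14 := by
    have h5 : Real.exp (5 / 2) ^ 2 = Real.exp 1 ^ 5 := by
      rw [← Real.exp_nat_mul, ← Real.exp_nat_mul]; norm_num
    have h6 : Real.exp 1 ^ 5 < 2.72 ^ 5 := by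
      gcongr
      exact Real.exp_one_lt_d9.trans (by norm_num)
    nlinarith [Real.exp_pos (5 / 2)]
  nlinarith [Real.exp_pos (5 / 2)]

theorem log_div_two_pi_le {t : ℝ} (ht : 0 < t) : Real.log (t / (2 * Real.pi)) ≤ Real.log t - 1 := by
  have hpi := Real.pi_gt_three
  have h1 : Real.log (t / (2 * Real.pi)) = Real.log t - Real.log (2 * Real.pi) :=
    Real.log_div ht.ne' (by positivity)
  have h2 : 1 ≤ Real.log (2 * Real.pi) := by
    rw [Real.le_log_iff_exp_le (by positivity)]
    have := Real.exp_one_lt_d9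
    linarith
  linarith

theorem norm_Lam_le_log {σ t : ℝ} (h1 : -1 / 2 ≤ σ) (h2 : σ ≤ 3 / 2) (ht : 100 ≤ t) :
    ‖Lam (σ + t * Complex.I)‖ ≤ Real.log t := by
  have h := norm_Lam_sub_log_le h1 h2 (by linarith)
  have h3 : 11 / t ≤ 1 := by rw [div_le_one (by linarith)]; linarith
  have h4 := five_half_le_log_div ht
  have h5 := log_div_two_pi_le (t := t) (by linarith)
  have h6 := norm_le_norm_add_norm_sub (Real.log (t / (2 * Real.pi)) : ℂ) (Lam (σ + t * Complex.I))
  rw [Complex.norm_real, Real.norm_of_nonneg (by linarith), norm_sub_rev] at h6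
  linarith

theorem two_le_re_Lam {σ t : ℝ} (h1 : -1 / 2 ≤ σ) (h2 : σ ≤ 3 / 2) (ht : 100 ≤ t) :
    2 ≤ (Lam (σ + t * Complex.I)).re := by
  have h := norm_Lam_sub_log_le h1 h2 (by linarith)
  have h3 : 11 / t ≤ 1 / 2 := by rw [div_le_div_iff₀ (by linarith) (by norm_num)]; linarith
  have h4 := five_half_le_log_div ht
  have h5 := (abs_le.1 ((Complex.abs_re_le_norm _).trans h)).1
  simp only [Complex.sub_re, Complex.ofReal_re] at h5
  linarith

theorem Lam_ne_zero {σ t : ℝ} (h1 : -1 / 2 ≤ σ) (h2 : σ ≤ 3 / 2) (ht : 100 ≤ t) :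
    Lam (σ + t * Complex.I) ≠ 0 := by
  intro h
  have := two_le_re_Lam h1 h2 ht
  rw [h] at this
  norm_num at this

theorem continuous_Lam_horizontal {t : ℝ} (ht : t ≠ 0) :
    Continuous fun u : ℝ => Lam (u + t * Complex.I) :=
  continuousOn_Lam.comp_continuous (by fun_prop) fun u => add_mul_I_mem_regularSet u ht

theorem half_add_eq (t : ℝ) : 1 / 2 + Complex.I * t = ((1 / 2 : ℝ) : ℂ) + t * Complex.I := by
  push_cast; ring

/-- The variation of `Δ` along a horizontal segment starting on the critical line. -/
theorem exists_Delta_eq_mul_exp {σ t : ℝ} (h1 : -1 / 2 ≤ σ) (h2 : σ ≤ 3 / 2) (ht : 100 ≤ t) :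
    ∃ e : ℂ, ‖e‖ ≤ 11 / t * |σ - 1 / 2| ∧ Delta (σ + t * Complex.I) =
      Delta (1 / 2 + Complex.I * t) *
        Complex.exp (-(((σ - 1 / 2) * Real.log (t / (2 * Real.pi)) : ℝ) + e)) := by
  have ht0 : t ≠ 0 := by linarith
  have hc := continuous_Lam_horizontal ht0
  have hD : ∀ u : ℝ, HasDerivAt (fun u : ℝ => Delta (u + t * Complex.I))
      (-Lam (u + t * Complex.I) * Delta (u + t * Complex.I)) u := by
    intro u
    have h := (hasDerivAt_Delta' (add_mul_I_mem_regularSet u ht0)).comp u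
      ((Complex.ofRealCLM.hasDerivAt (x := u)).add_const (t * Complex.I))
    refine HasDerivAt.congr_deriv h ?_
    simp
  have h := eq_mul_exp_integral hc.fun_neg hD (1 / 2) σ
  rw [← half_add_eq] at h
  set L : ℝ := Real.log (t / (2 * Real.pi)) with hL
  refine ⟨∫ u in (1 / 2 : ℝ)..σ, (Lam (u + t * Complex.I) - L), ?_, ?_⟩
  · refine intervalIntegral.norm_integral_le_of_norm_le_const fun u hu => ?_
    have hu' : u ∈ Set.uIcc (1 / 2) σ := Set.uIoc_subset_uIcc hu
    rw [Set.mem_uIcc] at hu'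
    refine norm_Lam_sub_log_le ?_ ?_ (by linarith)
    · rcases hu' with h | h <;> linarith [h.1]
    · rcases hu' with h | h <;> linarith [h.2]
  · rw [h]
    congr 2
    rw [intervalIntegral.integral_neg, intervalIntegral.integral_sub (hc.intervalIntegrable _ _)
      intervalIntegrable_const, intervalIntegral.integral_const]
    simp only [Complex.real_smul]
    push_cast
    ring

theorem norm_Delta_le_exp {σ t : ℝ} (h1 : -1 / 2 ≤ σ) (h2 : σ ≤ 3 / 2) (ht : 100 ≤ t) :
    ‖Delta (σ + t * Complex.I)‖ ≤
      Real.exp (-((σ - 1 / 2) * Real.log (t / (2 * Real.pi))) + 11 / t * |σ - 1 / 2|) := by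
  obtain ⟨e, he, h⟩ := exists_Delta_eq_mul_exp h1 h2 ht
  rw [h, norm_mul, norm_Delta_half, one_mul, Complex.norm_exp]
  gcongr
  simp only [Complex.neg_re, Complex.add_re, Complex.ofReal_re]
  have := (abs_le.1 ((Complex.abs_re_le_norm e).trans he)).1
  linarith

theorem norm_Delta_lt_one {σ t : ℝ} (h1 : 1 / 2 < σ) (h2 : σ ≤ 3 / 2) (ht : 100 ≤ t) :
    ‖Delta (σ + t * Complex.I)‖ < 1 := by
  refine (norm_Delta_le_exp (by linarith) h2 ht).trans_lt ?_
  rw [Real.exp_lt_one_iff, abs_of_pos (by linarith)]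
  have h3 : 11 / t ≤ 1 / 2 := by rw [div_le_div_iff₀ (by linarith) (by norm_num)]; linarith
  have h4 := five_half_le_log_div ht
  nlinarith

/-- `|Δ(σ + it)| |Δ(1 - σ + it)| = 1`: the two vertical sides of the contour mirror each other. -/
theorem norm_Delta_one_sub (σ : ℝ) {t : ℝ} (ht : t ≠ 0) :
    ‖Delta (σ + t * Complex.I)‖ * ‖Delta (((1 - σ : ℝ) : ℂ) + t * Complex.I)‖ = 1 := by
  rw [← conj_one_sub, Delta_conj, Complex.norm_conj, ← norm_mul,
    Delta_mul_Delta_one_sub (add_mul_I_mem_regularSet σ ht), norm_one]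

theorem one_lt_norm_Delta {σ t : ℝ} (h1 : -1 / 2 ≤ σ) (h2 : σ < 1 / 2) (ht : 100 ≤ t) :
    1 < ‖Delta (σ + t * Complex.I)‖ := by
  have h := norm_Delta_one_sub σ (t := t) (by linarith)
  have h3 := norm_Delta_lt_one (σ := 1 - σ) (by linarith) (by linarith) ht
  have h4 := norm_nonneg (Delta (σ + t * Complex.I))
  nlinarith [norm_nonneg (Delta (((1 - σ : ℝ) : ℂ) + t * Complex.I))]

theorem norm_Delta_le_div_sqrt {σ t : ℝ} (h1 : 1 ≤ σ) (h2 : σ ≤ 3 / 2) (ht : 100 ≤ t) :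
    ‖Delta (σ + t * Complex.I)‖ ≤ 3 / Real.sqrt t := by
  have ht0 : 0 < t := by linarith
  have hpi := Real.pi_pos
  have hpi' := Real.pi_lt_d2
  refine (norm_Delta_le_exp (by linarith) h2 ht).trans ?_
  have h3 : 11 / t ≤ 11 / 100 := by gcongr
  have h4 := five_half_le_log_div ht
  rw [abs_of_pos (by linarith)]
  have h5 : -((σ - 1 / 2) * Real.log (t / (2 * Real.pi))) + 11 / t * (σ - 1 / 2) ≤
      -(1 / 2 * Real.log (t / (2 * Real.pi))) + 11 / 200 := by
    nlinarith
  refine (Real.exp_le_exp.2 h5).trans ?_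
  rw [le_div_iff₀ (Real.sqrt_pos.2 ht0), ← sq_le_sq₀ (by positivity) (by norm_num), mul_pow,
    Real.sq_sqrt ht0.le, ← Real.exp_nat_mul]
  have h6 : ((2 : ℕ) : ℝ) * (-(1 / 2 * Real.log (t / (2 * Real.pi))) + 11 / 200) =
      -Real.log (t / (2 * Real.pi)) + 11 / 100 := by push_cast; ring
  rw [h6, Real.exp_add, Real.exp_neg, Real.exp_log (by positivity)]
  have h7 : Real.exp (11 / 100) ≤ 100 / 89 := by
    have := Real.one_sub_le_exp_neg (11 / 100)
    rw [Real.exp_neg] at this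
    rw [show (100 / 89 : ℝ) = (89 / 100)⁻¹ by norm_num]
    refine (le_inv_comm₀ (by norm_num) (Real.exp_pos _)).1 ?_
    linarith
  have h8 : (t / (2 * Real.pi))⁻¹ * Real.exp (11 / 100) * t = 2 * Real.pi * Real.exp (11 / 100) := by
    field_simp
  rw [h8]
  nlinarith

theorem norm_Delta_le_half {σ t : ℝ} (h1 : 1 ≤ σ) (h2 : σ ≤ 3 / 2) (ht : 100 ≤ t) :
    ‖Delta (σ + t * Complex.I)‖ ≤ 1 / 2 := by
  refine (norm_Delta_le_div_sqrt h1 h2 ht).trans ?_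
  have : 10 ≤ Real.sqrt t := Real.le_sqrt_of_sq_le (by linarith)
  rw [div_le_div_iff₀ (by linarith) (by norm_num)]
  linarith

theorem max_le_norm_one_add {q : ℂ} (hq : 0 ≤ q.re) : max 1 ‖q‖ ≤ ‖1 + q‖ := by
  have h : ‖1 + q‖ ^ 2 = 1 + 2 * q.re + ‖q‖ ^ 2 := by
    rw [Complex.sq_norm, Complex.sq_norm, Complex.normSq_apply, Complex.normSq_apply]
    simp
    ring
  apply max_le
  · rw [← sq_le_sq₀ zero_le_one (norm_nonneg _)]
    nlinarith [norm_nonneg q]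
  · rw [← sq_le_sq₀ (norm_nonneg _) (norm_nonneg _)]
    nlinarith

/-- On a horizontal line through a point of the critical line where `Δ = -w`, the values of `Δ`
stay away from `w`, because the argument of `Δ` hardly varies along the line. -/
theorem max_le_norm_Delta_sub {σ t : ℝ} {w : ℂ} (hw : ‖w‖ = 1) (h1 : -1 / 2 ≤ σ) (h2 : σ ≤ 3 / 2)
    (ht : 100 ≤ t) (hD : Delta (1 / 2 + Complex.I * t) = -w) :
    max 1 ‖Delta (σ + t * Complex.I)‖ ≤ ‖Delta (σ + t * Complex.I) - w‖ := by
  obtain ⟨e, he, h⟩ := exists_Delta_eq_mul_exp h1 h2 ht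
  rw [hD] at h
  set q := Complex.exp (-(((σ - 1 / 2) * Real.log (t / (2 * Real.pi)) : ℝ) + e)) with hq
  have hqre : 0 ≤ q.re := by
    rw [hq, Complex.exp_re]
    refine mul_nonneg (Real.exp_pos _).le (Real.cos_nonneg_of_mem_Icc ?_)
    have h3 : 11 / t ≤ 1 := by rw [div_le_one (by linarith)]; linarith
    have h4 : |σ - 1 / 2| ≤ 1 := abs_le.2 ⟨by linarith, by linarith⟩
    have h5 : ‖e‖ ≤ 1 := he.trans (mul_le_one₀ h3 (abs_nonneg _) h4)
    have h6 := abs_le.1 ((Complex.abs_im_le_norm e).trans h5)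
    have hpi := Real.pi_gt_three
    simp only [Complex.neg_im, Complex.add_im, Complex.ofReal_im, zero_add]
    constructor <;> linarith [h6.1, h6.2]
  have e1 : ‖Delta (σ + t * Complex.I)‖ = ‖q‖ := by rw [h, norm_mul, norm_neg, hw, one_mul]
  have e2 : ‖Delta (σ + t * Complex.I) - w‖ = ‖1 + q‖ := by
    rw [h, show -w * q - w = -w * (1 + q) by ring, norm_mul, norm_neg, hw, one_mul]
  rw [e1, e2]
  exact max_le_norm_one_add hqre

/-! ### The argument of `Δ` on the critical line -/

theorem continuous_re_Lam_half : Continuous fun t : ℝ => (Lam (1 / 2 + Complex.I * t)).re :=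
  Complex.continuous_re.comp
    (continuousOn_Lam.comp_continuous (by fun_prop) fun t => half_add_mem_regularSet t)

theorem hasDerivAt_Delta_half (t : ℝ) : HasDerivAt (fun t : ℝ => Delta (1 / 2 + Complex.I * t))
    (-Complex.I * (Lam (1 / 2 + Complex.I * t)).re * Delta (1 / 2 + Complex.I * t)) t := by
  have h1 : HasDerivAt (fun t : ℝ => 1 / 2 + Complex.I * (t : ℂ)) Complex.I t := by
    simpa using ((Complex.ofRealCLM.hasDerivAt (x := t)).const_mul Complex.I).const_add (1 / 2 : ℂ)
  have h := (hasDerivAt_Delta' (half_add_mem_regularSet t)).comp t h1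
  refine HasDerivAt.congr_deriv h ?_
  rw [← Lam_half_eq_re]
  ring

/-- Along the critical line `Δ` moves on the unit circle with angular velocity `-Λ`. -/
theorem Delta_half_eq_mul_exp (a b : ℝ) : Delta (1 / 2 + Complex.I * b) =
    Delta (1 / 2 + Complex.I * a) *
      Complex.exp (-((∫ u in a..b, (Lam (1 / 2 + Complex.I * u)).re : ℝ) * Complex.I)) := by
  have hc : Continuous fun t : ℝ => -Complex.I * ((Lam (1 / 2 + Complex.I * t)).re : ℂ) :=
    continuous_const.mul (Complex.continuous_ofReal.comp continuous_re_Lam_half)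
  have h := eq_mul_exp_integral hc hasDerivAt_Delta_half a b
  rw [h, intervalIntegral.integral_const_mul, intervalIntegral.integral_ofReal]
  congr 2
  ring

/-! ### A bound for the zeta function to the right of the critical line -/

/-- `(s-1) ∫_n^{n+1} (n^{-s} - u^{-s}) du` in closed form; these are the terms of a series for
`(s-1) ζ(s)` that converges for `Re s > 0`. -/
noncomputable def zetaTerm (n : ℕ) (s : ℂ) : ℂ :=
  (s - 1) * (n : ℂ) ^ (-s) + ((n + 1 : ℕ) : ℂ) ^ (1 - s) - (n : ℂ) ^ (1 - s)

theorem natCast_add_mem_slitPlane {n : ℕ} (hn : 0 < n) {u : ℝ} (hu : 0 ≤ u) :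
    (n : ℂ) + u ∈ Complex.slitPlane := by
  left
  have : (0 : ℝ) < n := Nat.cast_pos.2 hn
  simp
  linarith

theorem hasDerivAt_natCast_add_cpow {n : ℕ} (hn : 0 < n) {u : ℝ} (hu : 0 ≤ u) (a : ℂ) :
    HasDerivAt (fun v : ℝ => ((n : ℂ) + v) ^ a) (a * ((n : ℂ) + u) ^ (a - 1)) u := by
  have h1 : HasDerivAt (fun v : ℂ => (n : ℂ) + v) 1 (u : ℂ) := (hasDerivAt_id _).const_add _
  have h2 := (h1.cpow_const (c := a) (natCast_add_mem_slitPlane hn hu)).comp_ofReal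
  simpa using h2

theorem norm_natCast_add_cpow {n : ℕ} (hn : 0 < n) {u : ℝ} (hu : 0 ≤ u) (a : ℂ) :
    ‖((n : ℂ) + u) ^ a‖ = ((n : ℝ) + u) ^ a.re := by
  have : (0 : ℝ) < n := Nat.cast_pos.2 hn
  rw [show (n : ℂ) + u = ((n + u : ℝ) : ℂ) by push_cast; rfl]
  exact Complex.norm_cpow_eq_rpow_re_of_pos (by linarith) a

theorem norm_natCast_add_cpow_sub_le {n : ℕ} (hn : 0 < n) {s : ℂ} (hs : 0 ≤ s.re) {u : ℝ}
    (hu : u ∈ Set.Icc (0 : ℝ) 1) :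
    ‖((n : ℂ) + u) ^ (-s) - (n : ℂ) ^ (-s)‖ ≤ ‖s‖ * (n : ℝ) ^ (-s.re - 1) := by
  have hn' : (0 : ℝ) < n := Nat.cast_pos.2 hn
  have h := norm_image_sub_le_of_norm_deriv_le_segment' (a := 0) (b := 1)
    (f := fun v : ℝ => ((n : ℂ) + v) ^ (-s)) (C := ‖s‖ * (n : ℝ) ^ (-s.re - 1))
    (fun v hv => (hasDerivAt_natCast_add_cpow hn hv.1 (-s)).hasDerivWithinAt) ?_ u hu
  · simp only [Complex.ofReal_zero, add_zero, sub_zero] at h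
    refine h.trans (mul_le_of_le_one_right (by positivity) hu.2)
  · intro v hv
    rw [norm_mul, norm_neg, norm_natCast_add_cpow hn hv.1]
    gcongr
    simp only [Complex.sub_re, Complex.neg_re, Complex.one_re]
    exact Real.rpow_le_rpow_of_nonpos hn' (by linarith [hv.1]) (by linarith)

theorem norm_zetaTerm_le {n : ℕ} (hn : 0 < n) {s : ℂ} (hs : 0 ≤ s.re) :
    ‖zetaTerm n s‖ ≤ ‖s - 1‖ * ‖s‖ * (n : ℝ) ^ (-s.re - 1) := by
  have hd : ∀ u ∈ Set.Icc (0 : ℝ) 1, HasDerivWithinAt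
      (fun u : ℝ => (s - 1) * ((u : ℂ) * (n : ℂ) ^ (-s)) + ((n : ℂ) + u) ^ (1 - s))
      ((s - 1) * ((n : ℂ) ^ (-s) - ((n : ℂ) + u) ^ (-s))) (Set.Icc 0 1) u := by
    intro u hu
    have h1 := hasDerivAt_natCast_add_cpow hn hu.1 (1 - s)
    have h2 : HasDerivAt (fun u : ℝ => (s - 1) * ((u : ℂ) * (n : ℂ) ^ (-s)))
        ((s - 1) * (n : ℂ) ^ (-s)) u := by
      simpa using ((Complex.ofRealCLM.hasDerivAt (x := u)).mul_const ((n : ℂ) ^ (-s))).const_mul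
        (s - 1)
    have h3 := h2.fun_add h1
    refine (HasDerivAt.congr_deriv h3 ?_).hasDerivWithinAt
    rw [show 1 - s - 1 = -s by ring]
    ring
  have h := norm_image_sub_le_of_norm_deriv_le_segment_01'
    (C := ‖s - 1‖ * ‖s‖ * (n : ℝ) ^ (-s.re - 1)) hd ?_
  · refine le_trans (le_of_eq (congrArg norm ?_)) h
    unfold zetaTerm
    push_cast
    ring_nf
  · intro u hu
    rw [norm_mul, mul_assoc, norm_sub_rev ((n : ℂ) ^ (-s))]
    gcongr
    exact norm_natCast_add_cpow_sub_le hn hs ⟨hu.1, hu.2.le⟩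

theorem summable_norm_zetaTerm_bound {a : ℝ} (ha : 0 < a) (K : ℝ) :
    Summable fun n : ℕ => K * ((n + 1 : ℕ) : ℝ) ^ (-a - 1) := by
  refine Summable.mul_left K ?_
  have := (summable_nat_add_iff 1).2 (Real.summable_nat_rpow.2 (by linarith : -a - 1 < -1))
  exact this

theorem summable_zetaTerm {s : ℂ} (hs : 0 < s.re) : Summable fun n : ℕ => zetaTerm (n + 1) s :=
  Summable.of_norm_bounded (summable_norm_zetaTerm_bound hs _)
    fun n => norm_zetaTerm_le n.succ_pos hs.le

theorem differentiable_zetaTerm {n : ℕ} (hn : 0 < n) : Differentiable ℂ (zetaTerm n) := by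
  have h0 : (n : ℂ) ≠ 0 := Nat.cast_ne_zero.2 hn.ne'
  have h1 : ((n + 1 : ℕ) : ℂ) ≠ 0 := Nat.cast_ne_zero.2 (by omega)
  have c1 : Differentiable ℂ fun s : ℂ => (n : ℂ) ^ (-s) := fun s =>
    differentiable_neg.differentiableAt.const_cpow (Or.inl h0)
  have c2 : Differentiable ℂ fun s : ℂ => ((n + 1 : ℕ) : ℂ) ^ (1 - s) := fun s =>
    ((differentiable_const (1 : ℂ)).fun_sub differentiable_id).differentiableAt.const_cpow
      (Or.inl h1)
  have c3 : Differentiable ℂ fun s : ℂ => (n : ℂ) ^ (1 - s) := fun s =>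
    ((differentiable_const (1 : ℂ)).fun_sub differentiable_id).differentiableAt.const_cpow
      (Or.inl h0)
  exact (((differentiable_id.sub_const 1).fun_mul c1).fun_add c2).fun_sub c3

theorem isOpen_re_pos : IsOpen {s : ℂ | 0 < s.re} := isOpen_lt continuous_const Complex.continuous_re

theorem differentiableOn_tsum_zetaTerm :
    DifferentiableOn ℂ (fun s => ∑' n : ℕ, zetaTerm (n + 1) s) {s | 0 < s.re} := by
  intro s hs
  have hs' : 0 < s.re := hs
  set V : Set ℂ := {z | s.re / 2 < z.re} ∩ Metric.ball 0 (‖s‖ + 1) with hV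
  have hVo : IsOpen V := (isOpen_lt continuous_const Complex.continuous_re).inter Metric.isOpen_ball
  have hsV : s ∈ V := ⟨by simp; linarith, by simp⟩
  have hd := Complex.differentiableOn_tsum_of_summable_norm (F := fun n z => zetaTerm (n + 1) z)
    (U := V) (summable_norm_zetaTerm_bound (a := s.re / 2) (by linarith)
      ((‖s‖ + 2) * (‖s‖ + 1)))
    (fun n => (differentiable_zetaTerm n.succ_pos).differentiableOn) hVo ?_
  · exact (hd.differentiableAt (hVo.mem_nhds hsV)).differentiableWithinAt
  · intro n z hz
    have hz1 : s.re / 2 < z.re := hz.1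
    have hz2 : ‖z‖ < ‖s‖ + 1 := by simpa using hz.2
    refine (norm_zetaTerm_le n.succ_pos (by linarith)).trans ?_
    have h1 : ‖z - 1‖ ≤ ‖s‖ + 2 := by
      refine (norm_sub_le _ _).trans ?_
      rw [norm_one]; linarith
    gcongr
    · simp

theorem tendsto_natCast_cpow_one_sub {s : ℂ} (hs : 1 < s.re) :
    Filter.Tendsto (fun n : ℕ => ((n + 1 : ℕ) : ℂ) ^ (1 - s)) Filter.atTop (nhds 0) := by
  rw [tendsto_zero_iff_norm_tendsto_zero]
  have h : ∀ n : ℕ, ‖((n + 1 : ℕ) : ℂ) ^ (1 - s)‖ = ((n + 1 : ℕ) : ℝ) ^ (-(s.re - 1)) := fun n => by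
    rw [Complex.norm_natCast_cpow_of_pos n.succ_pos]
    congr 1
    simp
  simp only [h]
  have := (tendsto_rpow_neg_atTop (by linarith : 0 < s.re - 1)).comp
    (tendsto_natCast_atTop_atTop (R := ℝ))
  exact (Filter.tendsto_add_atTop_iff_nat 1).2 this

/-- The partial sums of the series of the `zetaTerm`s contain those of the Dirichlet series. -/
theorem sum_zetaTerm (s : ℂ) (N : ℕ) : ∑ n ∈ Finset.range N, zetaTerm (n + 1) s =
    (s - 1) * ∑ n ∈ Finset.range N, ((n + 1 : ℕ) : ℂ) ^ (-s) + ((N + 1 : ℕ) : ℂ) ^ (1 - s) - 1 := by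
  induction N with
  | zero => simp
  | succ N ih =>
    rw [Finset.sum_range_succ, ih, Finset.sum_range_succ, zetaTerm]
    ring

theorem riemannZeta₁_eq_of_one_lt {s : ℂ} (hs : 1 < s.re) :
    riemannZeta₁ s = 1 + ∑' n : ℕ, zetaTerm (n + 1) s := by
  have hs1 : s ≠ 1 := by rintro rfl; simp at hs
  have h1 := (summable_zetaTerm (by linarith : 0 < s.re)).hasSum.tendsto_sum_nat
  have hz := zeta_eq_tsum_one_div_nat_add_one_cpow hs
  have hsum : Summable fun n : ℕ => ((n + 1 : ℕ) : ℂ) ^ (-s) := by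
    have := (summable_nat_add_iff 1).2 (Complex.summable_one_div_nat_cpow.2 hs)
    refine this.congr fun n => ?_
    rw [Complex.cpow_neg, one_div]
  have h2 : Filter.Tendsto (fun N => (s - 1) * ∑ n ∈ Finset.range N, ((n + 1 : ℕ) : ℂ) ^ (-s) +
      ((N + 1 : ℕ) : ℂ) ^ (1 - s) - 1) Filter.atTop (nhds ((s - 1) * riemannZeta s + 0 - 1)) := by
    refine (((?_ : Filter.Tendsto _ _ _).const_mul (s - 1)).add
      (tendsto_natCast_cpow_one_sub hs)).sub_const 1
    rw [hz]
    convert hsum.hasSum.tendsto_sum_nat using 3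
    funext n
    rw [Complex.cpow_neg, one_div]
    push_cast
    rfl
  simp only [← sum_zetaTerm] at h2
  have h3 := tendsto_nhds_unique h1 h2
  rw [h3, riemannZeta_eq_inv_sub_mul hs1]
  have := sub_ne_zero.2 hs1
  field_simp
  ring

/-- The continuation of the series for `(s - 1) ζ(s)` from `Re s > 1` to `Re s > 0`. -/
theorem riemannZeta₁_eq {s : ℂ} (hs : 0 < s.re) :
    riemannZeta₁ s = 1 + ∑' n : ℕ, zetaTerm (n + 1) s := by
  have h1 : AnalyticOnNhd ℂ riemannZeta₁ {s | 0 < s.re} :=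
    differentiable_riemannZeta₁.differentiableOn.analyticOnNhd isOpen_re_pos
  have h2 : AnalyticOnNhd ℂ (fun s => 1 + ∑' n : ℕ, zetaTerm (n + 1) s) {s | 0 < s.re} :=
    (differentiableOn_tsum_zetaTerm.const_add 1).analyticOnNhd isOpen_re_pos
  have hpre : IsPreconnected {s : ℂ | 0 < s.re} :=
    (convex_halfSpace_re_gt 0).isPreconnected
  refine h1.eqOn_of_preconnected_of_eventuallyEq h2 hpre (z₀ := 2) (by simp) ?_ hs
  have : {s : ℂ | 1 < s.re} ∈ nhds (2 : ℂ) :=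
    (isOpen_lt continuous_const Complex.continuous_re).mem_nhds (by simp)
  filter_upwards [this] with z hz
  exact riemannZeta₁_eq_of_one_lt hz

theorem sum_range_inv_sqrt_le (N : ℕ) :
    ∑ n ∈ Finset.range N, 1 / Real.sqrt (n + 1 : ℕ) ≤ 2 * Real.sqrt N := by
  induction N with
  | zero => simp
  | succ N ih =>
    rw [Finset.sum_range_succ]
    have h1 : Real.sqrt N ≤ Real.sqrt (N + 1 : ℕ) := Real.sqrt_le_sqrt (by push_cast; linarith)
    have h2 : Real.sqrt (N + 1 : ℕ) ^ 2 = N + 1 := by rw [Real.sq_sqrt (by positivity)]; push_cast; rfl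
    have h3 : Real.sqrt N ^ 2 = N := Real.sq_sqrt (by positivity)
    have h4 : 0 < Real.sqrt (N + 1 : ℕ) := Real.sqrt_pos.2 (by positivity)
    have : 1 / Real.sqrt (N + 1 : ℕ) ≤ 2 * (Real.sqrt (N + 1 : ℕ) - Real.sqrt N) := by
      rw [div_le_iff₀ h4]
      nlinarith [Real.sqrt_nonneg (N : ℝ), sq_nonneg (Real.sqrt (N + 1 : ℕ) - Real.sqrt N)]
    linarith

theorem rpow_neg_three_half_le {n : ℕ} (hn : 0 < n) : ((n + 1 : ℕ) : ℝ) ^ (-(1 / 2 : ℝ) - 1) ≤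
    2 * (1 / Real.sqrt n - 1 / Real.sqrt (n + 1 : ℕ)) := by
  have hn' : (0 : ℝ) < n := Nat.cast_pos.2 hn
  have h4 : 0 < Real.sqrt (n + 1 : ℕ) := Real.sqrt_pos.2 (by positivity)
  have h5 : 0 < Real.sqrt n := Real.sqrt_pos.2 hn'
  have h2 : Real.sqrt (n + 1 : ℕ) ^ 2 = n + 1 := by rw [Real.sq_sqrt (by positivity)]; push_cast; rfl
  have h3 : Real.sqrt n ^ 2 = n := Real.sq_sqrt hn'.le
  have h1 : Real.sqrt n ≤ Real.sqrt (n + 1 : ℕ) := Real.sqrt_le_sqrt (by push_cast; linarith)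
  have e : ((n + 1 : ℕ) : ℝ) ^ (-(1 / 2 : ℝ) - 1) =
      1 / (Real.sqrt (n + 1 : ℕ) * Real.sqrt (n + 1 : ℕ) ^ 2) := by
    rw [Real.rpow_sub_one (by positivity), Real.rpow_neg (by positivity), ← Real.sqrt_eq_rpow,
      Real.sq_sqrt (by positivity)]
    field_simp
  rw [e]
  generalize Real.sqrt (n + 1 : ℕ) = b at *
  generalize Real.sqrt n = a at *
  have hab : 2 * (1 / a - 1 / b) = 2 * (b - a) / (a * b) := by field_simp
  rw [hab, div_le_div_iff₀ (by positivity) (by positivity)]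
  have h6 : (b - a) * (b + a) = 1 := by nlinarith
  have h7 : 0 ≤ b - a := by linarith
  have h8 : 1 ≤ 2 * (b - a) * b := by nlinarith
  nlinarith [mul_pos h5 h4, mul_le_mul_of_nonneg_right h8 (by positivity : 0 ≤ a * b),
    mul_nonneg h7 (by positivity : 0 ≤ b ^ 2), mul_nonneg (mul_nonneg h7 h7) h4.le]

/-- The trivial bound for `ζ` to the right of the critical line: the Dirichlet series is cut at
`N = ⌈t⌉`, and the tail of the series of the `zetaTerm`s is `O(|s|² / √N)`. -/
theorem norm_riemannZeta_le_sqrt {σ t : ℝ} (h1 : 1 / 2 ≤ σ) (h2 : σ ≤ 3 / 2) (ht : 1 ≤ t) :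
    ‖riemannZeta (σ + t * Complex.I)‖ ≤ 15 * Real.sqrt t := by
  set s : ℂ := σ + t * Complex.I with hs
  have hre : s.re = σ := by simp [hs]
  have him : s.im = t := by simp [hs]
  have ht0 : 0 < t := by linarith
  set N := ⌈t⌉₊ with hN
  have hN1 : t ≤ N := Nat.le_ceil t
  have hN2 : (N : ℝ) < t + 1 := Nat.ceil_lt_add_one ht0.le
  have hN0 : 0 < N := Nat.ceil_pos.2 ht0
  have hs1 : t ≤ ‖s - 1‖ := by
    refine le_trans ?_ (Complex.abs_im_le_norm _)
    simp [him, abs_of_pos ht0]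
  have hsne : s - 1 ≠ 0 := norm_pos_iff.1 (by linarith)
  have hnorm : ‖s‖ ≤ t + 3 / 2 := by
    rw [hs]
    refine (norm_add_le _ _).trans ?_
    rw [norm_mul, Complex.norm_I, mul_one, Complex.norm_real, Complex.norm_real, Real.norm_eq_abs,
      Real.norm_eq_abs, abs_of_pos ht0, abs_of_pos (by linarith)]
    linarith
  have hz := riemannZeta₁_eq (s := s) (by rw [hre]; linarith)
  have hsummable := summable_zetaTerm (s := s) (by rw [hre]; linarith)
  rw [← hsummable.sum_add_tsum_nat_add N, sum_zetaTerm] at hz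
  set tail := ∑' n : ℕ, zetaTerm (n + N + 1) s with htail
  have htail_le : ‖tail‖ ≤ ‖s - 1‖ * ‖s‖ * (2 / Real.sqrt N) := by
    have hb : ∀ n : ℕ, ‖zetaTerm (n + N + 1) s‖ ≤ ‖s - 1‖ * ‖s‖ *
        (2 * (1 / Real.sqrt (n + N : ℕ) - 1 / Real.sqrt (n + N + 1 : ℕ))) := by
      intro n
      refine (norm_zetaTerm_le (n + N).succ_pos (by rw [hre]; linarith)).trans ?_
      refine mul_le_mul_of_nonneg_left ?_ (by positivity)
      refine le_trans ?_ (rpow_neg_three_half_le (n := n + N) (by omega))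
      apply Real.rpow_le_rpow_of_exponent_le
      · push_cast
        linarith [Nat.cast_nonneg (α := ℝ) n, Nat.cast_nonneg (α := ℝ) N]
      · rw [hre]; linarith
    have hps : ∀ M : ℕ, ∑ n ∈ Finset.range M, ‖zetaTerm (n + N + 1) s‖ ≤
        ‖s - 1‖ * ‖s‖ * (2 / Real.sqrt N) := by
      intro M
      refine (Finset.sum_le_sum fun n _ => hb n).trans ?_
      rw [← Finset.mul_sum, ← Finset.mul_sum]
      refine mul_le_mul_of_nonneg_left ?_ (by positivity)
      have := Finset.sum_range_sub' (fun n : ℕ => 1 / Real.sqrt (n + N : ℕ)) M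
      have e : ∑ n ∈ Finset.range M, (1 / Real.sqrt (n + N : ℕ) - 1 / Real.sqrt (n + N + 1 : ℕ)) =
          1 / Real.sqrt (0 + N : ℕ) - 1 / Real.sqrt (M + N : ℕ) := by
        rw [← this]
        refine Finset.sum_congr rfl fun n _ => ?_
        rw [show n + N + 1 = n + 1 + N by ring]
      rw [e, zero_add]
      have : 0 ≤ 1 / Real.sqrt (M + N : ℕ) := by positivity
      rw [show 2 / Real.sqrt N = 2 * (1 / Real.sqrt N) by ring]
      linarith
    have hsn := summable_of_sum_range_le (fun n => norm_nonneg (zetaTerm (n + N + 1) s)) hps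
    exact (norm_tsum_le_tsum_norm hsn).trans (hsn.tsum_le_of_sum_range_le hps)
  have hzeta : riemannZeta s = ∑ n ∈ Finset.range N, ((n + 1 : ℕ) : ℂ) ^ (-s) +
      ((N + 1 : ℕ) : ℂ) ^ (1 - s) / (s - 1) + tail / (s - 1) := by
    rw [riemannZeta_eq_inv_sub_mul (sub_ne_zero.1 hsne), hz]
    field_simp
    ring
  have b1 : ‖∑ n ∈ Finset.range N, ((n + 1 : ℕ) : ℂ) ^ (-s)‖ ≤ 2 * Real.sqrt N := by
    refine (norm_sum_le _ _).trans (le_trans (Finset.sum_le_sum fun n _ => ?_)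
      (sum_range_inv_sqrt_le N))
    rw [Complex.norm_natCast_cpow_of_pos n.succ_pos, one_div, Real.sqrt_eq_rpow,
      ← Real.rpow_neg (by positivity)]
    apply Real.rpow_le_rpow_of_exponent_le
    · push_cast; linarith [Nat.cast_nonneg (α := ℝ) n]
    · simp only [Complex.neg_re, hre]; linarith
  have b2 : ‖((N + 1 : ℕ) : ℂ) ^ (1 - s) / (s - 1)‖ ≤ Real.sqrt (N + 1 : ℕ) / t := by
    rw [norm_div, Complex.norm_natCast_cpow_of_pos N.succ_pos]
    gcongr
    rw [Real.sqrt_eq_rpow]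
    apply Real.rpow_le_rpow_of_exponent_le
    · push_cast; linarith [Nat.cast_nonneg (α := ℝ) N]
    · simp only [Complex.sub_re, Complex.one_re, hre]; linarith
  have b3 : ‖tail / (s - 1)‖ ≤ ‖s‖ * (2 / Real.sqrt N) := by
    rw [norm_div, div_le_iff₀ (by linarith)]
    linarith
  have hst : 1 ≤ Real.sqrt t := Real.one_le_sqrt.2 ht
  have hsq : Real.sqrt t ^ 2 = t := Real.sq_sqrt ht0.le
  have c1 : Real.sqrt N ≤ 2 * Real.sqrt t := by
    rw [Real.sqrt_le_left (by positivity)]; nlinarith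
  have c2 : Real.sqrt (N + 1 : ℕ) ≤ 2 * Real.sqrt t := by
    rw [Real.sqrt_le_left (by positivity)]; push_cast; nlinarith
  have c3 : 2 / Real.sqrt N ≤ 2 / Real.sqrt t := by gcongr
  have c4 : (t + 3 / 2) * (2 / Real.sqrt t) ≤ 5 * Real.sqrt t := by
    rw [mul_div_assoc', div_le_iff₀ (by linarith)]
    nlinarith
  have c5 : Real.sqrt (N + 1 : ℕ) / t ≤ 2 * Real.sqrt t := (div_le_self (by positivity) ht).trans c2
  rw [hzeta]
  calc _ ≤ 2 * Real.sqrt N + Real.sqrt (N + 1 : ℕ) / t + ‖s‖ * (2 / Real.sqrt N) :=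
        (norm_add_le _ _).trans (add_le_add ((norm_add_le _ _).trans (add_le_add b1 b2)) b3)
    _ ≤ 2 * (2 * Real.sqrt t) + 2 * Real.sqrt t + (t + 3 / 2) * (2 / Real.sqrt t) := by gcongr
    _ ≤ 15 * Real.sqrt t := by linarith

/-! ### The residue theorem for rectangles -/

/-- The contour integral of `f` over the positively oriented boundary of `[a, b] × [c, d]`. -/
noncomputable def rectIntegral (f : ℂ → ℂ) (a b c d : ℝ) : ℂ :=
  (∫ x in a..b, f (x + c * Complex.I)) - (∫ x in a..b, f (x + d * Complex.I)) +
    Complex.I * (∫ y in c..d, f (b + y * Complex.I)) -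
    Complex.I * ∫ y in c..d, f (a + y * Complex.I)

/-- The boundary of the rectangle `[a, b] × [c, d]`. -/
def rectBoundary (a b c d : ℝ) : Set ℂ :=
  {z | z.re ∈ Set.Icc a b ∧ z.im ∈ Set.Icc c d ∧ (z.re = a ∨ z.re = b ∨ z.im = c ∨ z.im = d)}

section Rectangle

variable {a b c d : ℝ}

theorem mem_rectBoundary_horizontal {y : ℝ} (hcd : c ≤ d) (hy : y = c ∨ y = d) {x : ℝ}
    (hx : x ∈ Set.Icc a b) : (x : ℂ) + y * Complex.I ∈ rectBoundary a b c d := by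
  refine ⟨by simpa using hx, ?_, ?_⟩
  · rcases hy with rfl | rfl <;> simp [hcd]
  · rcases hy with rfl | rfl <;> simp

theorem mem_rectBoundary_vertical {x : ℝ} (hab : a ≤ b) (hx : x = a ∨ x = b) {y : ℝ}
    (hy : y ∈ Set.Icc c d) : (x : ℂ) + y * Complex.I ∈ rectBoundary a b c d := by
  refine ⟨?_, by simpa using hy, ?_⟩
  · rcases hx with rfl | rfl <;> simp [hab]
  · rcases hx with rfl | rfl <;> simp

theorem intervalIntegrable_horizontal {f : ℂ → ℂ} (hab : a ≤ b) (hcd : c ≤ d)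
    (hf : ContinuousOn f (rectBoundary a b c d)) {y : ℝ} (hy : y = c ∨ y = d) :
    IntervalIntegrable (fun x : ℝ => f (x + y * Complex.I)) MeasureTheory.volume a b := by
  refine ContinuousOn.intervalIntegrable ?_
  rw [Set.uIcc_of_le hab]
  exact hf.comp (by fun_prop) fun x hx => mem_rectBoundary_horizontal hcd hy hx

theorem intervalIntegrable_vertical {f : ℂ → ℂ} (hab : a ≤ b) (hcd : c ≤ d)
    (hf : ContinuousOn f (rectBoundary a b c d)) {x : ℝ} (hx : x = a ∨ x = b) :
    IntervalIntegrable (fun y : ℝ => f (x + y * Complex.I)) MeasureTheory.volume c d := by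
  refine ContinuousOn.intervalIntegrable ?_
  rw [Set.uIcc_of_le hcd]
  exact hf.comp (by fun_prop) fun y hy => mem_rectBoundary_vertical hab hx hy

theorem rectIntegral_add {f g : ℂ → ℂ} (hab : a ≤ b) (hcd : c ≤ d)
    (hf : ContinuousOn f (rectBoundary a b c d)) (hg : ContinuousOn g (rectBoundary a b c d)) :
    rectIntegral (fun z => f z + g z) a b c d = rectIntegral f a b c d + rectIntegral g a b c d := by
  unfold rectIntegral
  rw [intervalIntegral.integral_add (intervalIntegrable_horizontal hab hcd hf (Or.inl rfl))
      (intervalIntegrable_horizontal hab hcd hg (Or.inl rfl)),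
    intervalIntegral.integral_add (intervalIntegrable_horizontal hab hcd hf (Or.inr rfl))
      (intervalIntegrable_horizontal hab hcd hg (Or.inr rfl)),
    intervalIntegral.integral_add (intervalIntegrable_vertical hab hcd hf (Or.inr rfl))
      (intervalIntegrable_vertical hab hcd hg (Or.inr rfl)),
    intervalIntegral.integral_add (intervalIntegrable_vertical hab hcd hf (Or.inl rfl))
      (intervalIntegrable_vertical hab hcd hg (Or.inl rfl))]
  ring

theorem rectIntegral_congr {f g : ℂ → ℂ} (hab : a ≤ b) (hcd : c ≤ d)
    (h : Set.EqOn f g (rectBoundary a b c d)) :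
    rectIntegral f a b c d = rectIntegral g a b c d := by
  have hh : ∀ y : ℝ, (y = c ∨ y = d) →
      ∫ x in a..b, f (x + y * Complex.I) = ∫ x in a..b, g (x + y * Complex.I) := fun y hy => by
    refine intervalIntegral.integral_congr fun x hx => ?_
    rw [Set.uIcc_of_le hab] at hx
    exact h (mem_rectBoundary_horizontal hcd hy hx)
  have hv : ∀ x : ℝ, (x = a ∨ x = b) →
      ∫ y in c..d, f (x + y * Complex.I) = ∫ y in c..d, g (x + y * Complex.I) := fun x hx => by
    refine intervalIntegral.integral_congr fun y hy => ?_
    rw [Set.uIcc_of_le hcd] at hy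
    exact h (mem_rectBoundary_vertical hab hx hy)
  unfold rectIntegral
  rw [hh c (Or.inl rfl), hh d (Or.inr rfl), hv a (Or.inl rfl), hv b (Or.inr rfl)]

theorem rectIntegral_eq_zero {f : ℂ → ℂ} (hab : a ≤ b) (hcd : c ≤ d)
    (hf : DifferentiableOn ℂ f (Set.Icc a b ×ℂ Set.Icc c d)) : rectIntegral f a b c d = 0 := by
  have h := Complex.integral_boundary_rect_eq_zero_of_differentiableOn f ⟨a, c⟩ ⟨b, d⟩
    (by simpa only [Set.uIcc_of_le hab, Set.uIcc_of_le hcd] using hf)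
  simpa only [rectIntegral, smul_eq_mul] using h

theorem integral_inv_horizontal {ρ : ℂ} {y : ℝ} (hy : y ≠ ρ.im) :
    ∫ x in a..b, (x + y * Complex.I - ρ)⁻¹ =
      Complex.log (b + y * Complex.I - ρ) - Complex.log (a + y * Complex.I - ρ) := by
  have hsl : ∀ x : ℝ, (x : ℂ) + y * Complex.I - ρ ∈ Complex.slitPlane := fun x =>
    Or.inr (by simpa using sub_ne_zero.2 hy)
  refine intervalIntegral.integral_eq_sub_of_hasDerivAt
    (f := fun x : ℝ => Complex.log (x + y * Complex.I - ρ)) (fun x _ => ?_) ?_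
  · have h1 : HasDerivAt (fun x : ℝ => (x : ℂ) + y * Complex.I - ρ) 1 x := by
      simpa using ((Complex.ofRealCLM.hasDerivAt (x := x)).add_const (y * Complex.I)).sub_const ρ
    simpa using h1.clog_real (hsl x)
  · exact (Continuous.inv₀ (by fun_prop)
      fun x => Complex.slitPlane_ne_zero (hsl x)).intervalIntegrable _ _

theorem integral_inv_vertical_right {ρ : ℂ} {x : ℝ} (hx : ρ.re < x) :
    Complex.I * ∫ y in c..d, ((x : ℂ) + y * Complex.I - ρ)⁻¹ =
      Complex.log (x + d * Complex.I - ρ) - Complex.log (x + c * Complex.I - ρ) := by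
  have hsl : ∀ y : ℝ, (x : ℂ) + y * Complex.I - ρ ∈ Complex.slitPlane := fun y =>
    Or.inl (by simpa using hx)
  rw [← intervalIntegral.integral_const_mul]
  refine intervalIntegral.integral_eq_sub_of_hasDerivAt
    (f := fun y : ℝ => Complex.log (x + y * Complex.I - ρ)) (fun y _ => ?_) ?_
  · have h1 : HasDerivAt (fun y : ℝ => (x : ℂ) + y * Complex.I - ρ) Complex.I y := by
      simpa using (((Complex.ofRealCLM.hasDerivAt (x := y)).mul_const Complex.I).const_add
        (x : ℂ)).sub_const ρ
    simpa [div_eq_mul_inv] using h1.clog_real (hsl y)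
  · exact (continuous_const.mul (Continuous.inv₀ (by fun_prop)
      fun y => Complex.slitPlane_ne_zero (hsl y))).intervalIntegrable _ _

theorem integral_inv_vertical_left {ρ : ℂ} {x : ℝ} (hx : x < ρ.re) :
    Complex.I * ∫ y in c..d, ((x : ℂ) + y * Complex.I - ρ)⁻¹ =
      Complex.log (-(x + d * Complex.I - ρ)) - Complex.log (-(x + c * Complex.I - ρ)) := by
  have hsl : ∀ y : ℝ, -((x : ℂ) + y * Complex.I - ρ) ∈ Complex.slitPlane := fun y =>
    Or.inl (by simpa using hx)
  rw [← intervalIntegral.integral_const_mul]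
  refine intervalIntegral.integral_eq_sub_of_hasDerivAt
    (f := fun y : ℝ => Complex.log (-(x + y * Complex.I - ρ))) (fun y _ => ?_) ?_
  · have h1 : HasDerivAt (fun y : ℝ => -((x : ℂ) + y * Complex.I - ρ)) (-Complex.I) y := by
      simpa using ((((Complex.ofRealCLM.hasDerivAt (x := y)).mul_const Complex.I).const_add
        (x : ℂ)).sub_const ρ).fun_neg
    refine HasDerivAt.congr_deriv (h1.clog_real (hsl y)) ?_
    rw [neg_div_neg_eq, div_eq_mul_inv]
  · refine (continuous_const.mul (Continuous.inv₀ (by fun_prop)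
      fun y => ?_)).intervalIntegrable _ _
    exact neg_ne_zero.1 (Complex.slitPlane_ne_zero (hsl y))

theorem log_sub_log_neg_of_im_pos {z : ℂ} (hz : 0 < z.im) :
    Complex.log z - Complex.log (-z) = Real.pi * Complex.I := by
  rw [Complex.log, Complex.log, norm_neg, Complex.arg_neg_eq_arg_sub_pi_of_im_pos hz]
  push_cast
  ring

/-- The branch of `log` is adapted to the sides: the principal one on all sides but the left one, where
`log (-z)` is used. -/
theorem rectIntegral_inv {ρ : ℂ} (h1 : a < ρ.re) (h2 : ρ.re < b) (h3 : c < ρ.im) (h4 : ρ.im < d) :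
    rectIntegral (fun z => (z - ρ)⁻¹) a b c d = 2 * Real.pi * Complex.I := by
  unfold rectIntegral
  rw [integral_inv_horizontal h3.ne, integral_inv_horizontal h4.ne',
    integral_inv_vertical_right h2, integral_inv_vertical_left h1]
  have e1 := log_sub_log_neg_of_im_pos (z := (a : ℂ) + d * Complex.I - ρ) (by simpa using h4)
  have e2 := log_sub_log_neg_of_im_pos (z := -((a : ℂ) + c * Complex.I - ρ)) (by simpa using h3)
  rw [neg_neg] at e2
  linear_combination e1 + e2

theorem rectIntegral_const_mul (k : ℂ) (f : ℂ → ℂ) :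
    rectIntegral (fun z => k * f z) a b c d = k * rectIntegral f a b c d := by
  unfold rectIntegral
  simp only [intervalIntegral.integral_const_mul]
  ring

/-- The residue theorem for a rectangle and finitely many (at most) simple poles in its interior. -/
theorem rectIntegral_eq_sum_residues (hab : a ≤ b) (hcd : c ≤ d) {U : Set ℂ} (hU : IsOpen U)
    (hRU : Set.Icc a b ×ℂ Set.Icc c d ⊆ U) (r : ℂ → ℂ) (S : Finset ℂ) :
    ∀ F : ℂ → ℂ, (∀ ρ ∈ S, a < ρ.re ∧ ρ.re < b ∧ c < ρ.im ∧ ρ.im < d) →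
      DifferentiableOn ℂ F (U \ S) →
      (∀ ρ ∈ S, Filter.Tendsto (fun z => (z - ρ) * F z) (nhdsWithin ρ {ρ}ᶜ) (nhds (r ρ))) →
      rectIntegral F a b c d = 2 * Real.pi * Complex.I * ∑ ρ ∈ S, r ρ := by
  induction S using Finset.induction_on with
  | empty =>
    intro F _ hF _
    rw [Finset.sum_empty, mul_zero]
    exact rectIntegral_eq_zero hab hcd (hF.mono (by simpa using hRU))
  | insert ρ S hρS ih =>
    intro F hS hF hr
    obtain ⟨h1, h2, h3, h4⟩ := hS ρ (Finset.mem_insert_self _ _)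
    have hρU : ρ ∈ U := hRU ⟨⟨h1.le, h2.le⟩, ⟨h3.le, h4.le⟩⟩
    set G : ℂ → ℂ := fun z => F z - r ρ * (z - ρ)⁻¹ with hG
    set G₁ := Function.update G ρ ((nhdsWithin ρ {ρ}ᶜ).limUnder G) with hG₁
    have hVo : IsOpen (U \ (S : Set ℂ)) := hU.sdiff S.finite_toSet.isClosed
    have hV : U \ (S : Set ℂ) ∈ nhds ρ := hVo.mem_nhds ⟨hρU, by simpa using hρS⟩
    have hset : (U \ (S : Set ℂ)) \ {ρ} = U \ ((insert ρ S : Finset ℂ) : Set ℂ) := by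
      ext z; simp; tauto
    have hGd : DifferentiableOn ℂ G ((U \ (S : Set ℂ)) \ {ρ}) := by
      refine DifferentiableOn.fun_sub (hset ▸ hF) (DifferentiableOn.const_mul ?_ _)
      refine DifferentiableOn.inv (by fun_prop) fun z hz => sub_ne_zero.2 ?_
      simpa using hz.2
    have hz0 : Filter.Tendsto (fun z : ℂ => z - ρ) (nhdsWithin ρ {ρ}ᶜ) (nhds 0) := by
      have : Filter.Tendsto (fun z : ℂ => z - ρ) (nhds ρ) (nhds (ρ - ρ)) :=
        (continuous_id.sub continuous_const).tendsto ρ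
      rw [sub_self] at this
      exact this.mono_left nhdsWithin_le_nhds
    have hlo : (fun z => G z - G ρ) =o[nhdsWithin ρ {ρ}ᶜ] fun z => (z - ρ)⁻¹ := by
      refine Asymptotics.isLittleO_of_tendsto' ?_ ?_
      · filter_upwards [self_mem_nhdsWithin] with z hz h
        exact absurd (inv_eq_zero.1 h) (sub_ne_zero.2 (by simpa using hz))
      · have := ((hr ρ (Finset.mem_insert_self _ _)).sub_const (r ρ)).sub (hz0.mul_const (G ρ))
        rw [sub_self, zero_mul, sub_zero] at this
        refine this.congr' ?_
        filter_upwards [self_mem_nhdsWithin] with z hz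
        have hz' : z - ρ ≠ 0 := sub_ne_zero.2 (by simpa using hz)
        simp only [hG]
        field_simp
    have hG₁d := Complex.differentiableOn_update_limUnder_of_isLittleO hV hGd hlo
    have hG₁eq : ∀ z, z ≠ ρ → G₁ z = F z - r ρ * (z - ρ)⁻¹ := fun z hz => by
      rw [hG₁, Function.update_of_ne hz]
    have key := ih G₁ (fun ρ' h => hS ρ' (Finset.mem_insert_of_mem h)) hG₁d ?_
    · have hbd : ∀ z ∈ rectBoundary a b c d, z ∈ U \ ((insert ρ S : Finset ℂ) : Set ℂ) := by
        intro z hz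
        refine ⟨hRU ⟨hz.1, hz.2.1⟩, fun hzS => ?_⟩
        obtain ⟨k1, k2, k3, k4⟩ := hS z (by simpa using hzS)
        rcases hz.2.2 with h | h | h | h <;> linarith
      have hne : ∀ z ∈ rectBoundary a b c d, z ≠ ρ := by
        rintro z hz rfl
        exact (hbd z hz).2 (by simp)
      have hcongr : rectIntegral F a b c d =
          rectIntegral (fun z => G₁ z + r ρ * (z - ρ)⁻¹) a b c d := by
        refine rectIntegral_congr hab hcd fun z hz => ?_
        simp only [hG₁eq z (hne z hz)]
        ring
      rw [hcongr, rectIntegral_add hab hcd, key, rectIntegral_const_mul,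
        rectIntegral_inv h1 h2 h3 h4, Finset.sum_insert hρS]
      · ring
      · exact hG₁d.continuousOn.mono fun z hz => ⟨(hbd z hz).1, fun h => (hbd z hz).2 (by simp_all)⟩
      · refine continuousOn_const.mul (ContinuousOn.inv₀ (by fun_prop) fun z hz => ?_)
        exact sub_ne_zero.2 (hne z hz)
    · intro ρ' hρ'
      have hne : ρ' ≠ ρ := by rintro rfl; exact hρS hρ'
      have t1 := hr ρ' (Finset.mem_insert_of_mem hρ')
      have t2 : Filter.Tendsto (fun z : ℂ => (z - ρ') * (r ρ * (z - ρ)⁻¹)) (nhds ρ')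
          (nhds ((ρ' - ρ') * (r ρ * (ρ' - ρ)⁻¹))) := by
        refine ContinuousAt.tendsto (x := ρ') (ContinuousAt.mul (by fun_prop)
          (continuousAt_const.mul (ContinuousAt.inv₀ (by fun_prop) (sub_ne_zero.2 hne))))
      rw [sub_self, zero_mul] at t2
      have t3 := t1.sub (t2.mono_left nhdsWithin_le_nhds)
      rw [sub_zero] at t3
      refine t3.congr' ?_
      have : ∀ᶠ z in nhdsWithin ρ' {ρ'}ᶜ, z ≠ ρ :=
        nhdsWithin_le_nhds (isOpen_ne.mem_nhds hne)
      filter_upwards [this] with z hz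
      rw [hG₁eq z hz]
      ring

end Rectangle

/-- A sum over the solutions of `Δ(1/2 + it) = w` as a contour integral. The horizontal sides of
the rectangle pass through points where `Δ = -w`, so that the integrand is regular there. -/
theorem rectIntegral_eq_sum_gramPoints {f : ℂ → ℂ} (hf : DifferentiableOn ℂ f {s | 0 < s.im})
    {w : ℂ} (hw : ‖w‖ = 1) {σ₀ σ₁ τ₀ τ₁ : ℝ} (hσ₀ : -1 / 2 ≤ σ₀) (hσ₀' : σ₀ < 1 / 2)
    (hσ₁ : 1 / 2 < σ₁) (hσ₁' : σ₁ ≤ 3 / 2) (hτ₀ : 100 ≤ τ₀) (hτ : τ₀ ≤ τ₁)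
    (hD₀ : Delta (1 / 2 + Complex.I * τ₀) = -w) (hD₁ : Delta (1 / 2 + Complex.I * τ₁) = -w)
    (P : Finset ℝ) (hP : ∀ t, t ∈ P ↔ τ₀ < t ∧ t < τ₁ ∧ Delta (1 / 2 + Complex.I * t) = w) :
    rectIntegral (fun s => f s * (-Lam s * Delta s) / (Delta s - w)) σ₀ σ₁ τ₀ τ₁ =
      2 * Real.pi * Complex.I * ∑ t ∈ P, f (1 / 2 + Complex.I * t) := by
  set pt : ℝ → ℂ := fun t => 1 / 2 + Complex.I * t with hpt
  have hptre : ∀ t, (pt t).re = 1 / 2 := fun t => by simp [hpt]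
  have hptim : ∀ t, (pt t).im = t := fun t => by simp [hpt]
  have hinj : Function.Injective pt := fun t u h => by rw [← hptim t, ← hptim u, h]
  have hwne : w ≠ 0 := norm_pos_iff.1 (by rw [hw]; exact one_pos)
  have hzdecomp : ∀ z : ℂ, z = (z.re : ℂ) + z.im * Complex.I := fun z => (Complex.re_add_im z).symm
  set R : Set ℂ := {z | σ₀ < z.re ∧ z.re < σ₁ ∧ τ₀ < z.im ∧ z.im < τ₁} with hR
  have hRo : IsOpen R := by
    have : R = Set.Ioo σ₀ σ₁ ×ℂ Set.Ioo τ₀ τ₁ := by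
      ext z; simp [hR, Complex.mem_reProdIm, and_assoc]
    rw [this]
    exact isOpen_Ioo.reProdIm isOpen_Ioo
  set H : Set ℂ := {z | 0 < z.im} with hH
  have hHo : IsOpen H := isOpen_lt continuous_const Complex.continuous_im
  have hHreg : H ⊆ regularSet := fun z hz => Or.inl (ne_of_gt hz)
  have hDH : DifferentiableOn ℂ Delta H := differentiableOn_Delta.mono hHreg
  have hN : IsOpen {z ∈ H | Delta z - w ≠ 0} :=
    (hDH.continuousOn.sub continuousOn_const).isOpen_inter_preimage hHo isOpen_ne
  have hRH : R ⊆ H := fun z hz => by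
    have : τ₀ < z.im := hz.2.2.1
    simp only [hH, Set.mem_ofPred_eq]
    linarith
  -- in the closed rectangle, `Δ = w` forces the point to be one of the given ones
  have hzero : ∀ z : ℂ, z.re ∈ Set.Icc σ₀ σ₁ → z.im ∈ Set.Icc τ₀ τ₁ → Delta z - w = 0 →
      z ∈ P.image pt := by
    intro z hzre hzim hz
    rw [sub_eq_zero] at hz
    have h100 : 100 ≤ z.im := hτ₀.trans hzim.1
    have hnorm : ‖Delta z‖ = 1 := by rw [hz, hw]
    have hre : z.re = 1 / 2 := by
      rw [hzdecomp z] at hnorm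
      rcases lt_trichotomy z.re (1 / 2) with h | h | h
      · have := one_lt_norm_Delta (σ := z.re) (by linarith [hzre.1]) h h100
        linarith
      · exact h
      · have := norm_Delta_lt_one (σ := z.re) h (by linarith [hzre.2]) h100
        linarith
    have hzpt : z = pt z.im := by
      apply Complex.ext
      · rw [hptre, hre]
      · rw [hptim]
    have hzw : Delta (1 / 2 + Complex.I * z.im) = w := by rw [← hz]; exact congrArg Delta hzpt.symm
    have hnegw : w ≠ -w := fun h => hwne (self_eq_neg.1 h)
    rw [Finset.mem_image]
    refine ⟨z.im, (hP _).2 ⟨lt_of_le_of_ne hzim.1 ?_, lt_of_le_of_ne hzim.2 ?_, hzw⟩, hzpt.symm⟩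
    · intro h; rw [← h, hD₀] at hzw; exact hnegw hzw.symm
    · intro h; rw [h, hD₁] at hzw; exact hnegw hzw.symm
  have hPR : ∀ ρ ∈ P.image pt, σ₀ < ρ.re ∧ ρ.re < σ₁ ∧ τ₀ < ρ.im ∧ ρ.im < τ₁ := by
    intro ρ hρ
    obtain ⟨t, ht, rfl⟩ := Finset.mem_image.1 hρ
    have := (hP t).1 ht
    rw [hptre, hptim]
    exact ⟨hσ₀', hσ₁, this.1, this.2.1⟩
  have hsum : ∑ t ∈ P, f (1 / 2 + Complex.I * t) = ∑ ρ ∈ P.image pt, f ρ := by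
    rw [Finset.sum_image hinj.injOn]
  rw [hsum]
  refine rectIntegral_eq_sum_residues (by linarith) hτ
    (U := {z ∈ H | Delta z - w ≠ 0} ∪ R) (hN.union hRo) ?_ f (P.image pt) _ hPR ?_ ?_
  · rintro z ⟨hzre, hzim⟩
    by_cases hz : Delta z - w = 0
    · exact Or.inr (hPR z (hzero z hzre hzim hz))
    · exact Or.inl ⟨show 0 < z.im by have : τ₀ ≤ z.im := hzim.1; linarith, hz⟩
  · have hsub : ({z ∈ H | Delta z - w ≠ 0} ∪ R) \ ((P.image pt : Finset ℂ) : Set ℂ) ⊆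
        {z ∈ H | Delta z - w ≠ 0} := by
      rintro z ⟨hz | hz, hzP⟩
      · exact hz
      · refine ⟨hRH hz, fun h => hzP ?_⟩
        exact Finset.mem_coe.2 (hzero z ⟨hz.1.le, hz.2.1.le⟩ ⟨hz.2.2.1.le, hz.2.2.2.le⟩ h)
    refine DifferentiableOn.mono ?_ hsub
    have hsubH : {z ∈ H | Delta z - w ≠ 0} ⊆ H := fun z hz => hz.1
    refine DifferentiableOn.fun_div ?_ ((hDH.mono hsubH).sub_const w) fun z hz => hz.2
    exact (hf.mono hsubH).fun_mul (((differentiableOn_Lam.mono (hsubH.trans hHreg)).fun_neg).fun_mul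
      (hDH.mono hsubH))
  · intro ρ hρ
    obtain ⟨t, ht, rfl⟩ := Finset.mem_image.1 hρ
    obtain ⟨ht1, ht2, hDt⟩ := (hP t).1 ht
    have ht100 : 100 ≤ t := by linarith
    have hreg : pt t ∈ regularSet := half_add_mem_regularSet t
    have hHt : pt t ∈ H := by show 0 < (pt t).im; rw [hptim]; linarith
    set D := -Lam (pt t) * Delta (pt t) with hDdef
    have hL : Lam (pt t) ≠ 0 := by
      have := Lam_ne_zero (σ := 1 / 2) (by norm_num) (by norm_num) ht100
      rwa [← half_add_eq] at this
    have hD0 : D ≠ 0 := mul_ne_zero (neg_ne_zero.2 hL) (Delta_ne_zero hreg)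
    have hslope := (hasDerivAt_iff_tendsto_slope.1 (hasDerivAt_Delta' hreg)).inv₀ hD0
    have hcont : Filter.Tendsto (fun s => f s * (-Lam s * Delta s)) (nhdsWithin (pt t) {pt t}ᶜ)
        (nhds (f (pt t) * D)) := by
      have c1 := (hf.continuousOn.continuousAt (hHo.mem_nhds hHt))
      have c2 := continuousOn_Lam.continuousAt (isOpen_regularSet.mem_nhds hreg)
      have c3 := differentiableOn_Delta.continuousOn.continuousAt (isOpen_regularSet.mem_nhds hreg)
      exact (c1.mul (c2.neg.mul c3)).tendsto.mono_left nhdsWithin_le_nhds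
    have := hcont.mul hslope
    rw [mul_assoc, mul_inv_cancel₀ hD0, mul_one] at this
    refine this.congr' ?_
    filter_upwards [self_mem_nhdsWithin] with z _
    have hDt' : Delta (pt t) = w := hDt
    rw [slope_def_field, hDt', inv_div]
    ring

/-! ### The distribution of the solutions of `Δ(1/2 + it) = w` -/

theorem hasDerivAt_integral_re_Lam (a t : ℝ) :
    HasDerivAt (fun t => ∫ u in a..t, (Lam (1 / 2 + Complex.I * u)).re)
      (Lam (1 / 2 + Complex.I * t)).re t :=
  intervalIntegral.integral_hasDerivAt_right (continuous_re_Lam_half.intervalIntegrable _ _)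
    (continuous_re_Lam_half.stronglyMeasurableAtFilter _ _) continuous_re_Lam_half.continuousAt

/-- `Λ` has isolated zeros on the critical line: it is holomorphic near that line and not identically
zero. -/
theorem eventually_re_Lam_half_ne_zero (p : ℝ) :
    ∀ᶠ t : ℝ in nhdsWithin p {p}ᶜ, (Lam (1 / 2 + Complex.I * t)).re ≠ 0 := by
  set U : Set ℂ := {z | -(1 / 2) < z.im} ∩ {z | z.im < 1 / 2} with hU
  have hUo : IsOpen U := (isOpen_lt continuous_const Complex.continuous_im).inter
    (isOpen_lt Complex.continuous_im continuous_const)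
  have hUc : IsPreconnected U :=
    ((convex_halfSpace_im_gt _).inter (convex_halfSpace_im_lt _)).isPreconnected
  have hmaps : Set.MapsTo (fun z : ℂ => 1 / 2 + Complex.I * z) U regularSet := by
    rintro z ⟨h1, h2⟩
    have h1' : -(1 / 2) < z.im := h1
    have h2' : z.im < 1 / 2 := h2
    refine Or.inr ?_
    have : (1 / 2 + Complex.I * z).re = 1 / 2 - z.im := by simp [sub_eq_add_neg]
    rw [this]
    constructor <;> linarith
  have hreal : ∀ t : ℝ, (t : ℂ) ∈ U := fun t => by
    constructor <;> simp
  have hana : AnalyticOnNhd ℂ (fun z : ℂ => Lam (1 / 2 + Complex.I * z)) U :=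
    (differentiableOn_Lam.comp (by fun_prop) hmaps).analyticOnNhd hUo
  have hne : ∀ᶠ z in nhdsWithin (p : ℂ) {(p : ℂ)}ᶜ, Lam (1 / 2 + Complex.I * z) ≠ 0 := by
    rcases (hana p (hreal p)).eventually_eq_zero_or_eventually_ne_zero with h | h
    · exfalso
      have h0 := hana.eqOn_zero_of_preconnected_of_eventuallyEq_zero hUc (hreal p) h (hreal 100)
      have := Lam_ne_zero (σ := 1 / 2) (t := 100) (by norm_num) (by norm_num) le_rfl
      rw [← half_add_eq] at this
      exact this h0
    · exact h
  have hmap : Filter.Tendsto (fun t : ℝ => (t : ℂ)) (nhdsWithin p {p}ᶜ)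
      (nhdsWithin (p : ℂ) {(p : ℂ)}ᶜ) := by
    refine tendsto_nhdsWithin_of_tendsto_nhds_of_eventually_within _
      (Complex.continuous_ofReal.continuousAt.tendsto.mono_left nhdsWithin_le_nhds) ?_
    filter_upwards [self_mem_nhdsWithin] with t ht
    simpa using ht
  filter_upwards [hmap.eventually hne] with t ht h
  rw [Lam_half_eq_re, h] at ht
  simp at ht

theorem exp_neg_mul_I_eq_one {x : ℝ} (h : Complex.exp (-((x : ℂ) * Complex.I)) = 1)
    (h1 : -(2 * Real.pi) < x) (h2 : x < 2 * Real.pi) : x = 0 := by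
  obtain ⟨n, hn⟩ := Complex.exp_eq_one_iff.1 h
  have hx : x = -n * (2 * Real.pi) := by
    have := congrArg Complex.im hn
    simp at this
    linarith
  have hpi := Real.pi_pos
  have hn1 : (n : ℝ) < 1 := by nlinarith
  have hn2 : (-1 : ℝ) < n := by nlinarith
  have hn1' : n < 1 := by exact_mod_cast hn1
  have hn2' : -1 < n := by exact_mod_cast hn2
  have : n = 0 := by omega
  rw [hx, this]
  simp

theorem integral_eq_zero_of_Delta_half_eq {t₁ t₂ : ℝ}
    (h : Delta (1 / 2 + Complex.I * t₁) = Delta (1 / 2 + Complex.I * t₂))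
    (hlt : |∫ u in t₁..t₂, (Lam (1 / 2 + Complex.I * u)).re| < 2 * Real.pi) :
    ∫ u in t₁..t₂, (Lam (1 / 2 + Complex.I * u)).re = 0 := by
  have h1 := Delta_half_eq_mul_exp t₁ t₂
  rw [← h] at h1
  have h2 := Delta_ne_zero (half_add_mem_regularSet t₁)
  have h3 := mul_left_cancel₀ h2 ((mul_one _).trans h1)
  exact exp_neg_mul_I_eq_one h3.symm (abs_lt.1 hlt).1 (abs_lt.1 hlt).2

/-- On a short interval where `Λ` has no zero, the argument of `Δ` is strictly monotone and varies by
less than `2π`. -/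
theorem subsingleton_of_re_Lam_half_ne_zero {a b : ℝ} {M : ℝ}
    (hne : ∀ t ∈ Set.Ioo a b, (Lam (1 / 2 + Complex.I * t)).re ≠ 0)
    (hM : ∀ t ∈ Set.Ioo a b, ‖(Lam (1 / 2 + Complex.I * t)).re‖ ≤ M)
    (hMab : M * (b - a) < 2 * Real.pi) (w : ℂ) :
    {t ∈ Set.Ioo a b | Delta (1 / 2 + Complex.I * t) = w}.Subsingleton := by
  have key : ∀ t₁ ∈ Set.Ioo a b, ∀ t₂ ∈ Set.Ioo a b, t₁ < t₂ →
      Delta (1 / 2 + Complex.I * t₁) ≠ Delta (1 / 2 + Complex.I * t₂) := by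
    intro t₁ h₁ t₂ h₂ hlt heq
    have hsub : ∀ t ∈ Set.Icc t₁ t₂, t ∈ Set.Ioo a b := fun t ht =>
      ⟨h₁.1.trans_le ht.1, ht.2.trans_lt h₂.2⟩
    have hb := intervalIntegral.norm_integral_le_of_norm_le_const (a := t₁) (b := t₂) (C := M)
      (f := fun u : ℝ => (Lam (1 / 2 + Complex.I * u)).re) fun u hu => by
        rw [Set.uIoc_of_le hlt.le] at hu
        exact hM u (hsub u ⟨hu.1.le, hu.2⟩)
    have hM0 : 0 ≤ M := (norm_nonneg _).trans (hM t₁ h₁)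
    have hint : |∫ u in t₁..t₂, (Lam (1 / 2 + Complex.I * u)).re| < 2 * Real.pi := by
      refine (hb.trans ?_).trans_lt hMab
      rw [abs_of_pos (by linarith)]
      exact mul_le_mul_of_nonneg_left (by linarith [h₁.1, h₂.2]) hM0
    have hzero := integral_eq_zero_of_Delta_half_eq heq hint
    obtain ⟨ξ, hξ, hξ0⟩ := exists_hasDerivAt_eq_zero (f := fun t =>
      ∫ u in t₁..t, (Lam (1 / 2 + Complex.I * u)).re) hlt
      (fun t _ => (hasDerivAt_integral_re_Lam t₁ t).continuousAt.continuousWithinAt)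
      (by rw [hzero, intervalIntegral.integral_same])
      (fun t _ => hasDerivAt_integral_re_Lam t₁ t)
    exact hne ξ (hsub ξ ⟨hξ.1.le, hξ.2.le⟩) hξ0
  rintro t₁ ⟨h₁, e₁⟩ t₂ ⟨h₂, e₂⟩
  rcases lt_trichotomy t₁ t₂ with h | h | h
  · exact absurd (e₁.trans e₂.symm) (key t₁ h₁ t₂ h₂ h)
  · exact h
  · exact absurd (e₂.trans e₁.symm) (key t₂ h₂ t₁ h₁ h)

/-- Near `p` there is at most one solution on either side, besides possibly `p` itself. -/
theorem exists_nhds_encard_le (p : ℝ) : ∃ V ∈ nhds p, ∀ w : ℂ,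
    {t ∈ V | Delta (1 / 2 + Complex.I * t) = w}.encard ≤ 3 := by
  set M : ℝ := ‖(Lam (1 / 2 + Complex.I * p)).re‖ + 1 with hM
  have hM1 : 0 < M := by positivity
  have hcont : ∀ᶠ t : ℝ in nhds p, ‖(Lam (1 / 2 + Complex.I * t)).re‖ < M :=
    (continuous_re_Lam_half.norm.tendsto p).eventually_lt_const (by linarith)
  obtain ⟨δ₁, hδ₁, h₁⟩ := Metric.eventually_nhds_iff.1 hcont
  obtain ⟨δ₂, hδ₂, h₂⟩ := Metric.eventually_nhds_iff.1
    (eventually_nhdsWithin_iff.1 (eventually_re_Lam_half_ne_zero p))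
  set δ := min (min δ₁ δ₂) (1 / M) with hδ
  have hδ0 : 0 < δ := lt_min (lt_min hδ₁ hδ₂) (by positivity)
  have hδM : M * δ ≤ 1 := by
    calc M * δ ≤ M * (1 / M) := by gcongr; exact min_le_right _ _
      _ = 1 := by field_simp
  have hpi := Real.pi_gt_three
  have hdist : ∀ t : ℝ, |t - p| < δ → dist t p < δ₁ ∧ dist t p < δ₂ := fun t ht => by
    rw [Real.dist_eq]
    exact ⟨ht.trans_le ((min_le_left _ _).trans (min_le_left _ _)),
      ht.trans_le ((min_le_left _ _).trans (min_le_right _ _))⟩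
  have hside : ∀ a b : ℝ, b - a = δ → (∀ t ∈ Set.Ioo a b, |t - p| < δ ∧ t ≠ p) → ∀ w : ℂ,
      {t ∈ Set.Ioo a b | Delta (1 / 2 + Complex.I * t) = w}.encard ≤ 1 := by
    intro a b hab h w
    rw [Set.encard_le_one_iff_subsingleton]
    exact subsingleton_of_re_Lam_half_ne_zero (M := M)
      (fun t ht => h₂ (hdist t (h t ht).1).2 (h t ht).2)
      (fun t ht => (h₁ (hdist t (h t ht).1).1).le) (by rw [hab]; linarith) w
  refine ⟨Set.Ioo (p - δ) (p + δ), Ioo_mem_nhds (by linarith) (by linarith), fun w => ?_⟩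
  have hR := hside p (p + δ) (by ring) (fun t ht =>
    ⟨abs_lt.2 ⟨by linarith [ht.1], by linarith [ht.2]⟩, ht.1.ne'⟩) w
  have hL := hside (p - δ) p (by ring) (fun t ht =>
    ⟨abs_lt.2 ⟨by linarith [ht.1], by linarith [ht.2]⟩, ht.2.ne⟩) w
  have hsub : {t ∈ Set.Ioo (p - δ) (p + δ) | Delta (1 / 2 + Complex.I * t) = w} ⊆
      ({p} ∪ {t ∈ Set.Ioo p (p + δ) | Delta (1 / 2 + Complex.I * t) = w}) ∪
        {t ∈ Set.Ioo (p - δ) p | Delta (1 / 2 + Complex.I * t) = w} := by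
    rintro t ⟨⟨ht1, ht2⟩, hw⟩
    rcases lt_trichotomy t p with h | h | h
    · exact Or.inr ⟨⟨ht1, h⟩, hw⟩
    · exact Or.inl (Or.inl h)
    · exact Or.inl (Or.inr ⟨⟨h, ht2⟩, hw⟩)
  calc _ ≤ _ := Set.encard_le_encard hsub
    _ ≤ _ := Set.encard_union_le _ _
    _ ≤ (1 + 1) + 1 := by
      gcongr
      refine (Set.encard_union_le _ _).trans ?_
      rw [Set.encard_singleton]
      gcongr
    _ = 3 := by norm_num

/-- The number of solutions of `Δ(1/2 + it) = w` on a bounded interval is bounded uniformly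
in `w`. -/
theorem exists_encard_le (A : ℝ) : ∃ N : ℕ, ∀ w : ℂ,
    {t ∈ Set.Icc 0 A | Delta (1 / 2 + Complex.I * t) = w}.encard ≤ N := by
  refine (isCompact_Icc (a := (0 : ℝ)) (b := A)).induction_on
    (p := fun s => ∃ N : ℕ, ∀ w : ℂ, {t ∈ s | Delta (1 / 2 + Complex.I * t) = w}.encard ≤ N)
    ⟨0, by simp⟩ ?_ ?_ ?_
  · rintro s t hst ⟨N, hN⟩
    exact ⟨N, fun w => (Set.encard_le_encard (Set.inter_subset_inter_left _ hst)).trans (hN w)⟩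
  · rintro s t ⟨N, hN⟩ ⟨M, hM⟩
    refine ⟨N + M, fun w => ?_⟩
    have : {x ∈ s ∪ t | Delta (1 / 2 + Complex.I * x) = w} ⊆
        {x ∈ s | Delta (1 / 2 + Complex.I * x) = w} ∪
          {x ∈ t | Delta (1 / 2 + Complex.I * x) = w} := by
      rintro x ⟨hx | hx, hw⟩
      · exact Or.inl ⟨hx, hw⟩
      · exact Or.inr ⟨hx, hw⟩
    refine (Set.encard_le_encard this).trans ((Set.encard_union_le _ _).trans ?_)
    push_cast
    exact add_le_add (hN w) (hM w)
  · intro p _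
    obtain ⟨V, hV, h⟩ := exists_nhds_encard_le p
    exact ⟨V, mem_nhdsWithin_of_mem_nhds hV, 3, by exact_mod_cast h⟩

theorem finite_gramPoints (φ T : ℝ) : (gramPoints φ T).Finite := by
  obtain ⟨N, hN⟩ := exists_encard_le T
  refine Set.Finite.subset (Set.finite_of_encard_le_coe (hN (Complex.exp (2 * Complex.I * φ)))) ?_
  rintro t ⟨h1, h2, h3⟩
  exact ⟨⟨h1.le, h2⟩, h3⟩

theorem exists_exp_neg_mul_I_eq {z : ℂ} (hz : ‖z‖ = 1) :
    ∃ β : ℝ, 0 ≤ β ∧ β < 2 * Real.pi ∧ Complex.exp (-((β : ℂ) * Complex.I)) = z := by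
  have h := Complex.norm_mul_exp_arg_mul_I z
  rw [hz, Complex.ofReal_one, one_mul] at h
  have h1 := Complex.neg_pi_lt_arg z
  have h2 := Complex.arg_le_pi z
  have hpi := Real.pi_pos
  rcases le_or_gt z.arg 0 with h0 | h0
  · refine ⟨-z.arg, by linarith, by linarith, ?_⟩
    refine Eq.trans (congrArg Complex.exp ?_) h
    push_cast
    ring
  · refine ⟨2 * Real.pi - z.arg, by linarith, by linarith, ?_⟩
    push_cast
    rw [show -((2 * (Real.pi : ℂ) - z.arg) * Complex.I) =
      z.arg * Complex.I - 2 * Real.pi * Complex.I by ring, Complex.exp_periodic.sub_eq, h]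

/-- Above every height `a ≥ 100` there is a nearby `τ` with `Δ(1/2 + iτ) = -w`. The argument of `Δ`
has moved by less than `2π` when it first arrives there, so that it has met `w` at most once. -/
theorem exists_Delta_half_eq_neg {a : ℝ} (ha : 100 ≤ a) {w : ℂ} (hw : ‖w‖ = 1) :
    ∃ τ ∈ Set.Icc a (a + 7), Delta (1 / 2 + Complex.I * τ) = -w ∧
      {t ∈ Set.Icc a τ | Delta (1 / 2 + Complex.I * t) = w}.Subsingleton := by
  have hD0 := Delta_ne_zero (half_add_mem_regularSet a)
  obtain ⟨β, hβ0, hβ1, hβ⟩ := exists_exp_neg_mul_I_eq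
    (z := -w / Delta (1 / 2 + Complex.I * a)) (by rw [norm_div, norm_neg, hw, norm_Delta_half, div_one])
  set F : ℝ → ℝ := fun t => ∫ u in a..t, (Lam (1 / 2 + Complex.I * u)).re with hF
  have hFd : ∀ t : ℝ, HasDerivAt F (Lam (1 / 2 + Complex.I * t)).re t := hasDerivAt_integral_re_Lam a
  have hFc : Continuous F := continuous_iff_continuousAt.2 fun t => (hFd t).continuousAt
  have hlow : ∀ t : ℝ, 100 ≤ t → 2 ≤ (Lam (1 / 2 + Complex.I * t)).re := fun t ht => by
    have := two_le_re_Lam (σ := 1 / 2) (by norm_num) (by norm_num) ht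
    rwa [← half_add_eq] at this
  have hmvt : ∀ t₁ t₂, a ≤ t₁ → t₁ < t₂ → 2 * (t₂ - t₁) ≤ F t₂ - F t₁ := by
    intro t₁ t₂ h1 h2
    obtain ⟨ξ, hξ, he⟩ := exists_hasDerivAt_eq_slope F _ h2 hFc.continuousOn fun t _ => hFd t
    have h3 := hlow ξ (by linarith [hξ.1])
    rw [he, le_div_iff₀ (by linarith)] at h3
    exact h3
  have hFa : F a = 0 := by simp [hF]
  have hpi := Real.pi_lt_d2
  have hend : β ≤ F (a + 7) := by
    have := hmvt a (a + 7) le_rfl (by linarith)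
    rw [hFa] at this
    linarith
  obtain ⟨τ, hτ, hFτ⟩ := intermediate_value_Icc (by linarith : a ≤ a + 7) hFc.continuousOn
    (⟨by rw [hFa]; exact hβ0, hend⟩ : β ∈ Set.Icc (F a) (F (a + 7)))
  refine ⟨τ, hτ, ?_, ?_⟩
  · rw [Delta_half_eq_mul_exp a τ]
    change _ * Complex.exp (-((F τ : ℂ) * Complex.I)) = _
    rw [hFτ, hβ, mul_div_cancel₀ _ hD0]
  · have hFdiff : ∀ t₁ t₂ : ℝ, ∫ u in t₁..t₂, (Lam (1 / 2 + Complex.I * u)).re = F t₂ - F t₁ :=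
      fun t₁ t₂ => (intervalIntegral.integral_interval_sub_left
        (continuous_re_Lam_half.intervalIntegrable _ _)
        (continuous_re_Lam_half.intervalIntegrable _ _)).symm
    have key : ∀ t₁ t₂, a ≤ t₁ → t₁ < t₂ → t₂ ≤ τ →
        Delta (1 / 2 + Complex.I * t₁) ≠ Delta (1 / 2 + Complex.I * t₂) := by
      intro t₁ t₂ h1 h2 h3 heq
      have m1 := hmvt t₁ t₂ h1 h2
      have m2 : 0 ≤ F t₁ := by
        rcases h1.eq_or_lt with h | h
        · rw [← h, hFa]
        · have := hmvt a t₁ le_rfl h; rw [hFa] at this; linarith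
      have m3 : F t₂ ≤ β := by
        rw [← hFτ]
        rcases h3.eq_or_lt with h | h
        · rw [h]
        · have := hmvt t₂ τ (by linarith) h; linarith
      have hz := integral_eq_zero_of_Delta_half_eq heq (by
        rw [hFdiff, abs_of_pos (by linarith)]; linarith)
      rw [hFdiff] at hz
      linarith
    rintro t₁ ⟨h₁, e₁⟩ t₂ ⟨h₂, e₂⟩
    rcases lt_trichotomy t₁ t₂ with h | h | h
    · exact absurd (e₁.trans e₂.symm) (key t₁ t₂ h₁.1 h h₂.2)
    · exact h
    · exact absurd (e₂.trans e₁.symm) (key t₂ t₁ h₂.1 h h₁.2)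

/-! ### Twisted integrals of `Λ` along vertical lines -/

theorem continuousOn_Lam_vertical (σ : ℝ) {τ₀ τ₁ : ℝ} (h : 0 < τ₀) :
    ContinuousOn (fun t : ℝ => Lam (σ + t * Complex.I)) (Set.Icc τ₀ τ₁) :=
  continuousOn_Lam.comp (by fun_prop) fun t ht =>
    add_mul_I_mem_regularSet σ (show t ≠ 0 by linarith [ht.1])

theorem hasDerivAt_log_div_two_pi {t : ℝ} (ht : 0 < t) :
    HasDerivAt (fun t : ℝ => Real.log (t / (2 * Real.pi))) (1 / t) t := by
  have hpi := Real.pi_pos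
  have := ((hasDerivAt_id t).div_const (2 * Real.pi)).log (by simp; positivity)
  refine HasDerivAt.congr_deriv this ?_
  simp only [id]
  field_simp

theorem continuousOn_log_div {τ₀ τ₁ : ℝ} (h : 0 < τ₀) :
    ContinuousOn (fun t : ℝ => Real.log (t / (2 * Real.pi))) (Set.Icc τ₀ τ₁) := fun t ht =>
  (hasDerivAt_log_div_two_pi (show 0 < t by linarith [ht.1])).continuousAt.continuousWithinAt

theorem integral_log_div_two_pi {τ₀ τ₁ : ℝ} (h0 : 0 < τ₀) (h : τ₀ ≤ τ₁) :
    ∫ t in τ₀..τ₁, Real.log (t / (2 * Real.pi)) =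
      (τ₁ * Real.log (τ₁ / (2 * Real.pi)) - τ₁) - (τ₀ * Real.log (τ₀ / (2 * Real.pi)) - τ₀) := by
  refine intervalIntegral.integral_eq_sub_of_hasDerivAt
    (f := fun t => t * Real.log (t / (2 * Real.pi)) - t) (fun t ht => ?_) ?_
  · rw [Set.uIcc_of_le h] at ht
    have ht0 : 0 < t := by linarith [ht.1]
    refine HasDerivAt.congr_deriv
      (((hasDerivAt_id t).fun_mul (hasDerivAt_log_div_two_pi ht0)).fun_sub (hasDerivAt_id t)) ?_
    simp only [id]
    field_simp
    ring
  · refine ContinuousOn.intervalIntegrable ?_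
    rw [Set.uIcc_of_le h]
    exact continuousOn_log_div h0

theorem norm_cexp_I_mul_real (u t : ℝ) : ‖Complex.exp (Complex.I * u * t)‖ = 1 := by
  rw [Complex.norm_exp]; simp

theorem integral_one_div_le_log {τ₀ τ₁ : ℝ} (h0 : 100 ≤ τ₀) (h : τ₀ ≤ τ₁) :
    ∫ t in τ₀..τ₁, 1 / t ≤ Real.log τ₁ := by
  rw [integral_one_div_of_pos (by linarith) (by linarith)]
  refine Real.log_le_log (by apply div_pos <;> linarith) (div_le_self (by linarith) (by linarith))

theorem intervalIntegrable_one_div {τ₀ τ₁ : ℝ} (h0 : 100 ≤ τ₀) (h : τ₀ ≤ τ₁) (C : ℝ) :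
    IntervalIntegrable (fun t : ℝ => C / t) MeasureTheory.volume τ₀ τ₁ := by
  refine ContinuousOn.intervalIntegrable ?_
  rw [Set.uIcc_of_le h]
  exact continuousOn_const.div continuousOn_id fun t ht => show t ≠ 0 by linarith [ht.1]

theorem norm_integral_le_of_norm_le_div {f : ℝ → ℂ} {τ₀ τ₁ C : ℝ} (h0 : 100 ≤ τ₀) (h : τ₀ ≤ τ₁)
    (hC : 0 ≤ C) (hf : ∀ t ∈ Set.Icc τ₀ τ₁, ‖f t‖ ≤ C / t) :
    ‖∫ t in τ₀..τ₁, f t‖ ≤ C * Real.log τ₁ := by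
  refine (intervalIntegral.norm_integral_le_of_norm_le h (g := fun t => C / t)
    (Filter.Eventually.of_forall fun t ht => hf t ⟨ht.1.le, ht.2⟩)
    (intervalIntegrable_one_div h0 h C)).trans ?_
  have : ∀ t : ℝ, C / t = C * (1 / t) := fun t => by ring
  simp only [this]
  rw [intervalIntegral.integral_const_mul]
  exact mul_le_mul_of_nonneg_left (integral_one_div_le_log h0 h) hC

/-- The integral of `Λ` against a character, with `Λ` replaced by `log (t / 2π)`. -/
theorem norm_integral_Lam_sub_le {σ τ₀ τ₁ : ℝ} (h1 : -1 / 2 ≤ σ) (h2 : σ ≤ 3 / 2) (h0 : 100 ≤ τ₀)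
    (h : τ₀ ≤ τ₁) (u : ℝ) :
    ‖(∫ t in τ₀..τ₁, Lam (σ + t * Complex.I) * Complex.exp (Complex.I * u * t)) -
      ∫ t in τ₀..τ₁, (Real.log (t / (2 * Real.pi)) : ℂ) * Complex.exp (Complex.I * u * t)‖ ≤
      11 * Real.log τ₁ := by
  have hexp : Continuous fun t : ℝ => Complex.exp (Complex.I * u * t) := by fun_prop
  have i1 : IntervalIntegrable (fun t : ℝ => Lam (σ + t * Complex.I) *
      Complex.exp (Complex.I * u * t)) MeasureTheory.volume τ₀ τ₁ := by
    refine ContinuousOn.intervalIntegrable ?_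
    rw [Set.uIcc_of_le h]
    exact (continuousOn_Lam_vertical σ (by linarith)).mul hexp.continuousOn
  have i2 : IntervalIntegrable (fun t : ℝ => (Real.log (t / (2 * Real.pi)) : ℂ) *
      Complex.exp (Complex.I * u * t)) MeasureTheory.volume τ₀ τ₁ := by
    refine ContinuousOn.intervalIntegrable ?_
    rw [Set.uIcc_of_le h]
    exact (Complex.continuous_ofReal.comp_continuousOn
      (continuousOn_log_div (by linarith))).mul hexp.continuousOn
  rw [← intervalIntegral.integral_sub i1 i2]
  refine norm_integral_le_of_norm_le_div h0 h (by norm_num) fun t ht => ?_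
  rw [← sub_mul, norm_mul, norm_cexp_I_mul_real, mul_one]
  exact norm_Lam_sub_log_le h1 h2 (by linarith [ht.1])

/-- Integration by parts against an oscillating character. -/
theorem norm_integral_log_mul_exp_le {τ₀ τ₁ u : ℝ} (h0 : 100 ≤ τ₀) (h : τ₀ ≤ τ₁) (hu : u ≠ 0) :
    ‖∫ t in τ₀..τ₁, (Real.log (t / (2 * Real.pi)) : ℂ) * Complex.exp (Complex.I * u * t)‖ ≤
      3 * Real.log τ₁ / |u| := by
  have hIu : Complex.I * (u : ℂ) ≠ 0 := mul_ne_zero Complex.I_ne_zero (by exact_mod_cast hu)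
  have hexp : Continuous fun t : ℝ => Complex.exp (Complex.I * u * t) := by fun_prop
  set H : ℝ → ℂ := fun t => (Real.log (t / (2 * Real.pi)) : ℂ) *
    (Complex.exp (Complex.I * u * t) / (Complex.I * u)) with hH
  have hHd : ∀ t, 0 < t → HasDerivAt H ((Real.log (t / (2 * Real.pi)) : ℂ) *
      Complex.exp (Complex.I * u * t) +
      ((1 / t : ℝ) : ℂ) * (Complex.exp (Complex.I * u * t) / (Complex.I * u))) t := by
    intro t ht
    have e1 := (hasDerivAt_log_div_two_pi ht).ofReal_comp
    have e2 : HasDerivAt (fun t : ℝ => Complex.exp (Complex.I * u * t) / (Complex.I * u))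
        (Complex.exp (Complex.I * u * t)) t := by
      have : HasDerivAt (fun t : ℝ => Complex.I * u * (t : ℂ)) (Complex.I * u) t := by
        simpa using (Complex.ofRealCLM.hasDerivAt (x := t)).const_mul (Complex.I * u)
      exact HasDerivAt.congr_deriv (this.cexp.div_const (Complex.I * u)) (mul_div_cancel_right₀ _ hIu)
    refine HasDerivAt.congr_deriv (e1.fun_mul e2) ?_
    ring
  have i2 : IntervalIntegrable (fun t : ℝ => (Real.log (t / (2 * Real.pi)) : ℂ) *
      Complex.exp (Complex.I * u * t)) MeasureTheory.volume τ₀ τ₁ := by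
    refine ContinuousOn.intervalIntegrable ?_
    rw [Set.uIcc_of_le h]
    exact (Complex.continuous_ofReal.comp_continuousOn
      (continuousOn_log_div (by linarith))).mul hexp.continuousOn
  have i3 : IntervalIntegrable (fun t : ℝ => ((1 / t : ℝ) : ℂ) *
      (Complex.exp (Complex.I * u * t) / (Complex.I * u))) MeasureTheory.volume τ₀ τ₁ := by
    refine ContinuousOn.intervalIntegrable ?_
    rw [Set.uIcc_of_le h]
    refine (Complex.continuous_ofReal.comp_continuousOn ?_).mul (by fun_prop)
    exact continuousOn_const.div continuousOn_id fun t ht => show t ≠ 0 by linarith [ht.1]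
  have hftc := intervalIntegral.integral_eq_sub_of_hasDerivAt (f := H) (fun t ht => hHd t (by
    rw [Set.uIcc_of_le h] at ht; linarith [ht.1])) (i2.add i3)
  rw [intervalIntegral.integral_add i2 i3] at hftc
  have hn : ∀ t : ℝ, ‖Complex.exp (Complex.I * u * t) / (Complex.I * u)‖ = 1 / |u| := fun t => by
    rw [norm_div, norm_cexp_I_mul_real, norm_mul, Complex.norm_I, one_mul, Complex.norm_real,
      Real.norm_eq_abs]
  have hHn : ∀ t, 100 ≤ t → t ≤ τ₁ → ‖H t‖ ≤ Real.log τ₁ * (1 / |u|) := fun t ht ht1 => by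
    rw [hH]
    simp only
    rw [norm_mul, hn, Complex.norm_real, Real.norm_of_nonneg (by linarith [five_half_le_log_div ht])]
    refine mul_le_mul_of_nonneg_right ?_ (by positivity)
    have := log_div_two_pi_le (t := t) (by linarith)
    have := Real.log_le_log (by linarith : 0 < t) ht1
    linarith
  have hrem := norm_integral_le_of_norm_le_div (f := fun t : ℝ => ((1 / t : ℝ) : ℂ) *
      (Complex.exp (Complex.I * u * t) / (Complex.I * u))) (C := 1 / |u|) h0 h (by positivity)
      fun t ht => by
    rw [norm_mul, hn, Complex.norm_real, Real.norm_of_nonneg (by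
      have : 0 < t := by linarith [ht.1]
      positivity)]
    exact le_of_eq (by ring)
  rw [eq_sub_of_add_eq hftc]
  calc _ ≤ (Real.log τ₁ * (1 / |u|) + Real.log τ₁ * (1 / |u|)) + 1 / |u| * Real.log τ₁ :=
        (norm_sub_le _ _).trans (add_le_add ((norm_sub_le _ _).trans
          (add_le_add (hHn _ (h0.trans h) le_rfl) (hHn _ h0 h))) hrem)
    _ = 3 * Real.log τ₁ / |u| := by ring

theorem norm_integral_Lam_mul_exp_le {σ τ₀ τ₁ u : ℝ} (h1 : -1 / 2 ≤ σ) (h2 : σ ≤ 3 / 2)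
    (h0 : 100 ≤ τ₀) (h : τ₀ ≤ τ₁) (hu : u ≠ 0) :
    ‖∫ t in τ₀..τ₁, Lam (σ + t * Complex.I) * Complex.exp (Complex.I * u * t)‖ ≤
      11 * Real.log τ₁ * (1 + 1 / |u|) := by
  have e1 := norm_integral_Lam_sub_le h1 h2 h0 h u
  have e2 := norm_integral_log_mul_exp_le h0 h hu
  have e3 := norm_le_norm_add_norm_sub
    (∫ t in τ₀..τ₁, (Real.log (t / (2 * Real.pi)) : ℂ) * Complex.exp (Complex.I * u * t))
    (∫ t in τ₀..τ₁, Lam (σ + t * Complex.I) * Complex.exp (Complex.I * u * t))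
  rw [norm_sub_rev] at e3
  have hlog : 0 ≤ Real.log τ₁ := Real.log_nonneg (by linarith)
  have : 0 ≤ Real.log τ₁ / |u| := by positivity
  calc _ ≤ _ := e3
    _ ≤ 3 * Real.log τ₁ / |u| + 11 * Real.log τ₁ := add_le_add e2 e1
    _ = 11 * Real.log τ₁ + 3 * (Real.log τ₁ / |u|) := by ring
    _ ≤ 11 * Real.log τ₁ + 11 * (Real.log τ₁ / |u|) := by linarith
    _ = _ := by ring

/-- The main term `T log (T / 2πe)`. -/
noncomputable def mainTerm (T : ℝ) : ℝ := T * Real.log (T / (2 * Real.pi * Real.exp 1))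

theorem mainTerm_eq {T : ℝ} (hT : 0 < T) : mainTerm T = T * Real.log (T / (2 * Real.pi)) - T := by
  have hpi := Real.pi_pos
  rw [mainTerm, ← div_div, Real.log_div (by positivity) (Real.exp_ne_zero 1), Real.log_exp]
  ring

theorem norm_integral_Lam_sub_mainTerm_le {σ τ₀ τ₁ T : ℝ} (h1 : -1 / 2 ≤ σ) (h2 : σ ≤ 3 / 2)
    (h0 : 100 ≤ τ₀) (h0' : τ₀ ≤ 107) (hT : 107 ≤ T) (hT1 : T ≤ τ₁) (hT2 : τ₁ ≤ T + 7) :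
    ‖(∫ t in τ₀..τ₁, Lam (σ + t * Complex.I)) - mainTerm T‖ ≤ 125 * Real.log τ₁ := by
  have h : τ₀ ≤ τ₁ := by linarith
  have e1 := norm_integral_Lam_sub_le h1 h2 h0 h 0
  simp only [Complex.ofReal_zero, mul_zero, zero_mul, Complex.exp_zero, mul_one] at e1
  rw [intervalIntegral.integral_ofReal, integral_log_div_two_pi (by linarith) h] at e1
  have hsplit := integral_log_div_two_pi (τ₀ := T) (τ₁ := τ₁) (by linarith) hT1
  have hb : ‖∫ t in T..τ₁, Real.log (t / (2 * Real.pi))‖ ≤ Real.log τ₁ * |τ₁ - T| := by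
    refine intervalIntegral.norm_integral_le_of_norm_le_const fun t ht => ?_
    rw [Set.uIoc_of_le hT1] at ht
    have ht100 : 100 ≤ t := by linarith [ht.1]
    rw [Real.norm_of_nonneg (by linarith [five_half_le_log_div ht100])]
    have := log_div_two_pi_le (t := t) (by linarith)
    have := Real.log_le_log (by linarith : 0 < t) ht.2
    linarith
  rw [hsplit, Real.norm_eq_abs, abs_of_nonneg (by linarith : 0 ≤ τ₁ - T)] at hb
  have hlog : 0 ≤ Real.log τ₁ := Real.log_nonneg (by linarith)
  have hτ0 : |τ₀ * Real.log (τ₀ / (2 * Real.pi)) - τ₀| ≤ 107 * Real.log τ₁ := by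
    have a1 := five_half_le_log_div h0
    have a2 := log_div_two_pi_le (t := τ₀) (by linarith)
    have a3 := Real.log_le_log (by linarith : 0 < τ₀) h
    rw [abs_of_nonneg (by nlinarith)]
    nlinarith
  have hM := mainTerm_eq (T := T) (by linarith)
  set G1 := τ₁ * Real.log (τ₁ / (2 * Real.pi)) - τ₁
  set G0 := τ₀ * Real.log (τ₀ / (2 * Real.pi)) - τ₀
  rw [hM]
  have e2 : (∫ t in τ₀..τ₁, Lam (σ + t * Complex.I)) -
      ((T * Real.log (T / (2 * Real.pi)) - T : ℝ) : ℂ) =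
      ((∫ t in τ₀..τ₁, Lam (σ + t * Complex.I)) - ((G1 - G0 : ℝ) : ℂ)) +
      ((G1 - (T * Real.log (T / (2 * Real.pi)) - T) - G0 : ℝ) : ℂ) := by push_cast; ring
  rw [e2]
  refine (norm_add_le _ _).trans ?_
  rw [Complex.norm_real, Real.norm_eq_abs]
  have e3 := abs_sub (G1 - (T * Real.log (T / (2 * Real.pi)) - T)) G0
  have e4 : Real.log τ₁ * (τ₁ - T) ≤ 7 * Real.log τ₁ := by nlinarith
  linarith

/-- The contribution `1 / |q - l|` of the nearly resonant pairs `q ≠ l`, `q < 2l`. -/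
noncomputable def nearTerm (q l : ℕ) : ℝ := if q ≠ l ∧ q < 2 * l then 1 / |(q : ℝ) - l| else 0

theorem nearTerm_nonneg (q l : ℕ) : 0 ≤ nearTerm q l := by
  unfold nearTerm
  split_ifs <;> positivity

/-- The size `1 / |log (l / q)|` of an oscillating integral, weighted by `1 / q`, is of order `1 / q`
unless `q` and `l` are of comparable size. -/
theorem inv_abs_log_div_le {q l : ℕ} (hq : 0 < q) (hl : 0 < l) (hne : q ≠ l) :
    1 / |Real.log (l / q)| * (1 / q) ≤ 2 / q + nearTerm q l := by
  have hq' : (0 : ℝ) < q := Nat.cast_pos.2 hq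
  have hl' : (0 : ℝ) < l := Nat.cast_pos.2 hl
  rcases lt_or_gt_of_ne hne with hlt | hlt
  · have hlt' : (q : ℝ) < l := Nat.cast_lt.2 hlt
    have hsub : 0 < (l : ℝ) - q := by linarith
    have hlog : ((l : ℝ) - q) / l ≤ Real.log (l / q) := by
      have := Real.one_sub_inv_le_log_of_pos (div_pos hl' hq')
      rw [inv_div] at this
      rwa [sub_div, div_self hl'.ne']
    have hpos : 0 < ((l : ℝ) - q) / l := by positivity
    rw [abs_of_pos (hpos.trans_le hlog)]
    have hn : nearTerm q l = 1 / ((l : ℝ) - q) := by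
      unfold nearTerm
      rw [if_pos ⟨hne, by omega⟩, abs_sub_comm, abs_of_pos hsub]
    rw [hn]
    calc _ ≤ 1 / (((l : ℝ) - q) / l) * (1 / q) := by gcongr
      _ = 1 / q + 1 / ((l : ℝ) - q) := by field_simp; ring
      _ ≤ _ := by gcongr; norm_num
  · have hlt' : (l : ℝ) < q := Nat.cast_lt.2 hlt
    have hsub : 0 < (q : ℝ) - l := by linarith
    have hlog : ((q : ℝ) - l) / q ≤ |Real.log (l / q)| := by
      have := Real.one_sub_inv_le_log_of_pos (div_pos hq' hl')
      rw [inv_div] at this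
      have e : Real.log (l / q) = -Real.log (q / l) := by rw [← Real.log_inv, inv_div]
      rw [e, abs_neg, sub_div, div_self hq'.ne']
      exact this.trans (le_abs_self _)
    have hpos : 0 < ((q : ℝ) - l) / q := by positivity
    have step : 1 / |Real.log (l / q)| * (1 / q) ≤ 1 / ((q : ℝ) - l) := by
      calc _ ≤ 1 / (((q : ℝ) - l) / q) * (1 / q) := by gcongr
        _ = 1 / ((q : ℝ) - l) := by field_simp
    refine step.trans ?_
    by_cases h2 : q < 2 * l
    · have hn : nearTerm q l = 1 / ((q : ℝ) - l) := by
        unfold nearTerm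
        rw [if_pos ⟨hne, h2⟩, abs_of_pos hsub]
      rw [hn]
      have : 0 ≤ 2 / (q : ℝ) := by positivity
      linarith
    · have h2' : (2 : ℝ) * l ≤ q := by exact_mod_cast not_lt.1 h2
      have := nearTerm_nonneg q l
      have h3 : 1 / ((q : ℝ) - l) ≤ 2 / q := by
        rw [div_le_div_iff₀ hsub hq']; linarith
      linarith

/-- `∫ Λ(s) q^{-s} l^{s-1} dt` along a vertical segment with abscissa `σ`. -/
noncomputable def twistedIntegral (σ τ₀ τ₁ : ℝ) (q l : ℕ) : ℂ :=
  ∫ t in τ₀..τ₁, Lam (σ + t * Complex.I) * ((q : ℂ) ^ (-((σ : ℂ) + t * Complex.I)) *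
    (l : ℂ) ^ ((σ : ℂ) + t * Complex.I - 1))

theorem cpow_mul_cpow_eq {q l : ℕ} (hq : 0 < q) (hl : 0 < l) (σ t : ℝ) :
    (q : ℂ) ^ (-((σ : ℂ) + t * Complex.I)) * (l : ℂ) ^ ((σ : ℂ) + t * Complex.I - 1) =
      (((q : ℝ) ^ (-σ) * (l : ℝ) ^ (σ - 1) : ℝ) : ℂ) *
        Complex.exp (Complex.I * Real.log (l / q) * t) := by
  have hq' : (0 : ℝ) < q := Nat.cast_pos.2 hq
  have hl' : (0 : ℝ) < l := Nat.cast_pos.2 hl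
  rw [Complex.cpow_def_of_ne_zero (Nat.cast_ne_zero.2 hq.ne'),
    Complex.cpow_def_of_ne_zero (Nat.cast_ne_zero.2 hl.ne'), Real.rpow_def_of_pos hq',
    Real.rpow_def_of_pos hl', ← Complex.ofReal_natCast, ← Complex.ofReal_natCast,
    ← Complex.ofReal_log hq'.le, ← Complex.ofReal_log hl'.le, Real.log_div hl'.ne' hq'.ne']
  push_cast
  rw [← Complex.exp_add, ← Complex.exp_add, ← Complex.exp_add]
  congr 1
  ring

theorem twistedIntegral_eq {q l : ℕ} (hq : 0 < q) (hl : 0 < l) (σ τ₀ τ₁ : ℝ) :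
    twistedIntegral σ τ₀ τ₁ q l = (((q : ℝ) ^ (-σ) * (l : ℝ) ^ (σ - 1) : ℝ) : ℂ) *
      ∫ t in τ₀..τ₁, Lam (σ + t * Complex.I) *
        Complex.exp (Complex.I * Real.log (l / q) * t) := by
  rw [twistedIntegral, ← intervalIntegral.integral_const_mul]
  congr 1
  funext t
  rw [cpow_mul_cpow_eq hq hl]
  ring

/-- The diagonal `q = l` carries the main term; off the diagonal the integral oscillates. -/
theorem norm_twistedIntegral_sub_le {σ τ₀ τ₁ T : ℝ} (h1 : 1 ≤ σ) (h2 : σ ≤ 3 / 2)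
    (h0 : 100 ≤ τ₀) (h0' : τ₀ ≤ 107) (hT : 107 ≤ T) (hT1 : T ≤ τ₁) (hT2 : τ₁ ≤ T + 7)
    {q l : ℕ} (hq : 0 < q) (hl : 0 < l) :
    ‖twistedIntegral σ τ₀ τ₁ q l - (if q = l then (mainTerm T / l : ℂ) else 0)‖ ≤
      125 * Real.log τ₁ * (l : ℝ) ^ (σ - 1) * (3 * (q : ℝ) ^ (-σ) + nearTerm q l) := by
  have hq' : (0 : ℝ) < q := Nat.cast_pos.2 hq
  have hl' : (0 : ℝ) < l := Nat.cast_pos.2 hl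
  have hlog : 0 ≤ Real.log τ₁ := Real.log_nonneg (by linarith)
  have hnear := nearTerm_nonneg q l
  have hA : 0 ≤ (q : ℝ) ^ (-σ) := by positivity
  have hB : 0 ≤ (l : ℝ) ^ (σ - 1) := by positivity
  rw [twistedIntegral_eq hq hl]
  by_cases hql : q = l
  · subst hql
    have hc : (q : ℝ) ^ (-σ) * (q : ℝ) ^ (σ - 1) = 1 / q := by
      rw [← Real.rpow_add hq', show -σ + (σ - 1) = -1 by ring, Real.rpow_neg_one, one_div]
    have e := norm_integral_Lam_sub_mainTerm_le (σ := σ) (by linarith) h2 h0 h0' hT hT1 hT2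
    simp only [if_true, div_self hq'.ne', Real.log_one, Complex.ofReal_zero, mul_zero, zero_mul,
      Complex.exp_zero, mul_one]
    rw [hc]
    have e2 : ((1 / q : ℝ) : ℂ) * (∫ t in τ₀..τ₁, Lam (σ + t * Complex.I)) - mainTerm T / q =
        ((1 / q : ℝ) : ℂ) * ((∫ t in τ₀..τ₁, Lam (σ + t * Complex.I)) - mainTerm T) := by
      push_cast; ring
    rw [e2, norm_mul, Complex.norm_real, Real.norm_of_nonneg (by positivity)]
    calc _ ≤ 1 / (q : ℝ) * (125 * Real.log τ₁) := by gcongr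
      _ = 125 * Real.log τ₁ * ((q : ℝ) ^ (-σ) * (q : ℝ) ^ (σ - 1)) := by rw [hc]; ring
      _ = 125 * Real.log τ₁ * (q : ℝ) ^ (σ - 1) * (q : ℝ) ^ (-σ) := by ring
      _ ≤ _ := by gcongr; linarith
  · rw [if_neg hql, sub_zero, norm_mul, Complex.norm_real, Real.norm_of_nonneg (by positivity)]
    have hu : Real.log ((l : ℝ) / q) ≠ 0 := by
      refine Real.log_ne_zero_of_pos_of_ne_one (by positivity) fun h => hql ?_
      rw [div_eq_one_iff_eq hq'.ne'] at h
      exact_mod_cast h.symm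
    have e := norm_integral_Lam_mul_exp_le (σ := σ) (by linarith) h2 h0 (by linarith : τ₀ ≤ τ₁) hu
    have hinv := inv_abs_log_div_le hq hl hql
    have hsplit : (q : ℝ) ^ (-σ) = (q : ℝ) ^ (1 - σ) * (1 / q) := by
      rw [one_div, ← Real.rpow_neg_one, ← Real.rpow_add hq']
      congr 1
      ring
    have hle1 : (q : ℝ) ^ (1 - σ) ≤ 1 :=
      Real.rpow_le_one_of_one_le_of_nonpos (by exact_mod_cast hq) (by linarith)
    have hbound : (q : ℝ) ^ (-σ) * (1 + 1 / |Real.log (l / q)|) ≤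
        3 * (q : ℝ) ^ (-σ) + nearTerm q l := by
      have hC : 0 ≤ (q : ℝ) ^ (1 - σ) := by positivity
      have k := mul_le_mul_of_nonneg_left hinv hC
      have k2 : (q : ℝ) ^ (1 - σ) * nearTerm q l ≤ nearTerm q l := mul_le_of_le_one_left hnear hle1
      have k3 : (q : ℝ) ^ (1 - σ) * (2 / q) = 2 * (q : ℝ) ^ (-σ) := by rw [hsplit]; ring
      have k4 : (q : ℝ) ^ (-σ) * (1 / |Real.log (l / q)|) =
          (q : ℝ) ^ (1 - σ) * (1 / |Real.log (l / q)| * (1 / q)) := by rw [hsplit]; ring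
      rw [mul_add, mul_one, k4]
      linarith
    calc _ ≤ (q : ℝ) ^ (-σ) * (l : ℝ) ^ (σ - 1) *
          (11 * Real.log τ₁ * (1 + 1 / |Real.log (l / q)|)) := by gcongr
      _ = 11 * Real.log τ₁ * (l : ℝ) ^ (σ - 1) *
          ((q : ℝ) ^ (-σ) * (1 + 1 / |Real.log (l / q)|)) := by ring
      _ ≤ 125 * Real.log τ₁ * (l : ℝ) ^ (σ - 1) * (3 * (q : ℝ) ^ (-σ) + nearTerm q l) := by
        gcongr
        norm_num

/-! ### Sums over resonant and nearly resonant pairs -/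

theorem sum_Icc_inv_le (N : ℕ) : ∑ n ∈ Finset.Icc 1 N, 1 / (n : ℝ) ≤ 1 + Real.log N := by
  have h := harmonic_le_one_add_log N
  rw [harmonic_eq_sum_Icc] at h
  push_cast at h
  simpa only [one_div] using h

theorem sum_inv_comp_le {A : Finset ℕ} {i : ℕ → ℕ} {K : ℕ} (hi : Set.InjOn i A)
    (hK : ∀ l ∈ A, i l ∈ Finset.Icc 1 K) : ∑ l ∈ A, 1 / (i l : ℝ) ≤ 1 + Real.log K := by
  rw [← Finset.sum_image (f := fun k : ℕ => 1 / (k : ℝ)) hi]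
  refine le_trans (Finset.sum_le_sum_of_subset_of_nonneg ?_ fun _ _ _ => by positivity)
    (sum_Icc_inv_le K)
  exact Finset.image_subset_iff.2 hK

theorem sum_nearTerm_le (q M : ℕ) :
    ∑ l ∈ Finset.Icc 1 M, nearTerm q l ≤ 2 * (1 + Real.log (2 * M : ℕ)) := by
  set A := (Finset.Icc 1 M).filter (fun l => l < q ∧ q < 2 * l) with hA
  set B := (Finset.Icc 1 M).filter (fun l => q < l) with hB
  have h1 : ∑ l ∈ Finset.Icc 1 M, nearTerm q l ≤
      ∑ l ∈ A, 1 / ((q - l : ℕ) : ℝ) + ∑ l ∈ B, 1 / ((l - q : ℕ) : ℝ) := by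
    rw [hA, hB, Finset.sum_filter, Finset.sum_filter, ← Finset.sum_add_distrib]
    refine Finset.sum_le_sum fun l _ => ?_
    unfold nearTerm
    rcases lt_trichotomy l q with h | h | h
    · by_cases h2 : q < 2 * l
      · rw [if_pos ⟨h.ne', h2⟩, if_pos ⟨h, h2⟩, if_neg (by omega), add_zero, Nat.cast_sub h.le,
          abs_of_pos (sub_pos.2 (Nat.cast_lt.2 h))]
      · rw [if_neg (by tauto), if_neg (by tauto), if_neg (by omega), add_zero]
    · rw [if_neg (by tauto), if_neg (by omega), if_neg (by omega), add_zero]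
    · rw [if_pos ⟨h.ne, by omega⟩, if_neg (by omega), if_pos h, zero_add, Nat.cast_sub h.le,
        abs_sub_comm, abs_of_pos (sub_pos.2 (Nat.cast_lt.2 h))]
  have h2 : ∑ l ∈ A, 1 / ((q - l : ℕ) : ℝ) ≤ 1 + Real.log (2 * M : ℕ) := by
    refine sum_inv_comp_le (i := fun l => q - l) ?_ ?_
    · intro a ha b hb hab
      simp only [hA, Finset.coe_filter, Set.mem_ofPred_eq] at ha hb hab
      omega
    · intro l hl
      simp only [hA, Finset.mem_filter, Finset.mem_Icc] at hl ⊢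
      omega
  have h3 : ∑ l ∈ B, 1 / ((l - q : ℕ) : ℝ) ≤ 1 + Real.log (2 * M : ℕ) := by
    refine sum_inv_comp_le (i := fun l => l - q) ?_ ?_
    · intro a ha b hb hab
      simp only [hB, Finset.coe_filter, Set.mem_ofPred_eq] at ha hb hab
      omega
    · intro l hl
      simp only [hB, Finset.mem_filter, Finset.mem_Icc] at hl ⊢
      omega
  linarith

theorem one_add_log_natCast_nonneg (n : ℕ) : 0 ≤ 1 + Real.log n := by
  have := Real.log_natCast_nonneg n
  linarith

/-- For each `m` only the `n` with `nm < 2M` contribute. -/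
theorem sum_sum_nearTerm_le (N M : ℕ) :
    ∑ m ∈ Finset.Icc 1 N, ∑ l ∈ Finset.Icc 1 M, ∑ n ∈ Finset.range (2 * M),
      nearTerm ((n + 1) * m) l ≤
      4 * M * (1 + Real.log N) * (1 + Real.log (2 * M : ℕ)) := by
  set K : ℝ := 2 * (1 + Real.log (2 * M : ℕ)) with hK
  have hK0 : 0 ≤ K := mul_nonneg zero_le_two (one_add_log_natCast_nonneg _)
  have hm : ∀ m ∈ Finset.Icc 1 N, ∑ l ∈ Finset.Icc 1 M, ∑ n ∈ Finset.range (2 * M),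
      nearTerm ((n + 1) * m) l ≤ 2 * M * K * (1 / (m : ℝ)) := by
    intro m hm
    have hm1 : 0 < m := (Finset.mem_Icc.1 hm).1
    rw [Finset.sum_comm]
    have h1 : ∀ n ∈ Finset.range (2 * M), ∑ l ∈ Finset.Icc 1 M, nearTerm ((n + 1) * m) l ≤
        if n < 2 * M / m then K else 0 := by
      intro n _
      split_ifs with h
      · exact sum_nearTerm_le _ _
      · refine (Finset.sum_eq_zero fun l hl => ?_).le
        unfold nearTerm
        rw [if_neg]
        rintro ⟨_, h2⟩
        refine h ?_
        rw [Nat.lt_iff_add_one_le, Nat.le_div_iff_mul_le hm1]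
        have := (Finset.mem_Icc.1 hl).2
        omega
    refine (Finset.sum_le_sum h1).trans ?_
    rw [← Finset.sum_filter, Finset.sum_const, nsmul_eq_mul]
    have hcard : ((Finset.filter (fun n => n < 2 * M / m) (Finset.range (2 * M))).card : ℝ) ≤
        2 * M / m := by
      calc _ ≤ ((Finset.range (2 * M / m)).card : ℝ) := by
            refine Nat.cast_le.2 (Finset.card_le_card fun n hn => ?_)
            exact Finset.mem_range.2 (Finset.mem_filter.1 hn).2
        _ ≤ ((2 * M : ℕ) : ℝ) / m := by rw [Finset.card_range]; exact Nat.cast_div_le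
        _ = 2 * M / m := by push_cast; rfl
    calc _ ≤ 2 * M / m * K := by gcongr
      _ = _ := by ring
  refine (Finset.sum_le_sum hm).trans ?_
  rw [← Finset.mul_sum]
  calc _ ≤ 2 * M * K * (1 + Real.log N) := by gcongr; exact sum_Icc_inv_le N
    _ = _ := by rw [hK]; ring

/-- `ζ(σ) ≤ 1 + 1 / (σ - 1)` for real `σ > 1`. -/
theorem hasSum_rpow_neg {σ : ℝ} (hσ : 1 < σ) :
    ∃ Z : ℝ, Z ≤ 1 + 1 / (σ - 1) ∧ HasSum (fun n : ℕ => ((n + 1 : ℕ) : ℝ) ^ (-σ)) Z := by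
  have hs : Summable fun n : ℕ => ((n + 1 : ℕ) : ℝ) ^ (-σ) :=
    (summable_nat_add_iff 1).2 (Real.summable_nat_rpow.2 (by linarith))
  refine ⟨_, ?_, hs.hasSum⟩
  have h := ZetaAsymptotics.zeta_limit_aux1 hσ
  have h1 : 0 ≤ σ * ZetaAsymptotics.termTSum σ :=
    mul_nonneg (by linarith) (tsum_nonneg fun n => ZetaAsymptotics.term_nonneg _ _)
  have e : ∑' n : ℕ, ((n + 1 : ℕ) : ℝ) ^ (-σ) = ∑' n : ℕ, 1 / ((n : ℝ) + 1) ^ σ := by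
    congr 1
    funext n
    rw [Real.rpow_neg (by positivity), one_div]
    push_cast
    rfl
  rw [e]
  linarith

/-! ### Mean values of Dirichlet polynomials against `Λ` and `Λζ` -/

theorem dirPoly_mul_dirPoly (X Y : ℝ) (x y : ℕ → ℂ) (s : ℂ) :
    dirPoly X x s * dirPoly Y y (1 - s) = ∑ m ∈ Finset.Icc 1 ⌊X⌋₊, ∑ l ∈ Finset.Icc 1 ⌊Y⌋₊,
      x m * y l * ((m : ℂ) ^ (-s) * (l : ℂ) ^ (s - 1)) := by
  unfold dirPoly
  rw [Finset.sum_mul_sum]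
  refine Finset.sum_congr rfl fun m _ => Finset.sum_congr rfl fun l _ => ?_
  rw [Complex.cpow_neg, show s - 1 = -(1 - s) by ring, Complex.cpow_neg]
  ring

theorem continuous_natCast_cpow_vertical {m : ℕ} (hm : 0 < m) (σ : ℝ) :
    Continuous fun t : ℝ => (m : ℂ) ^ (-((σ : ℂ) + t * Complex.I)) := by
  refine Continuous.const_cpow (by fun_prop) (Or.inl (Nat.cast_ne_zero.2 hm.ne'))

theorem continuous_natCast_cpow_vertical' {m : ℕ} (hm : 0 < m) (σ : ℝ) :
    Continuous fun t : ℝ => (m : ℂ) ^ ((σ : ℂ) + t * Complex.I - 1) := by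
  refine Continuous.const_cpow (by fun_prop) (Or.inl (Nat.cast_ne_zero.2 hm.ne'))

theorem integral_mul_dirPoly {g : ℝ → ℂ} {τ₀ τ₁ : ℝ} (h : τ₀ ≤ τ₁)
    (hg : ContinuousOn g (Set.Icc τ₀ τ₁)) (X Y : ℝ) (x y : ℕ → ℂ) (σ : ℝ) :
    ∫ t in τ₀..τ₁, g t * (dirPoly X x (σ + t * Complex.I) * dirPoly Y y (1 - (σ + t * Complex.I))) =
      ∑ m ∈ Finset.Icc 1 ⌊X⌋₊, ∑ l ∈ Finset.Icc 1 ⌊Y⌋₊, x m * y l *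
        ∫ t in τ₀..τ₁, g t * ((m : ℂ) ^ (-((σ : ℂ) + t * Complex.I)) *
          (l : ℂ) ^ ((σ : ℂ) + t * Complex.I - 1)) := by
  have hint : ∀ m ∈ Finset.Icc 1 ⌊X⌋₊, ∀ l ∈ Finset.Icc 1 ⌊Y⌋₊, IntervalIntegrable
      (fun t : ℝ => x m * y l * (g t * ((m : ℂ) ^ (-((σ : ℂ) + t * Complex.I)) *
          (l : ℂ) ^ ((σ : ℂ) + t * Complex.I - 1)))) MeasureTheory.volume τ₀ τ₁ := by
    intro m hm l hl
    refine ContinuousOn.intervalIntegrable ?_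
    rw [Set.uIcc_of_le h]
    exact continuousOn_const.mul (hg.mul
      ((continuous_natCast_cpow_vertical (Finset.mem_Icc.1 hm).1 σ).mul
        (continuous_natCast_cpow_vertical' (Finset.mem_Icc.1 hl).1 σ)).continuousOn)
  have e : ∀ t : ℝ, g t * (dirPoly X x (σ + t * Complex.I) *
      dirPoly Y y (1 - (σ + t * Complex.I))) =
      ∑ m ∈ Finset.Icc 1 ⌊X⌋₊, ∑ l ∈ Finset.Icc 1 ⌊Y⌋₊, x m * y l *
        (g t * ((m : ℂ) ^ (-((σ : ℂ) + t * Complex.I)) *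
          (l : ℂ) ^ ((σ : ℂ) + t * Complex.I - 1))) := by
    intro t
    rw [dirPoly_mul_dirPoly, Finset.mul_sum]
    refine Finset.sum_congr rfl fun m _ => ?_
    rw [Finset.mul_sum]
    refine Finset.sum_congr rfl fun l _ => ?_
    ring
  simp only [e]
  rw [intervalIntegral.integral_finsetSum fun m hm => by
    have hI := IntervalIntegrable.sum _ (hint m hm)
    rw [Finset.sum_fn] at hI
    exact hI]
  refine Finset.sum_congr rfl fun m hm => ?_
  rw [intervalIntegral.integral_finsetSum fun l hl => hint m hm l hl]
  refine Finset.sum_congr rfl fun l _ => ?_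
  rw [intervalIntegral.integral_const_mul]

theorem norm_cpow_mul_cpow_vertical {m l : ℕ} (hm : 0 < m) (hl : 0 < l) (σ t : ℝ) :
    ‖(m : ℂ) ^ (-((σ : ℂ) + t * Complex.I)) * (l : ℂ) ^ ((σ : ℂ) + t * Complex.I - 1)‖ =
      (m : ℝ) ^ (-σ) * (l : ℝ) ^ (σ - 1) := by
  rw [norm_mul, Complex.norm_natCast_cpow_of_pos hm, Complex.norm_natCast_cpow_of_pos hl]
  simp

/-- Expanding the zeta function into its Dirichlet series under the integral sign. -/
theorem hasSum_twistedIntegral {σ τ₀ τ₁ : ℝ} (hσ : 1 < σ) (hσ2 : σ ≤ 3 / 2) (h0 : 100 ≤ τ₀)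
    (h : τ₀ ≤ τ₁) {m l : ℕ} (hm : 0 < m) (hl : 0 < l) :
    HasSum (fun n : ℕ => twistedIntegral σ τ₀ τ₁ ((n + 1) * m) l)
      (∫ t in τ₀..τ₁, Lam (σ + t * Complex.I) * riemannZeta (σ + t * Complex.I) *
        ((m : ℂ) ^ (-((σ : ℂ) + t * Complex.I)) * (l : ℂ) ^ ((σ : ℂ) + t * Complex.I - 1))) := by
  obtain ⟨Z, -, hZ⟩ := hasSum_rpow_neg hσ
  have hlog : 0 ≤ Real.log τ₁ := Real.log_nonneg (by linarith)
  set K : ℝ := Real.log τ₁ * ((m : ℝ) ^ (-σ) * (l : ℝ) ^ (σ - 1)) with hK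
  have hsplit : ∀ (n : ℕ) (t : ℝ), Lam (σ + t * Complex.I) *
      ((((n + 1) * m : ℕ) : ℂ) ^ (-((σ : ℂ) + t * Complex.I)) *
        (l : ℂ) ^ ((σ : ℂ) + t * Complex.I - 1)) =
      ((n + 1 : ℕ) : ℂ) ^ (-((σ : ℂ) + t * Complex.I)) * (Lam (σ + t * Complex.I) *
        ((m : ℂ) ^ (-((σ : ℂ) + t * Complex.I)) * (l : ℂ) ^ ((σ : ℂ) + t * Complex.I - 1))) := by
    intro n t
    rw [Nat.cast_mul, Complex.natCast_mul_natCast_cpow]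
    ring
  refine intervalIntegral.hasSum_integral_of_dominated_convergence
    (fun n _ => ((n + 1 : ℕ) : ℝ) ^ (-σ) * K) (fun n => ?_) (fun n => ?_) ?_ ?_ ?_
  · rw [Set.uIoc_of_le h]
    refine (ContinuousOn.mono ?_ Set.Ioc_subset_Icc_self).aestronglyMeasurable measurableSet_Ioc
    exact (continuousOn_Lam_vertical σ (by linarith)).mul
      ((continuous_natCast_cpow_vertical (by positivity) σ).mul
        (continuous_natCast_cpow_vertical' hl σ)).continuousOn
  · refine Filter.Eventually.of_forall fun t ht => ?_
    rw [Set.uIoc_of_le h] at ht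
    have ht100 : 100 ≤ t := by linarith [ht.1]
    rw [hsplit, norm_mul, Complex.norm_natCast_cpow_of_pos n.succ_pos, norm_mul,
      norm_cpow_mul_cpow_vertical hm hl]
    have e1 : (-((σ : ℂ) + t * Complex.I)).re = -σ := by simp
    rw [e1, hK]
    gcongr
    exact (norm_Lam_le_log (by linarith) hσ2 ht100).trans
      (Real.log_le_log (by linarith) ht.2)
  · exact Filter.Eventually.of_forall fun t _ => (hZ.mul_right K).summable
  · exact intervalIntegrable_const
  · refine Filter.Eventually.of_forall fun t _ => ?_
    have hs : 1 < ((σ : ℂ) + t * Complex.I).re := by simpa using hσ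
    have hz : HasSum (fun n : ℕ => ((n + 1 : ℕ) : ℂ) ^ (-((σ : ℂ) + t * Complex.I)))
        (riemannZeta (σ + t * Complex.I)) := by
      rw [zeta_eq_tsum_one_div_nat_add_one_cpow hs]
      have hsum : Summable fun n : ℕ => ((n + 1 : ℕ) : ℂ) ^ (-((σ : ℂ) + t * Complex.I)) := by
        refine ((summable_nat_add_iff 1).2 (Complex.summable_one_div_nat_cpow.2 hs)).congr
          fun n => ?_
        rw [Complex.cpow_neg, one_div]
      convert hsum.hasSum using 3
      rw [Complex.cpow_neg, one_div]
      push_cast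
      rfl
    simp only [hsplit]
    have := hz.mul_right (Lam (σ + t * Complex.I) *
      ((m : ℂ) ^ (-((σ : ℂ) + t * Complex.I)) * (l : ℂ) ^ ((σ : ℂ) + t * Complex.I - 1)))
    rwa [mul_left_comm (riemannZeta _), ← mul_assoc (Lam _) (riemannZeta _)] at this

/-- The resonant terms `nm = l` of the Dirichlet series of `ζ` give the main term. -/
theorem norm_zeta_twistedIntegral_sub_le {σ τ₀ τ₁ T : ℝ} (h1 : 1 < σ) (h2 : σ ≤ 3 / 2)
    (h0 : 100 ≤ τ₀) (h0' : τ₀ ≤ 107) (hT : 107 ≤ T) (hT1 : T ≤ τ₁) (hT2 : τ₁ ≤ T + 7)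
    {m l M : ℕ} (hm : 0 < m) (hl : 0 < l) (hlM : l ≤ M) :
    ‖(∫ t in τ₀..τ₁, Lam (σ + t * Complex.I) * riemannZeta (σ + t * Complex.I) *
        ((m : ℂ) ^ (-((σ : ℂ) + t * Complex.I)) * (l : ℂ) ^ ((σ : ℂ) + t * Complex.I - 1))) -
      ∑ n ∈ Finset.range M, (if (n + 1) * m = l then (mainTerm T / l : ℂ) else 0)‖ ≤
      125 * Real.log τ₁ * (l : ℝ) ^ (σ - 1) * (3 * (m : ℝ) ^ (-σ) * (1 + 1 / (σ - 1)) +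
        ∑ n ∈ Finset.range (2 * M), nearTerm ((n + 1) * m) l) := by
  obtain ⟨Z, hZle, hZ⟩ := hasSum_rpow_neg h1
  have hlog : 0 ≤ Real.log τ₁ := Real.log_nonneg (by linarith)
  have ha := hasSum_twistedIntegral h1 h2 h0 (by linarith : τ₀ ≤ τ₁) hm hl
  have hd : HasSum (fun n : ℕ => if (n + 1) * m = l then (mainTerm T / l : ℂ) else 0)
      (∑ n ∈ Finset.range M, if (n + 1) * m = l then (mainTerm T / l : ℂ) else 0) := by
    refine hasSum_sum_of_ne_finset_zero fun n hn => if_neg fun h => hn ?_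
    rw [Finset.mem_range]
    have : n + 1 ≤ (n + 1) * m := Nat.le_mul_of_pos_right _ hm
    omega
  have hnear : HasSum (fun n : ℕ => nearTerm ((n + 1) * m) l)
      (∑ n ∈ Finset.range (2 * M), nearTerm ((n + 1) * m) l) := by
    refine hasSum_sum_of_ne_finset_zero fun n hn => if_neg fun h => hn ?_
    rw [Finset.mem_range]
    have : n + 1 ≤ (n + 1) * m := Nat.le_mul_of_pos_right _ hm
    omega
  have hb := (((hZ.mul_right ((m : ℝ) ^ (-σ))).mul_left 3).add hnear).mul_left
    (125 * Real.log τ₁ * (l : ℝ) ^ (σ - 1))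
  refine (HasSum.norm_le_of_bounded (ha.sub hd) hb fun n => ?_).trans ?_
  · refine (norm_twistedIntegral_sub_le h1.le h2 h0 h0' hT hT1 hT2
      (by positivity : 0 < (n + 1) * m) hl).trans (le_of_eq ?_)
    rw [Nat.cast_mul, Real.mul_rpow (by positivity) (by positivity)]
  · gcongr ?_ * (?_ + _)
    rw [mul_comm Z, ← mul_assoc]
    gcongr

theorem norm_le_coeffMax {X : ℝ} (x : ℕ → ℂ) {n : ℕ} (hn : n ∈ Finset.Icc 1 ⌊X⌋₊) :
    ‖x n‖ ≤ coeffMax X x := by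
  unfold coeffMax
  have := Finset.le_sup (f := fun n => ‖x n‖₊) hn
  exact_mod_cast this

theorem coeffMax_nonneg (X : ℝ) (x : ℕ → ℂ) : 0 ≤ coeffMax X x := NNReal.coe_nonneg _

theorem coeffSum_nonneg (X : ℝ) (x : ℕ → ℂ) : 0 ≤ coeffSum X x :=
  Finset.sum_nonneg fun _ _ => by positivity

theorem sum_norm_le (X : ℝ) (x : ℕ → ℂ) :
    ∑ n ∈ Finset.Icc 1 ⌊X⌋₊, ‖x n‖ ≤ ⌊X⌋₊ * coeffSum X x := by
  rw [coeffSum, Finset.mul_sum]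
  refine Finset.sum_le_sum fun n hn => ?_
  obtain ⟨h1, h2⟩ := Finset.mem_Icc.1 hn
  have h1' : (0 : ℝ) < n := Nat.cast_pos.2 h1
  have h2' : (n : ℝ) ≤ ⌊X⌋₊ := Nat.cast_le.2 h2
  rw [mul_div_assoc', le_div_iff₀ h1', mul_comm]
  gcongr

/-- `diagSum` as a sum over all pairs, with the coefficients produced by the Dirichlet series of `ζ`. -/
theorem diagSum_eq (X Y : ℝ) (x y : ℕ → ℂ) : diagSum X Y x y =
    ∑ m ∈ Finset.Icc 1 ⌊X⌋₊, ∑ l ∈ Finset.Icc 1 ⌊Y⌋₊, x m * y l *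
      ∑ n ∈ Finset.range ⌊Y⌋₊, (if (n + 1) * m = l then (1 / l : ℂ) else 0) := by
  unfold diagSum
  refine Finset.sum_congr rfl fun m hm => ?_
  have hm1 := (Finset.mem_Icc.1 hm).1
  simp only [Finset.mul_sum]
  rw [Finset.sum_comm, Finset.sum_filter, ← Finset.sum_image (s := Finset.range ⌊Y⌋₊)
    (g := fun n => n + 1) (f := fun k => ∑ l ∈ Finset.Icc 1 ⌊Y⌋₊,
      x m * y l * (if k * m = l then (1 / l : ℂ) else 0)) (fun a _ b _ h => by simpa using h)]
  have himg : Finset.image (fun n => n + 1) (Finset.range ⌊Y⌋₊) = Finset.Icc 1 ⌊Y⌋₊ := by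
    ext k
    simp only [Finset.mem_image, Finset.mem_range, Finset.mem_Icc]
    constructor
    · rintro ⟨n, hn, rfl⟩; omega
    · rintro ⟨h1, h2⟩; exact ⟨k - 1, by omega, by omega⟩
  rw [himg]
  refine Finset.sum_congr rfl fun n hn => ?_
  have hn1 := (Finset.mem_Icc.1 hn).1
  simp only [mul_ite, mul_zero]
  rw [Finset.sum_ite_eq]
  have hpos : 1 ≤ n * m := Nat.mul_pos hn1 hm1
  by_cases h : m * n ≤ ⌊Y⌋₊
  · rw [if_pos h, if_pos (Finset.mem_Icc.2 ⟨hpos, by rwa [mul_comm]⟩), mul_comm n m]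
    push_cast
    ring
  · rw [if_neg h, if_neg fun h' => h (by rw [mul_comm]; exact (Finset.mem_Icc.1 h').2)]

theorem log_le_two_mul_log {T τ : ℝ} (hT : 107 ≤ T) (hτ : 0 < τ) (hτ2 : τ ≤ T + 7) :
    Real.log τ ≤ 2 * Real.log T := by
  rw [show 2 * Real.log T = Real.log (T ^ 2) by rw [Real.log_pow]; norm_num]
  exact Real.log_le_log hτ (by nlinarith)

theorem two_le_log {T : ℝ} (hT : 107 ≤ T) : 2 ≤ Real.log T := by
  have := five_half_le_log_div (t := T) (by linarith)
  have := log_div_two_pi_le (t := T) (by linarith)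
  linarith

/-- With the abscissa `1 + 1 / log T`, powers `y ^ (σ - 1)` with `y ≤ T` stay bounded. -/
theorem rpow_inv_log_le {T : ℝ} (hT : 107 ≤ T) {y : ℝ} (hy : 1 ≤ y) (hyT : y ≤ T) :
    y ^ (1 / Real.log T) ≤ 3 := by
  have hL := two_le_log hT
  calc y ^ (1 / Real.log T) ≤ T ^ (1 / Real.log T) := by gcongr
    _ = Real.exp 1 := by
      rw [Real.rpow_def_of_pos (by linarith), mul_one_div, div_self (by linarith)]
    _ ≤ 3 := by have := Real.exp_one_lt_d9; linarith

theorem floor_le_of_le {X T : ℝ} (hT : 0 ≤ T) (hXT : X ≤ T) : (⌊X⌋₊ : ℝ) ≤ T :=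
  (Nat.cast_le.2 (Nat.floor_le_floor hXT)).trans (Nat.floor_le hT)

theorem one_add_log_floor_le {X T : ℝ} (hT : 107 ≤ T) (hXT : X ≤ T) :
    1 + Real.log ⌊X⌋₊ ≤ 2 * Real.log T := by
  have hL := two_le_log hT
  have h := floor_le_of_le (by linarith) hXT
  rcases Nat.eq_zero_or_pos ⌊X⌋₊ with h0 | h0
  · rw [h0]; simp; linarith
  · have := Real.log_le_log (by exact_mod_cast h0) h
    linarith

theorem one_add_log_two_mul_floor_le {X T : ℝ} (hT : 107 ≤ T) (hXT : X ≤ T) :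
    1 + Real.log (2 * ⌊X⌋₊ : ℕ) ≤ 3 * Real.log T := by
  have hL := two_le_log hT
  rcases Nat.eq_zero_or_pos ⌊X⌋₊ with h0 | h0
  · rw [h0]; simp; linarith
  · have h1 := one_add_log_floor_le hT hXT
    have h2 : Real.log (2 * ⌊X⌋₊ : ℕ) = Real.log 2 + Real.log ⌊X⌋₊ := by
      push_cast
      exact Real.log_mul two_ne_zero (by exact_mod_cast h0.ne')
    have := Real.log_two_lt_d9
    linarith

/-- The mean value of `ζ(s) X(s) Y(1-s)` against `Λ` just to the right of the line of absolute
convergence. -/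
theorem norm_zetaMoment_sub_le {τ₀ τ₁ T : ℝ} (h0 : 100 ≤ τ₀) (h0' : τ₀ ≤ 107) (hT : 107 ≤ T)
    (hT1 : T ≤ τ₁) (hT2 : τ₁ ≤ T + 7) {X Y : ℝ} (hX : X ≤ T) (hY : Y ≤ T) (x y : ℕ → ℂ) {σ : ℝ}
    (hσ : σ = 1 + 1 / Real.log T) :
    ‖(∫ t in τ₀..τ₁, Lam (σ + t * Complex.I) * riemannZeta (σ + t * Complex.I) *
        (dirPoly X x (σ + t * Complex.I) * dirPoly Y y (1 - (σ + t * Complex.I)))) -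
      mainTerm T * diagSum X Y x y‖ ≤
      18000 * (⌊Y⌋₊ * Real.log T ^ 2 * coeffSum X x * coeffSum Y y +
        ⌊Y⌋₊ * Real.log T ^ 3 * coeffMax X x * coeffMax Y y) := by
  have hL := two_le_log hT
  set L := Real.log T with hLdef
  have hLinv : 1 / L ≤ 1 / 2 := by gcongr
  have hLinv0 : 0 < 1 / L := by positivity
  have h1 : 1 < σ := by linarith
  have h2 : σ ≤ 3 / 2 := by linarith
  have hτ : τ₀ ≤ τ₁ := by linarith
  have hlogτ : Real.log τ₁ ≤ 2 * L := log_le_two_mul_log hT (by linarith) hT2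
  have hlogτ0 : 0 ≤ Real.log τ₁ := Real.log_nonneg (by linarith)
  have hcont : ContinuousOn (fun t : ℝ => Lam (σ + t * Complex.I) *
      riemannZeta (σ + t * Complex.I)) (Set.Icc τ₀ τ₁) := by
    refine (continuousOn_Lam_vertical σ (by linarith)).mul (Continuous.continuousOn ?_)
    refine continuous_iff_continuousAt.2 fun t => ?_
    have hne : (σ : ℂ) + t * Complex.I ≠ 1 := fun h => by
      have := congrArg Complex.re h
      simp at this
      linarith
    exact ContinuousAt.comp (f := fun t : ℝ => (σ : ℂ) + t * Complex.I)
      (differentiableAt_riemannZeta hne).continuousAt (by fun_prop)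
  rw [integral_mul_dirPoly hτ hcont, diagSum_eq, Finset.mul_sum, ← Finset.sum_sub_distrib]
  set N := ⌊X⌋₊
  set M := ⌊Y⌋₊
  set X₁ := coeffSum X x with hX₁
  set Y₁ := coeffSum Y y
  set X₀ := coeffMax X x
  set Y₀ := coeffMax Y y
  have hterm : ∀ m ∈ Finset.Icc 1 N, ∀ l ∈ Finset.Icc 1 M,
      ‖x m * y l * (∫ t in τ₀..τ₁, Lam (σ + t * Complex.I) * riemannZeta (σ + t * Complex.I) *
        ((m : ℂ) ^ (-((σ : ℂ) + t * Complex.I)) * (l : ℂ) ^ ((σ : ℂ) + t * Complex.I - 1))) -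
        mainTerm T * (x m * y l *
          ∑ n ∈ Finset.range M, (if (n + 1) * m = l then (1 / l : ℂ) else 0))‖ ≤
      750 * L * (6 * L * ((‖x m‖ / m) * ‖y l‖) +
        X₀ * Y₀ * ∑ n ∈ Finset.range (2 * M), nearTerm ((n + 1) * m) l) := by
    intro m hm l hl
    obtain ⟨hm1, hm2⟩ := Finset.mem_Icc.1 hm
    obtain ⟨hl1, hl2⟩ := Finset.mem_Icc.1 hl
    have hm' : (1 : ℝ) ≤ m := by exact_mod_cast hm1
    have hl' : (1 : ℝ) ≤ l := by exact_mod_cast hl1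
    have hlT : (l : ℝ) ≤ T := (Nat.cast_le.2 hl2).trans (floor_le_of_le (by linarith) hY)
    have hk := norm_zeta_twistedIntegral_sub_le h1 h2 h0 h0' hT hT1 hT2 hm1 hl1 hl2
    set near := ∑ n ∈ Finset.range (2 * M), nearTerm ((n + 1) * m) l with hnear
    have hnear0 : 0 ≤ near := Finset.sum_nonneg fun _ _ => nearTerm_nonneg _ _
    set D := ∫ t in τ₀..τ₁, Lam (σ + t * Complex.I) * riemannZeta (σ + t * Complex.I) *
        ((m : ℂ) ^ (-((σ : ℂ) + t * Complex.I)) * (l : ℂ) ^ ((σ : ℂ) + t * Complex.I - 1))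
    have e : x m * y l * D - mainTerm T * (x m * y l *
        ∑ n ∈ Finset.range M, (if (n + 1) * m = l then (1 / l : ℂ) else 0)) =
        x m * y l * (D - ∑ n ∈ Finset.range M,
          (if (n + 1) * m = l then (mainTerm T / l : ℂ) else 0)) := by
      rw [mul_sub, Finset.mul_sum, Finset.mul_sum, Finset.mul_sum]
      congr 1
      refine Finset.sum_congr rfl fun n _ => ?_
      split_ifs <;> ring
    have hσl : (l : ℝ) ^ (σ - 1) ≤ 3 := by
      rw [hσ, add_sub_cancel_left]; exact rpow_inv_log_le hT hl' hlT
    have hσm : (m : ℝ) ^ (-σ) ≤ 1 / m := by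
      rw [one_div, ← Real.rpow_neg_one]
      exact Real.rpow_le_rpow_of_exponent_le hm' (by linarith)
    have hZ : 1 + 1 / (σ - 1) ≤ 2 * L := by
      rw [hσ, add_sub_cancel_left, one_div_one_div]; linarith
    rw [e, norm_mul, norm_mul]
    have hxy : ‖x m‖ * ‖y l‖ ≤ X₀ * Y₀ :=
      mul_le_mul (norm_le_coeffMax x hm) (norm_le_coeffMax y hl) (norm_nonneg _)
        (coeffMax_nonneg _ _)
    calc _ ≤ ‖x m‖ * ‖y l‖ * (125 * (2 * L) * 3 * (3 * (1 / m) * (2 * L) + near)) := by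
          refine mul_le_mul_of_nonneg_left (hk.trans ?_) (by positivity)
          have : 0 ≤ 1 + 1 / (σ - 1) := by
            have : 0 < σ - 1 := by linarith
            positivity
          gcongr
      _ = 750 * L * (6 * L * ((‖x m‖ / m) * ‖y l‖) + ‖x m‖ * ‖y l‖ * near) := by ring
      _ ≤ _ := by gcongr
  calc _ ≤ ∑ m ∈ Finset.Icc 1 N, ∑ l ∈ Finset.Icc 1 M,
        750 * L * (6 * L * ((‖x m‖ / m) * ‖y l‖) +
          X₀ * Y₀ * ∑ n ∈ Finset.range (2 * M), nearTerm ((n + 1) * m) l) := by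
        refine (norm_sum_le _ _).trans (Finset.sum_le_sum fun m hm => ?_)
        rw [Finset.mul_sum, ← Finset.sum_sub_distrib]
        exact (norm_sum_le _ _).trans (Finset.sum_le_sum fun l hl => hterm m hm l hl)
    _ = 750 * L * (6 * L * (X₁ * ∑ l ∈ Finset.Icc 1 M, ‖y l‖) + X₀ * Y₀ *
          ∑ m ∈ Finset.Icc 1 N, ∑ l ∈ Finset.Icc 1 M, ∑ n ∈ Finset.range (2 * M),
            nearTerm ((n + 1) * m) l) := by
        rw [hX₁, coeffSum, Finset.sum_mul_sum]
        simp only [← Finset.mul_sum, Finset.sum_add_distrib]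
        rfl
    _ ≤ 750 * L * (6 * L * (X₁ * (M * Y₁)) + X₀ * Y₀ * (4 * M * (2 * L) * (3 * L))) := by
        have hX0 : 0 ≤ X₀ := coeffMax_nonneg _ _
        have hY0 : 0 ≤ Y₀ := coeffMax_nonneg _ _
        have hX1 : 0 ≤ X₁ := coeffSum_nonneg _ _
        gcongr
        · exact sum_norm_le Y y
        · refine (sum_sum_nearTerm_le N M).trans ?_
          have := one_add_log_natCast_nonneg (2 * M)
          gcongr
          · exact one_add_log_floor_le hT hX
          · exact one_add_log_two_mul_floor_le hT hY
    _ ≤ _ := by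
        have hX0 : 0 ≤ X₀ := coeffMax_nonneg _ _
        have hY0 : 0 ≤ Y₀ := coeffMax_nonneg _ _
        have hX1 : 0 ≤ X₁ := coeffSum_nonneg _ _
        have hY1 : 0 ≤ Y₁ := coeffSum_nonneg _ _
        have : 0 ≤ (M : ℝ) * L ^ 2 * X₁ * Y₁ := by positivity
        linarith

/-- The mean value of `X(s) Y(1-s)` against `Λ` just to the right of the line `Re s = 1`. -/
theorem norm_moment_sub_le {τ₀ τ₁ T : ℝ} (h0 : 100 ≤ τ₀) (h0' : τ₀ ≤ 107) (hT : 107 ≤ T)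
    (hT1 : T ≤ τ₁) (hT2 : τ₁ ≤ T + 7) {X : ℝ} (hX : X ≤ T) (x y : ℕ → ℂ) {σ : ℝ}
    (hσ : σ = 1 + 1 / Real.log T) :
    ‖(∫ t in τ₀..τ₁, Lam (σ + t * Complex.I) *
        (dirPoly X x (σ + t * Complex.I) * dirPoly X y (1 - (σ + t * Complex.I)))) -
      mainTerm T * ∑ n ∈ Finset.Icc 1 ⌊X⌋₊, x n * y n / n‖ ≤
      4500 * (⌊X⌋₊ * Real.log T * coeffSum X x * coeffSum X y +
        ⌊X⌋₊ * Real.log T ^ 2 * coeffMax X x * coeffMax X y) := by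
  have hL := two_le_log hT
  set L := Real.log T with hLdef
  have hLinv : 1 / L ≤ 1 / 2 := by gcongr
  have hLinv0 : 0 < 1 / L := by positivity
  have h1 : 1 < σ := by linarith
  have h2 : σ ≤ 3 / 2 := by linarith
  have hτ : τ₀ ≤ τ₁ := by linarith
  have hlogτ : Real.log τ₁ ≤ 2 * L := log_le_two_mul_log hT (by linarith) hT2
  have hlogτ0 : 0 ≤ Real.log τ₁ := Real.log_nonneg (by linarith)
  rw [integral_mul_dirPoly hτ (continuousOn_Lam_vertical σ (by linarith))]
  set N := ⌊X⌋₊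
  have hdiag : ∑ n ∈ Finset.Icc 1 N, x n * y n / n = ∑ m ∈ Finset.Icc 1 N, ∑ l ∈ Finset.Icc 1 N,
      x m * y l * (if m = l then (1 / l : ℂ) else 0) := by
    refine Finset.sum_congr rfl fun m hm => ?_
    simp only [mul_ite, mul_zero]
    rw [Finset.sum_ite_eq, if_pos hm]
    ring
  rw [hdiag, Finset.mul_sum, ← Finset.sum_sub_distrib]
  set X₁ := coeffSum X x with hX₁
  set Y₁ := coeffSum X y
  set X₀ := coeffMax X x
  set Y₀ := coeffMax X y
  have hX0 : 0 ≤ X₀ := coeffMax_nonneg _ _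
  have hY0 : 0 ≤ Y₀ := coeffMax_nonneg _ _
  have hX1 : 0 ≤ X₁ := coeffSum_nonneg _ _
  have hterm : ∀ m ∈ Finset.Icc 1 N, ∀ l ∈ Finset.Icc 1 N,
      ‖x m * y l * (∫ t in τ₀..τ₁, Lam (σ + t * Complex.I) *
        ((m : ℂ) ^ (-((σ : ℂ) + t * Complex.I)) * (l : ℂ) ^ ((σ : ℂ) + t * Complex.I - 1))) -
        mainTerm T * (x m * y l * (if m = l then (1 / l : ℂ) else 0))‖ ≤
      750 * L * (3 * ((‖x m‖ / m) * ‖y l‖) + X₀ * Y₀ * nearTerm m l) := by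
    intro m hm l hl
    obtain ⟨hm1, hm2⟩ := Finset.mem_Icc.1 hm
    obtain ⟨hl1, hl2⟩ := Finset.mem_Icc.1 hl
    have hm' : (1 : ℝ) ≤ m := by exact_mod_cast hm1
    have hl' : (1 : ℝ) ≤ l := by exact_mod_cast hl1
    have hlT : (l : ℝ) ≤ T := (Nat.cast_le.2 hl2).trans (floor_le_of_le (by linarith) hX)
    have hk := norm_twistedIntegral_sub_le h1.le h2 h0 h0' hT hT1 hT2 hm1 hl1
    have hnear0 := nearTerm_nonneg m l
    have e : x m * y l * twistedIntegral σ τ₀ τ₁ m l -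
        mainTerm T * (x m * y l * (if m = l then (1 / l : ℂ) else 0)) =
        x m * y l * (twistedIntegral σ τ₀ τ₁ m l -
          (if m = l then (mainTerm T / l : ℂ) else 0)) := by
      split_ifs <;> ring
    have hσl : (l : ℝ) ^ (σ - 1) ≤ 3 := by
      rw [hσ, add_sub_cancel_left]; exact rpow_inv_log_le hT hl' hlT
    have hσm : (m : ℝ) ^ (-σ) ≤ 1 / m := by
      rw [one_div, ← Real.rpow_neg_one]
      exact Real.rpow_le_rpow_of_exponent_le hm' (by linarith)
    have hxy : ‖x m‖ * ‖y l‖ ≤ X₀ * Y₀ :=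
      mul_le_mul (norm_le_coeffMax x hm) (norm_le_coeffMax y hl) (norm_nonneg _) hX0
    change ‖x m * y l * twistedIntegral σ τ₀ τ₁ m l - _‖ ≤ _
    rw [e, norm_mul, norm_mul]
    calc _ ≤ ‖x m‖ * ‖y l‖ * (125 * (2 * L) * 3 * (3 * (1 / m) + nearTerm m l)) := by
          refine mul_le_mul_of_nonneg_left (hk.trans ?_) (by positivity)
          gcongr
      _ = 750 * L * (3 * ((‖x m‖ / m) * ‖y l‖) + ‖x m‖ * ‖y l‖ * nearTerm m l) := by ring
      _ ≤ _ := by gcongr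
  calc _ ≤ ∑ m ∈ Finset.Icc 1 N, ∑ l ∈ Finset.Icc 1 N,
        750 * L * (3 * ((‖x m‖ / m) * ‖y l‖) + X₀ * Y₀ * nearTerm m l) := by
        refine (norm_sum_le _ _).trans (Finset.sum_le_sum fun m hm => ?_)
        rw [Finset.mul_sum, ← Finset.sum_sub_distrib]
        exact (norm_sum_le _ _).trans (Finset.sum_le_sum fun l hl => hterm m hm l hl)
    _ = 750 * L * (3 * (X₁ * ∑ l ∈ Finset.Icc 1 N, ‖y l‖) + X₀ * Y₀ *
          ∑ m ∈ Finset.Icc 1 N, ∑ l ∈ Finset.Icc 1 N, nearTerm m l) := by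
        rw [hX₁, coeffSum, Finset.sum_mul_sum]
        simp only [← Finset.mul_sum, Finset.sum_add_distrib]
        rfl
    _ ≤ 750 * L * (3 * (X₁ * (N * Y₁)) + X₀ * Y₀ * (N * (2 * (3 * L)))) := by
        gcongr
        · exact sum_norm_le X y
        · calc _ ≤ ∑ m ∈ Finset.Icc 1 N, 2 * (1 + Real.log (2 * N : ℕ)) :=
                Finset.sum_le_sum fun m _ => sum_nearTerm_le m N
            _ = N * (2 * (1 + Real.log (2 * N : ℕ))) := by simp
            _ ≤ _ := by
              gcongr
              exact one_add_log_two_mul_floor_le hT hX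
    _ ≤ _ := by
        have hY1 : 0 ≤ Y₁ := coeffSum_nonneg _ _
        have : 0 ≤ (N : ℝ) * L * X₁ * Y₁ := by positivity
        linarith

/-! ### Evaluation of the contour integral -/

theorem norm_integral_le_of_norm_le_div_sqrt {f : ℝ → ℂ} {τ₀ τ₁ C : ℝ} (h0 : 0 < τ₀) (h : τ₀ ≤ τ₁)
    (hC : 0 ≤ C) (hf : ∀ t ∈ Set.Icc τ₀ τ₁, ‖f t‖ ≤ C / Real.sqrt t) :
    ‖∫ t in τ₀..τ₁, f t‖ ≤ 2 * C * Real.sqrt τ₁ := by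
  have hpos : ∀ t ∈ Set.uIcc τ₀ τ₁, 0 < t := fun t ht => by
    rw [Set.uIcc_of_le h] at ht; linarith [ht.1]
  have hcont : ContinuousOn (fun t => C / Real.sqrt t) (Set.uIcc τ₀ τ₁) :=
    continuousOn_const.div Real.continuous_sqrt.continuousOn fun t ht =>
      (Real.sqrt_pos.2 (hpos t ht)).ne'
  have hI : ∫ t in τ₀..τ₁, C / Real.sqrt t =
      2 * C * Real.sqrt τ₁ - 2 * C * Real.sqrt τ₀ := by
    refine intervalIntegral.integral_eq_sub_of_hasDerivAt (f := fun t => 2 * C * Real.sqrt t)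
      (fun t ht => ?_) hcont.intervalIntegrable
    refine HasDerivAt.congr_deriv ((Real.hasDerivAt_sqrt (hpos t ht).ne').const_mul (2 * C)) ?_
    have := Real.sqrt_pos.2 (hpos t ht)
    field_simp
  refine (intervalIntegral.norm_integral_le_of_norm_le h (g := fun t => C / Real.sqrt t)
    (Filter.Eventually.of_forall fun t ht => hf t ⟨ht.1.le, ht.2⟩) hcont.intervalIntegrable).trans ?_
  rw [hI]
  have : 0 ≤ 2 * C * Real.sqrt τ₀ := by positivity
  linarith

/-- For small `D`, the kernel is close to a multiple of `D`. -/
theorem norm_kernel_sub_le_of_norm_le_half {f l D w : ℂ} (hw : ‖w‖ = 1) (hD : ‖D‖ ≤ 1 / 2) :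
    ‖f * (-l * D) / (D - w) - w⁻¹ * (l * (f * D))‖ ≤ 2 * (‖l‖ * ‖f * D‖ * ‖D‖) := by
  have hwne : w ≠ 0 := norm_pos_iff.1 (by rw [hw]; exact one_pos)
  have hsub : 1 / 2 ≤ ‖D - w‖ := by
    have := norm_sub_norm_le w D
    rw [norm_sub_rev, hw] at this
    linarith
  have hne : D - w ≠ 0 := norm_pos_iff.1 (by linarith)
  have e : f * (-l * D) / (D - w) - w⁻¹ * (l * (f * D)) = -(l * (f * D) * D) / ((D - w) * w) := by
    field_simp
    ring
  rw [e, norm_div, norm_neg, norm_mul (D - w) w, norm_mul, norm_mul, hw, mul_one,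
    div_le_iff₀ (by linarith)]
  have : 0 ≤ ‖l‖ * ‖f * D‖ * ‖D‖ := by positivity
  nlinarith

/-- For large `D`, the kernel is close to a constant. -/
theorem norm_kernel_add_le_of_two_le_norm {f l D w : ℂ} (hw : ‖w‖ = 1) (hD : 2 ≤ ‖D‖) :
    ‖f * (-l * D) / (D - w) + l * f‖ ≤ 2 * (‖l‖ * ‖f‖ * ‖D‖⁻¹) := by
  have hsub : ‖D‖ / 2 ≤ ‖D - w‖ := by
    have := norm_sub_norm_le D w
    rw [hw] at this
    linarith
  have hne : D - w ≠ 0 := norm_pos_iff.1 (by linarith)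
  have e : f * (-l * D) / (D - w) + l * f = -(l * f * w) / (D - w) := by
    field_simp
    ring
  rw [e, norm_div, norm_neg, norm_mul, norm_mul, hw, mul_one]
  calc ‖l‖ * ‖f‖ / ‖D - w‖ ≤ ‖l‖ * ‖f‖ / (‖D‖ / 2) := by
        gcongr
    _ = _ := by field_simp

/-- The sum of `f(1/2 + it)` over the solutions of `Δ(1/2 + it) = w`, expressed through integrals
over the two vertical lines. -/
theorem norm_sum_gramPoints_sub_le {f : ℂ → ℂ} (hf : DifferentiableOn ℂ f {s | 0 < s.im})
    {w : ℂ} (hw : ‖w‖ = 1) {σ τ₀ τ₁ : ℝ} (h1 : 1 < σ) (h2 : σ ≤ 3 / 2) (h0 : 100 ≤ τ₀)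
    (hτ : τ₀ ≤ τ₁) (hD₀ : Delta (1 / 2 + Complex.I * τ₀) = -w)
    (hD₁ : Delta (1 / 2 + Complex.I * τ₁) = -w) {P : Finset ℝ}
    (hP : ∀ t, t ∈ P ↔ τ₀ < t ∧ t < τ₁ ∧ Delta (1 / 2 + Complex.I * t) = w) {B K : ℝ}
    (hB : ∀ u ∈ Set.Icc (1 - σ) σ, ∀ t ∈ Set.Icc τ₀ τ₁,
      ‖f (u + t * Complex.I)‖ * ‖Delta (u + t * Complex.I)‖ ≤
        B * max 1 ‖Delta (u + t * Complex.I)‖)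
    (hR : ∀ t ∈ Set.Icc τ₀ τ₁, ‖f (σ + t * Complex.I) * Delta (σ + t * Complex.I)‖ ≤ K)
    (hL : ∀ t ∈ Set.Icc τ₀ τ₁, ‖f (((1 - σ : ℝ) : ℂ) + t * Complex.I)‖ ≤ K) :
    ‖2 * Real.pi * ∑ t ∈ P, f (1 / 2 + Complex.I * t) -
      (w⁻¹ * (∫ t in τ₀..τ₁, Lam (σ + t * Complex.I) *
          (f (σ + t * Complex.I) * Delta (σ + t * Complex.I))) +
        starRingEnd ℂ (∫ t in τ₀..τ₁, Lam (σ + t * Complex.I) *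
          starRingEnd ℂ (f (((1 - σ : ℝ) : ℂ) + t * Complex.I))))‖ ≤
      4 * (B * Real.log τ₁) + 24 * (K * Real.log τ₁ * Real.sqrt τ₁) := by
  have hlog : 0 ≤ Real.log τ₁ := Real.log_nonneg (by linarith)
  have hK : 0 ≤ K := (norm_nonneg _).trans (hL τ₀ ⟨le_rfl, hτ⟩)
  have hpos : ∀ t ∈ Set.Icc τ₀ τ₁, 100 ≤ t := fun t ht => h0.trans ht.1
  have hLam : ∀ u ∈ Set.Icc (1 - σ) σ, ∀ t ∈ Set.Icc τ₀ τ₁,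
      ‖Lam (u + t * Complex.I)‖ ≤ Real.log τ₁ := fun u hu t ht =>
    (norm_Lam_le_log (by linarith [hu.1]) (by linarith [hu.2]) (hpos t ht)).trans
      (Real.log_le_log (by linarith [hpos t ht]) ht.2)
  have hfc : ∀ u : ℝ, ContinuousOn (fun t : ℝ => f (u + t * Complex.I)) (Set.Icc τ₀ τ₁) := fun u =>
    hf.continuousOn.comp (by fun_prop) fun t ht => by
      have := hpos t ht
      simp only [Set.mem_ofPred_eq]
      simp
      linarith
  have hDc : ∀ u : ℝ, ContinuousOn (fun t : ℝ => Delta (u + t * Complex.I)) (Set.Icc τ₀ τ₁) :=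
    fun u => differentiableOn_Delta.continuousOn.comp (by fun_prop) fun t ht =>
      add_mul_I_mem_regularSet u (show t ≠ 0 by linarith [hpos t ht])
  have hLc := fun u : ℝ => continuousOn_Lam_vertical u (τ₀ := τ₀) (τ₁ := τ₁) (by linarith)
  set F : ℂ → ℂ := fun s => f s * (-Lam s * Delta s) / (Delta s - w) with hF
  have hFc : ∀ u : ℝ, (∀ t ∈ Set.Icc τ₀ τ₁, Delta (u + t * Complex.I) - w ≠ 0) →
      ContinuousOn (fun t : ℝ => F (u + t * Complex.I)) (Set.Icc τ₀ τ₁) := fun u hu =>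
    ((hfc u).mul ((hLc u).neg.mul (hDc u))).div ((hDc u).sub continuousOn_const) hu
  have hDne : ∀ u t : ℝ, ‖Delta (u + t * Complex.I)‖ ≠ 1 → Delta (u + t * Complex.I) - w ≠ 0 := by
    intro u t h h'
    rw [sub_eq_zero] at h'
    rw [h', hw] at h
    exact h rfl
  -- the horizontal sides
  have hhor : ∀ τ ∈ Set.Icc τ₀ τ₁, Delta (1 / 2 + Complex.I * τ) = -w →
      ‖∫ x in (1 - σ)..σ, F (x + τ * Complex.I)‖ ≤ 2 * (B * Real.log τ₁) := by
    intro τ hτm hDτ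
    have hbd : ∀ u ∈ Set.Icc (1 - σ) σ, ‖F (u + τ * Complex.I)‖ ≤ B * Real.log τ₁ := by
      intro u hu
      have hmax := max_le_norm_Delta_sub (σ := u) hw (by linarith [hu.1]) (by linarith [hu.2])
        (hpos τ hτm) hDτ
      have hm1 := le_max_left 1 ‖Delta (u + τ * Complex.I)‖
      simp only [hF]
      rw [norm_div, norm_mul, norm_mul, norm_neg, div_le_iff₀ (by linarith)]
      have hb := hB u hu τ hτm
      have hB0 : 0 ≤ B := by
        by_contra hneg
        have : 0 ≤ ‖f (u + τ * Complex.I)‖ * ‖Delta (u + τ * Complex.I)‖ := by positivity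
        nlinarith
      calc _ = ‖f (u + τ * Complex.I)‖ * ‖Delta (u + τ * Complex.I)‖ *
            ‖Lam (u + τ * Complex.I)‖ := by ring
        _ ≤ B * max 1 ‖Delta (u + τ * Complex.I)‖ * Real.log τ₁ := by
            gcongr
            exact hLam u hu τ hτm
        _ ≤ B * ‖Delta (u + τ * Complex.I) - w‖ * Real.log τ₁ := by gcongr
        _ = _ := by ring
    have := intervalIntegral.norm_integral_le_of_norm_le_const (a := 1 - σ) (b := σ)
      (C := B * Real.log τ₁) (f := fun x : ℝ => F (x + τ * Complex.I)) fun u hu => by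
        rw [Set.uIoc_of_le (by linarith)] at hu
        exact hbd u ⟨hu.1.le, hu.2⟩
    refine this.trans ?_
    rw [abs_of_pos (by linarith)]
    have hBl : 0 ≤ B * Real.log τ₁ := (norm_nonneg _).trans (hbd σ ⟨by linarith, le_rfl⟩)
    nlinarith
  -- the right side
  have hright : ‖(∫ t in τ₀..τ₁, F (σ + t * Complex.I)) - w⁻¹ * (∫ t in τ₀..τ₁,
      Lam (σ + t * Complex.I) * (f (σ + t * Complex.I) * Delta (σ + t * Complex.I)))‖ ≤
      12 * (K * Real.log τ₁ * Real.sqrt τ₁) := by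
    have hhalf : ∀ t ∈ Set.Icc τ₀ τ₁, ‖Delta (σ + t * Complex.I)‖ ≤ 1 / 2 := fun t ht =>
      norm_Delta_le_half h1.le h2 (hpos t ht)
    rw [← intervalIntegral.integral_const_mul, ← intervalIntegral.integral_sub]
    · refine (norm_integral_le_of_norm_le_div_sqrt (C := 6 * (K * Real.log τ₁)) (by linarith) hτ
        (by positivity) fun t ht => ?_).trans (le_of_eq (by ring))
      refine (norm_kernel_sub_le_of_norm_le_half hw (hhalf t ht)).trans ?_
      calc _ ≤ 2 * (Real.log τ₁ * K * (3 / Real.sqrt t)) := by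
            gcongr
            · exact hLam σ ⟨by linarith, le_rfl⟩ t ht
            · exact hR t ht
            · exact norm_Delta_le_div_sqrt h1.le h2 (hpos t ht)
        _ = _ := by ring
    · refine ContinuousOn.intervalIntegrable ?_
      rw [Set.uIcc_of_le hτ]
      exact hFc σ fun t ht => hDne σ t fun h => by have := hhalf t ht; rw [h] at this; norm_num at this
    · refine ContinuousOn.intervalIntegrable ?_
      rw [Set.uIcc_of_le hτ]
      exact continuousOn_const.mul ((hLc σ).mul ((hfc σ).mul (hDc σ)))
  -- the left side, reflected in the critical line
  have hleft : ‖(∫ t in τ₀..τ₁, F (((1 - σ : ℝ) : ℂ) + t * Complex.I)) + starRingEnd ℂ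
      (∫ t in τ₀..τ₁, Lam (σ + t * Complex.I) *
        starRingEnd ℂ (f (((1 - σ : ℝ) : ℂ) + t * Complex.I)))‖ ≤
      12 * (K * Real.log τ₁ * Real.sqrt τ₁) := by
    have hinv : ∀ t ∈ Set.Icc τ₀ τ₁, ‖Delta (((1 - σ : ℝ) : ℂ) + t * Complex.I)‖⁻¹ =
        ‖Delta (σ + t * Complex.I)‖ := fun t ht =>
      (eq_inv_of_mul_eq_one_left (norm_Delta_one_sub σ (show t ≠ 0 by linarith [hpos t ht]))).symm
    have htwo : ∀ t ∈ Set.Icc τ₀ τ₁, 2 ≤ ‖Delta (((1 - σ : ℝ) : ℂ) + t * Complex.I)‖ := by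
      intro t ht
      have ha := norm_Delta_le_half h1.le h2 (hpos t ht)
      have hb := norm_Delta_one_sub σ (t := t) (by linarith [hpos t ht])
      nlinarith [norm_nonneg (Delta (((1 - σ : ℝ) : ℂ) + t * Complex.I))]
    have hconj : starRingEnd ℂ (∫ t in τ₀..τ₁, Lam (σ + t * Complex.I) *
        starRingEnd ℂ (f (((1 - σ : ℝ) : ℂ) + t * Complex.I))) =
        ∫ t in τ₀..τ₁, Lam (((1 - σ : ℝ) : ℂ) + t * Complex.I) *
          f (((1 - σ : ℝ) : ℂ) + t * Complex.I) := by
      rw [intervalIntegral.integral_of_le hτ, ← integral_conj,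
        ← intervalIntegral.integral_of_le hτ]
      refine intervalIntegral.integral_congr fun t ht => ?_
      rw [Set.uIcc_of_le hτ] at ht
      rw [Lam_one_sub_add_mul_I σ (show t ≠ 0 by linarith [hpos t ht]), map_mul,
        Complex.conj_conj]
    rw [hconj, ← intervalIntegral.integral_add]
    · refine (norm_integral_le_of_norm_le_div_sqrt (C := 6 * (K * Real.log τ₁)) (by linarith) hτ
        (by positivity) fun t ht => ?_).trans (le_of_eq (by ring))
      refine (norm_kernel_add_le_of_two_le_norm hw (htwo t ht)).trans ?_
      rw [hinv t ht]
      calc _ ≤ 2 * (Real.log τ₁ * K * (3 / Real.sqrt t)) := by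
            gcongr
            · exact hLam (1 - σ) ⟨le_rfl, by linarith⟩ t ht
            · exact hL t ht
            · exact norm_Delta_le_div_sqrt h1.le h2 (hpos t ht)
        _ = _ := by ring
    · refine ContinuousOn.intervalIntegrable ?_
      rw [Set.uIcc_of_le hτ]
      exact hFc _ fun t ht => hDne _ t fun h => by
        have := htwo t ht; rw [h] at this; norm_num at this
    · refine ContinuousOn.intervalIntegrable ?_
      rw [Set.uIcc_of_le hτ]
      exact (hLc _).mul (hfc _)
  have hrect := rectIntegral_eq_sum_gramPoints hf hw (σ₀ := 1 - σ) (σ₁ := σ) (by linarith)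
    (by linarith) (by linarith) h2 h0 hτ hD₀ hD₁ P hP
  change rectIntegral F _ _ _ _ = _ at hrect
  unfold rectIntegral at hrect
  set bot := ∫ x in (1 - σ)..σ, F (x + τ₀ * Complex.I)
  set top := ∫ x in (1 - σ)..σ, F (x + τ₁ * Complex.I)
  set right := ∫ t in τ₀..τ₁, F (σ + t * Complex.I)
  set left := ∫ t in τ₀..τ₁, F (((1 - σ : ℝ) : ℂ) + t * Complex.I)
  set mr := w⁻¹ * (∫ t in τ₀..τ₁, Lam (σ + t * Complex.I) *
    (f (σ + t * Complex.I) * Delta (σ + t * Complex.I)))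
  set ml := starRingEnd ℂ (∫ t in τ₀..τ₁, Lam (σ + t * Complex.I) *
    starRingEnd ℂ (f (((1 - σ : ℝ) : ℂ) + t * Complex.I)))
  have e : 2 * Real.pi * ∑ t ∈ P, f (1 / 2 + Complex.I * t) - (mr + ml) =
      (right - mr) - (left + ml) - Complex.I * (bot - top) := by
    have : 2 * Real.pi * ∑ t ∈ P, f (1 / 2 + Complex.I * t) =
        -Complex.I * (2 * Real.pi * Complex.I * ∑ t ∈ P, f (1 / 2 + Complex.I * t)) := by
      linear_combination (2 * Real.pi * ∑ t ∈ P, f (1 / 2 + Complex.I * t)) * Complex.I_sq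
    rw [this, ← hrect]
    linear_combination (left - right) * Complex.I_sq
  rw [e]
  have hb := hhor τ₀ ⟨le_rfl, hτ⟩ hD₀
  have ht := hhor τ₁ ⟨hτ, le_rfl⟩ hD₁
  have n1 := norm_sub_le ((right - mr) - (left + ml)) (Complex.I * (bot - top))
  have n2 := norm_sub_le (right - mr) (left + ml)
  have n3 := norm_sub_le bot top
  rw [norm_mul, Complex.norm_I, one_mul] at n1
  linarith

theorem norm_exp_two_mul_I_mul (φ : ℝ) : ‖Complex.exp (2 * Complex.I * φ)‖ = 1 := by
  rw [Complex.norm_exp]; simp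

theorem sqrt_le_two_mul_sqrt {T τ : ℝ} (hT : 107 ≤ T) (hτ : τ ≤ T + 7) :
    Real.sqrt τ ≤ 2 * Real.sqrt T := by
  rw [Real.sqrt_le_left (by positivity), mul_pow, Real.sq_sqrt (by linarith)]
  linarith

theorem norm_sum_le_card_mul {s : Finset ℝ} {g : ℝ → ℂ} {G : ℝ} {N : ℕ} (hG : 0 ≤ G)
    (hN : s.card ≤ N) (hg : ∀ t ∈ s, ‖g t‖ ≤ G) : ‖∑ t ∈ s, g t‖ ≤ N * G := by
  refine (norm_sum_le_of_le s hg).trans ?_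
  rw [Finset.sum_const, nsmul_eq_mul]
  gcongr

/-- Sums over `gramPoints φ T` through integrals over two vertical lines between heights where
`Δ = -e^{2iφ}`. Passing to such heights changes the sum by boundedly many terms. -/
theorem exists_norm_finsum_gramPoints_sub_le : ∃ N : ℕ, ∀ φ T : ℝ, 107 ≤ T →
    ∃ τ₀ ∈ Set.Icc (100 : ℝ) 107, ∃ τ₁ ∈ Set.Icc T (T + 7), ∀ f : ℂ → ℂ,
      DifferentiableOn ℂ f {s | 0 < s.im} → ∀ σ B K G : ℝ, σ = 1 + 1 / Real.log T →
      (∀ u ∈ Set.Icc (1 - σ) σ, ∀ t ∈ Set.Icc 100 (T + 7),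
        ‖f (u + t * Complex.I)‖ * ‖Delta (u + t * Complex.I)‖ ≤
          B * max 1 ‖Delta (u + t * Complex.I)‖) →
      (∀ t ∈ Set.Icc 100 (T + 7), ‖f (σ + t * Complex.I) * Delta (σ + t * Complex.I)‖ ≤ K) →
      (∀ t ∈ Set.Icc 100 (T + 7), ‖f (((1 - σ : ℝ) : ℂ) + t * Complex.I)‖ ≤ K) →
      (∀ t ∈ Set.Icc 0 (T + 7), ‖f (1 / 2 + Complex.I * t)‖ ≤ G) →
      ‖2 * Real.pi * (∑ᶠ t ∈ gramPoints φ T, f (1 / 2 + Complex.I * t)) -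
        ((Complex.exp (2 * Complex.I * φ))⁻¹ * (∫ t in τ₀..τ₁, Lam (σ + t * Complex.I) *
            (f (σ + t * Complex.I) * Delta (σ + t * Complex.I))) +
          starRingEnd ℂ (∫ t in τ₀..τ₁, Lam (σ + t * Complex.I) *
            starRingEnd ℂ (f (((1 - σ : ℝ) : ℂ) + t * Complex.I))))‖ ≤
        8 * (B * Real.log T) + 96 * (K * Real.log T * Real.sqrt T) + 7 * ((N + 1) * G) := by
  obtain ⟨N, hN⟩ := exists_encard_le 107
  refine ⟨N, fun φ T hT => ?_⟩
  have hw := norm_exp_two_mul_I_mul φ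
  set w := Complex.exp (2 * Complex.I * φ) with hwdef
  have hww : w ≠ -w := fun h => (norm_pos_iff.1 (by rw [hw]; exact one_pos)) (self_eq_neg.1 h)
  obtain ⟨τ₀, hτ₀, hD₀, -⟩ := exists_Delta_half_eq_neg (a := 100) le_rfl hw
  obtain ⟨τ₁, hτ₁, hD₁, hsub⟩ := exists_Delta_half_eq_neg (a := T) (by linarith) hw
  have hτ₀' : τ₀ ≤ 107 := by linarith [hτ₀.2]
  refine ⟨τ₀, ⟨hτ₀.1, hτ₀'⟩, τ₁, hτ₁, fun f hf σ B K G hσ hB hR hL hG => ?_⟩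
  have hlogT := two_le_log hT
  have hinv : 1 / Real.log T ≤ 1 / 2 := by gcongr
  have hinv0 : 0 < 1 / Real.log T := by positivity
  have hττ : τ₀ ≤ τ₁ := by linarith [hτ₁.1]
  have hfinP : {t | τ₀ < t ∧ t < τ₁ ∧ Delta (1 / 2 + Complex.I * t) = w}.Finite := by
    refine (finite_gramPoints φ τ₁).subset fun t ht => ⟨?_, ht.2.1.le, ht.2.2⟩
    linarith [ht.1, hτ₀.1]
  set P := hfinP.toFinset with hPdef
  have hP : ∀ t, t ∈ P ↔ τ₀ < t ∧ t < τ₁ ∧ Delta (1 / 2 + Complex.I * t) = w := fun t => by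
    rw [hPdef, Set.Finite.mem_toFinset]; rfl
  set Q := (finite_gramPoints φ T).toFinset with hQdef
  have hQ : ∀ t, t ∈ Q ↔ 0 < t ∧ t ≤ T ∧ Delta (1 / 2 + Complex.I * t) = w := fun t => by
    rw [hQdef, Set.Finite.mem_toFinset]; rfl
  have hG0 : 0 ≤ G := (norm_nonneg _).trans (hG 0 ⟨le_rfl, by linarith⟩)
  have h1 : ‖∑ t ∈ Q \ P, f (1 / 2 + Complex.I * t)‖ ≤ N * G := by
    refine norm_sum_le_card_mul hG0 ?_ fun t ht => ?_
    · have hsub : ((Q \ P : Finset ℝ) : Set ℝ) ⊆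
          {t ∈ Set.Icc 0 107 | Delta (1 / 2 + Complex.I * t) = w} := by
        intro t ht
        obtain ⟨htQ, htP⟩ := Finset.mem_sdiff.1 (Finset.mem_coe.1 ht)
        obtain ⟨ht0, htT, htw⟩ := (hQ t).1 htQ
        refine ⟨⟨ht0.le, ?_⟩, htw⟩
        by_contra hlt
        refine htP ((hP t).2 ⟨by linarith, lt_of_le_of_ne (htT.trans hτ₁.1) fun h => ?_, htw⟩)
        rw [h, hD₁] at htw
        exact hww htw.symm
      have := (Set.encard_le_encard hsub).trans (hN w)
      rw [Set.encard_coe_eq_coe_finsetCard] at this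
      exact_mod_cast this
    · obtain ⟨ht0, htT, -⟩ := (hQ t).1 (Finset.mem_sdiff.1 ht).1
      exact hG t ⟨ht0.le, by linarith⟩
  have h2 : ‖∑ t ∈ P \ Q, f (1 / 2 + Complex.I * t)‖ ≤ (1 : ℕ) * G := by
    have hmem : ∀ t ∈ P \ Q, t ∈ {t ∈ Set.Icc T τ₁ | Delta (1 / 2 + Complex.I * t) = w} := by
      intro t ht
      obtain ⟨htP, htQ⟩ := Finset.mem_sdiff.1 ht
      obtain ⟨ht0, ht1, htw⟩ := (hP t).1 htP
      refine ⟨⟨?_, ht1.le⟩, htw⟩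
      by_contra hlt
      exact htQ ((hQ t).2 ⟨by linarith [hτ₀.1], by linarith, htw⟩)
    refine norm_sum_le_card_mul hG0 ?_ fun t ht => ?_
    · exact Finset.card_le_one.2 fun a ha b hb => hsub (hmem a ha) (hmem b hb)
    · have := (hmem t ht).1
      exact hG t ⟨by linarith [this.1], by linarith [this.2, hτ₁.2]⟩
  have hfin : ∑ᶠ t ∈ gramPoints φ T, f (1 / 2 + Complex.I * t) =
      ∑ t ∈ Q, f (1 / 2 + Complex.I * t) := finsum_mem_eq_finite_toFinset_sum _ _
  have hdiff := Finset.sum_sdiff_sub_sum_sdiff (s₁ := P) (s₂ := Q)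
    (f := fun t : ℝ => f (1 / 2 + Complex.I * t))
  have hIcc : ∀ t ∈ Set.Icc τ₀ τ₁, t ∈ Set.Icc 100 (T + 7) := fun t ht =>
    ⟨hτ₀.1.trans ht.1, ht.2.trans hτ₁.2⟩
  have hmain := norm_sum_gramPoints_sub_le hf hw (σ := σ) (by linarith) (by linarith) hτ₀.1 hττ
    hD₀ hD₁ hP (fun u hu t ht => hB u hu t (hIcc t ht)) (fun t ht => hR t (hIcc t ht))
    (fun t ht => hL t (hIcc t ht))
  have hlogτ : Real.log τ₁ ≤ 2 * Real.log T :=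
    log_le_two_mul_log hT (by linarith [hτ₁.1]) hτ₁.2
  have hsqrt := sqrt_le_two_mul_sqrt hT hτ₁.2
  have hK0 : 0 ≤ K := (norm_nonneg _).trans (hL 100 ⟨le_rfl, by linarith⟩)
  have hB0 : 0 ≤ B := by
    have hb := hB σ ⟨by linarith, le_rfl⟩ 100 ⟨le_rfl, by linarith⟩
    have hm := le_max_left 1 ‖Delta (σ + (100 : ℝ) * Complex.I)‖
    by_contra hneg
    have : 0 ≤ ‖f (σ + (100 : ℝ) * Complex.I)‖ * ‖Delta (σ + (100 : ℝ) * Complex.I)‖ := by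
      positivity
    nlinarith
  rw [hfin]
  set m := w⁻¹ * (∫ t in τ₀..τ₁, Lam (σ + t * Complex.I) *
            (f (σ + t * Complex.I) * Delta (σ + t * Complex.I))) +
          starRingEnd ℂ (∫ t in τ₀..τ₁, Lam (σ + t * Complex.I) *
            starRingEnd ℂ (f (((1 - σ : ℝ) : ℂ) + t * Complex.I)))
  have e : 2 * Real.pi * ∑ t ∈ Q, f (1 / 2 + Complex.I * t) - m =
      (2 * Real.pi * ∑ t ∈ P, f (1 / 2 + Complex.I * t) - m) +
        2 * Real.pi * (∑ t ∈ Q \ P, f (1 / 2 + Complex.I * t) -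
          ∑ t ∈ P \ Q, f (1 / 2 + Complex.I * t)) := by
    rw [hdiff]; ring
  have hpi := Real.pi_lt_d2
  have hpi0 := Real.pi_pos
  have h2pi : ‖(2 * Real.pi : ℂ)‖ = 2 * Real.pi := by
    rw [norm_mul, Complex.norm_real, Real.norm_of_nonneg hpi0.le]; simp
  rw [e]
  refine (norm_add_le _ _).trans (add_le_add (hmain.trans ?_) ?_)
  · have hB' : B * Real.log τ₁ ≤ B * (2 * Real.log T) := by gcongr
    have hK' : K * Real.log τ₁ * Real.sqrt τ₁ ≤ K * (2 * Real.log T) * (2 * Real.sqrt T) := by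
      gcongr
    linarith
  · rw [norm_mul, h2pi]
    have n := norm_sub_le (∑ t ∈ Q \ P, f (1 / 2 + Complex.I * t))
      (∑ t ∈ P \ Q, f (1 / 2 + Complex.I * t))
    push_cast at h2
    calc _ ≤ 7 * (N * G + 1 * G) := by
          gcongr
          · linarith
          · linarith
      _ = _ := by ring

/-! ### Pointwise bounds and conjugation of Dirichlet polynomials -/

theorem rpow_mul_rpow_le {T : ℝ} (hT : 107 ≤ T) {m l : ℝ} (hm : 1 ≤ m) (hl : 1 ≤ l) (hmT : m ≤ T)
    (hlT : l ≤ T) {u : ℝ} (h1 : -(1 / Real.log T) ≤ u) (h2 : u ≤ 1 + 1 / Real.log T) :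
    m ^ (1 - u) * l ^ u ≤ 3 * (m + l) := by
  have key : ∀ a b : ℝ, 1 ≤ a → 1 ≤ b → b ≤ T → ∀ v : ℝ, 1 ≤ v → v ≤ 1 + 1 / Real.log T →
      a ^ (1 - v) * b ^ v ≤ 3 * b := by
    intro a b ha hb hbT v hv1 hv2
    have e1 : a ^ (1 - v) ≤ 1 := Real.rpow_le_one_of_one_le_of_nonpos ha (by linarith)
    have e2 : b ^ v ≤ b * b ^ (1 / Real.log T) := by
      calc b ^ v ≤ b ^ (1 + 1 / Real.log T) := by gcongr
        _ = _ := by rw [Real.rpow_add (by linarith), Real.rpow_one]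
    have e3 := rpow_inv_log_le hT hb hbT
    calc a ^ (1 - v) * b ^ v ≤ 1 * (b * 3) := by
          gcongr
          exact e2.trans (by gcongr)
      _ = 3 * b := by ring
  rcases le_total 1 u with hu | hu
  · linarith [key m l hm hl hlT u hu h2]
  rcases le_total u 0 with hu0 | hu0
  · have := key l m hl hm hmT (1 - u) (by linarith) (by linarith)
    rw [sub_sub_cancel, mul_comm] at this
    linarith
  · calc m ^ (1 - u) * l ^ u ≤ (m + l) ^ (1 - u) * (m + l) ^ u := by
          gcongr <;> linarith
      _ = m + l := by rw [← Real.rpow_add (by linarith), sub_add_cancel, Real.rpow_one]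
      _ ≤ _ := by linarith

theorem norm_dirPoly_mul_dirPoly_le {T : ℝ} (hT : 107 ≤ T) {X Y : ℝ} (hX : X ≤ T) (hY : Y ≤ T)
    (x y : ℕ → ℂ) {u : ℝ} (h1 : -(1 / Real.log T) ≤ u) (h2 : u ≤ 1 + 1 / Real.log T) (t : ℝ) :
    ‖dirPoly X x (u + t * Complex.I) * dirPoly Y y (1 - (u + t * Complex.I))‖ ≤
      3 * (⌊X⌋₊ + ⌊Y⌋₊) * coeffSum X x * coeffSum Y y := by
  rw [dirPoly_mul_dirPoly]
  unfold coeffSum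
  rw [mul_assoc, Finset.sum_mul_sum, Finset.mul_sum]
  refine norm_sum_le_of_le _ fun m hm => ?_
  rw [Finset.mul_sum]
  refine norm_sum_le_of_le _ fun l hl => ?_
  obtain ⟨hm1, hm2⟩ := Finset.mem_Icc.1 hm
  obtain ⟨hl1, hl2⟩ := Finset.mem_Icc.1 hl
  have hm' : (1 : ℝ) ≤ m := by exact_mod_cast hm1
  have hl' : (1 : ℝ) ≤ l := by exact_mod_cast hl1
  have hm3 : (m : ℝ) ≤ ⌊X⌋₊ := Nat.cast_le.2 hm2
  have hl3 : (l : ℝ) ≤ ⌊Y⌋₊ := Nat.cast_le.2 hl2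
  have hk := rpow_mul_rpow_le hT hm' hl' (hm3.trans (floor_le_of_le (by linarith) hX))
    (hl3.trans (floor_le_of_le (by linarith) hY)) h1 h2
  rw [norm_mul, norm_mul, norm_cpow_mul_cpow_vertical hm1 hl1]
  have e1 : (m : ℝ) ^ (-u) = (m : ℝ) ^ (1 - u) / m := by
    rw [← Real.rpow_sub_one (by linarith)]; ring_nf
  rw [e1, Real.rpow_sub_one (by linarith)]
  calc ‖x m‖ * ‖y l‖ * ((m : ℝ) ^ (1 - u) / m * ((l : ℝ) ^ u / l)) =
        (m : ℝ) ^ (1 - u) * (l : ℝ) ^ u * (‖x m‖ / m * (‖y l‖ / l)) := by ring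
    _ ≤ 3 * (m + l) * (‖x m‖ / m * (‖y l‖ / l)) := by gcongr
    _ ≤ _ := by gcongr

theorem conj_dirPoly (X : ℝ) (x : ℕ → ℂ) (s : ℂ) :
    starRingEnd ℂ (dirPoly X x s) = dirPoly X (fun n => starRingEnd ℂ (x n)) (starRingEnd ℂ s) := by
  unfold dirPoly
  rw [map_sum]
  refine Finset.sum_congr rfl fun n _ => ?_
  rw [map_div₀, Complex.cpow_conj _ _ (by rw [Complex.natCast_arg]; exact Real.pi_pos.ne),
    Complex.conj_natCast]

theorem coeffSum_conj (X : ℝ) (x : ℕ → ℂ) :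
    coeffSum X (fun n => starRingEnd ℂ (x n)) = coeffSum X x := by
  simp [coeffSum]

theorem coeffMax_conj (X : ℝ) (x : ℕ → ℂ) :
    coeffMax X (fun n => starRingEnd ℂ (x n)) = coeffMax X x := by
  simp [coeffMax]

theorem conj_diagSum_conj (X Y : ℝ) (x y : ℕ → ℂ) :
    starRingEnd ℂ (diagSum X Y (fun n => starRingEnd ℂ (x n)) fun n => starRingEnd ℂ (y n)) =
      diagSum X Y x y := by
  simp [diagSum, map_sum]

theorem differentiable_dirPoly (X : ℝ) (x : ℕ → ℂ) : Differentiable ℂ (dirPoly X x) := by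
  unfold dirPoly
  refine Differentiable.fun_sum fun n hn => ?_
  have hn0 : (n : ℂ) ≠ 0 := Nat.cast_ne_zero.2 (by have := (Finset.mem_Icc.1 hn).1; omega)
  refine (differentiable_const _).div (fun s => ?_) fun s => ?_
  · exact (differentiableAt_id).const_cpow (Or.inl hn0)
  · rw [Complex.cpow_def_of_ne_zero hn0]; exact Complex.exp_ne_zero _

theorem norm_riemannZeta_le_two_mul_log {T : ℝ} (hT : 107 ≤ T) {σ : ℝ}
    (hσ : σ = 1 + 1 / Real.log T) (t : ℝ) :
    ‖riemannZeta (σ + t * Complex.I)‖ ≤ 2 * Real.log T := by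
  have hL := two_le_log hT
  have h1 : 1 < σ := by rw [hσ]; have : 0 < 1 / Real.log T := by positivity
                        linarith
  obtain ⟨Z, hZ, hs⟩ := hasSum_rpow_neg h1
  rw [zeta_eq_tsum_one_div_nat_add_one_cpow (by simpa using h1)]
  refine (tsum_of_norm_bounded hs fun n => ?_).trans (hZ.trans ?_)
  · rw [norm_div, norm_one, ← Nat.cast_add_one, Complex.norm_natCast_cpow_of_pos n.succ_pos,
      Real.rpow_neg (by positivity), one_div]
    simp
  · rw [hσ, add_sub_cancel_left, one_div_one_div]
    linarith

/-- Reflection in the critical line combined with complex conjugation. -/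
theorem norm_riemannZeta_one_sub (u t : ℝ) :
    ‖riemannZeta (1 - (u + t * Complex.I))‖ =
      ‖riemannZeta (((1 - u : ℝ) : ℂ) + t * Complex.I)‖ := by
  rw [← conj_one_sub, riemannZeta_conj, Complex.norm_conj]

/-- The bound `O(√T)` for `ζ` on the critical line at all heights up to `T + 7`; near the real axis,
where the bound in terms of `√t` is not available, it holds by continuity. -/
theorem exists_norm_riemannZeta_half_le : ∃ C : ℝ, 0 ≤ C ∧ ∀ T t : ℝ, 107 ≤ T →
    t ∈ Set.Icc 0 (T + 7) → ‖riemannZeta (1 - (1 / 2 + Complex.I * t))‖ ≤ C * Real.sqrt T := by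
  have hcont : ContinuousOn (fun t : ℝ => riemannZeta (1 - (1 / 2 + Complex.I * t)))
      (Set.Icc 0 1) := fun t _ => by
    have hne : 1 - (1 / 2 + Complex.I * (t : ℂ)) ≠ 1 := fun h => by
      have := congrArg Complex.re h
      norm_num at this
    exact (ContinuousAt.comp (f := fun t : ℝ => 1 - (1 / 2 + Complex.I * (t : ℂ)))
      (differentiableAt_riemannZeta hne).continuousAt (by fun_prop)).continuousWithinAt
  obtain ⟨C, hC⟩ := isCompact_Icc.exists_bound_of_continuousOn hcont
  have hC0 : 0 ≤ C := (norm_nonneg _).trans (hC 0 ⟨le_rfl, zero_le_one⟩)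
  refine ⟨C + 30, by linarith, fun T t hT ht => ?_⟩
  have hs : 1 ≤ Real.sqrt T := Real.one_le_sqrt.2 (by linarith)
  rcases le_total t 1 with h | h
  · have := hC t ⟨ht.1, h⟩
    nlinarith
  · rw [half_add_eq, norm_riemannZeta_one_sub]
    have h1 := norm_riemannZeta_le_sqrt (σ := 1 - 1 / 2) (t := t) (by norm_num) (by norm_num) h
    have h2 := sqrt_le_two_mul_sqrt hT ht.2
    nlinarith

/-! ### The two asymptotic formulas -/

/-- If `⌊X⌋₊ = 0` both sides vanish; this covers negative `X`. -/
theorem floor_mul_coeffSum_le (X : ℝ) (x : ℕ → ℂ) :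
    ⌊X⌋₊ * coeffSum X x ≤ X * coeffSum X x := by
  rcases Nat.eq_zero_or_pos ⌊X⌋₊ with h | h
  · simp [coeffSum, h]
  · exact mul_le_mul_of_nonneg_right (Nat.floor_le (Nat.pos_of_floor_pos h).le)
      (coeffSum_nonneg _ _)

theorem floor_mul_coeffMax_le (X : ℝ) (x : ℕ → ℂ) :
    ⌊X⌋₊ * coeffMax X x ≤ X * coeffMax X x := by
  rcases Nat.eq_zero_or_pos ⌊X⌋₊ with h | h
  · simp [coeffMax, h]
  · exact mul_le_mul_of_nonneg_right (Nat.floor_le (Nat.pos_of_floor_pos h).le)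
      (coeffMax_nonneg _ _)

theorem coeffSqSum_nonneg (X : ℝ) (x : ℕ → ℂ) : 0 ≤ coeffSqSum X x :=
  Finset.sum_nonneg fun _ _ => by positivity

theorem floor_mul_coeffSqSum_le (X : ℝ) (x : ℕ → ℂ) :
    ⌊X⌋₊ * coeffSqSum X x ≤ X * coeffSqSum X x := by
  rcases Nat.eq_zero_or_pos ⌊X⌋₊ with h | h
  · simp [coeffSqSum, h]
  · exact mul_le_mul_of_nonneg_right (Nat.floor_le (Nat.pos_of_floor_pos h).le)
      (coeffSqSum_nonneg _ _)

/-- Cauchy–Schwarz. -/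
theorem coeffSum_sq_le {T X : ℝ} (hT : 107 ≤ T) (hX : X ≤ T) (x : ℕ → ℂ) :
    coeffSum X x ^ 2 ≤ 2 * Real.log T * coeffSqSum X x := by
  have h := Finset.sum_mul_sq_le_sq_mul_sq (Finset.Icc 1 ⌊X⌋₊)
    (fun n : ℕ => 1 / Real.sqrt n) (fun n => ‖x n‖ / Real.sqrt n)
  have e1 : ∀ n ∈ Finset.Icc 1 ⌊X⌋₊, 1 / Real.sqrt (n : ℝ) * (‖x n‖ / Real.sqrt n) = ‖x n‖ / n :=
    fun n _ => by rw [div_mul_div_comm, one_mul, Real.mul_self_sqrt n.cast_nonneg]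
  have e2 : ∀ n ∈ Finset.Icc 1 ⌊X⌋₊, (1 / Real.sqrt (n : ℝ)) ^ 2 = 1 / n := fun n _ => by
    rw [div_pow, one_pow, Real.sq_sqrt n.cast_nonneg]
  have e3 : ∀ n ∈ Finset.Icc 1 ⌊X⌋₊, (‖x n‖ / Real.sqrt (n : ℝ)) ^ 2 = ‖x n‖ ^ 2 / n :=
    fun n _ => by rw [div_pow, Real.sq_sqrt n.cast_nonneg]
  rw [Finset.sum_congr rfl e1, Finset.sum_congr rfl e2, Finset.sum_congr rfl e3] at h
  refine h.trans (mul_le_mul_of_nonneg_right ?_ (coeffSqSum_nonneg X x))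
  exact (sum_Icc_inv_le _).trans (one_add_log_floor_le hT hX)

theorem norm_sub_div_two_pi_le {S A : ℂ} {M E : ℝ} (h : ‖2 * Real.pi * S - M * A‖ ≤ E) :
    ‖S - ((M / (2 * Real.pi) : ℝ) : ℂ) * A‖ ≤ E := by
  have hpi := Real.pi_gt_three
  have hpi0 : (Real.pi : ℂ) ≠ 0 := Complex.ofReal_ne_zero.2 Real.pi_ne_zero
  have e : 2 * Real.pi * S - M * A =
      ((2 * Real.pi : ℝ) : ℂ) * (S - ((M / (2 * Real.pi) : ℝ) : ℂ) * A) := by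
    push_cast
    field_simp
  rw [e, norm_mul, Complex.norm_real, Real.norm_of_nonneg (by linarith)] at h
  nlinarith [norm_nonneg (S - ((M / (2 * Real.pi) : ℝ) : ℂ) * A)]

theorem one_sub_half_add (t : ℝ) : 1 - (1 / 2 + Complex.I * t) = 1 / 2 - Complex.I * t := by
  ring

/-- Collecting the error terms of the formula for `S₁`; `k` stands for the number of points missed by
the contour times the implied constant of the bound for `ζ` on the critical line. -/
theorem error_le_mul_R₁ {T : ℝ} (hT : 107 ≤ T) (X Y : ℝ) (x y : ℕ → ℂ) {k : ℝ} (hk : 0 ≤ k) :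
    720 * (Real.sqrt T * Real.log T * ((⌊X⌋₊ + ⌊Y⌋₊) * coeffSum X x * coeffSum Y y)) +
      576 * (Real.sqrt T * Real.log T ^ 2 * ((⌊X⌋₊ + ⌊Y⌋₊) * coeffSum X x * coeffSum Y y)) +
      21 * (k * (Real.sqrt T * ((⌊X⌋₊ + ⌊Y⌋₊) * coeffSum X x * coeffSum Y y))) +
      18000 * (Real.log T ^ 2 * ((⌊X⌋₊ + ⌊Y⌋₊) * coeffSum X x * coeffSum Y y)) +
      18000 * (Real.log T ^ 3 * ((⌊X⌋₊ + ⌊Y⌋₊) * coeffMax X x * coeffMax Y y)) ≤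
    (19296 + 21 * k) * R₁ T X Y x y := by
  have hX1 := coeffSum_nonneg X x
  have hY1 := coeffSum_nonneg Y y
  have hX0 := coeffMax_nonneg X x
  have hY0 := coeffMax_nonneg Y y
  have hL := two_le_log hT
  have hs : 1 ≤ Real.sqrt T := Real.one_le_sqrt.2 (by linarith)
  unfold R₁
  set L := Real.log T
  set r := Real.sqrt T
  set a := coeffSum X x with ha
  set b := coeffSum Y y with hb
  set c := coeffMax X x with hc
  set d := coeffMax Y y with hd
  set U := ((⌊X⌋₊ : ℝ) + ⌊Y⌋₊) * a * b with hU
  set V := ((⌊X⌋₊ : ℝ) + ⌊Y⌋₊) * c * d with hV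
  have hU0 : 0 ≤ U := by positivity
  have hV0 : 0 ≤ V := by positivity
  have hUle : U ≤ (X + Y) * a * b := by
    have h1 := mul_le_mul_of_nonneg_right (floor_mul_coeffSum_le X x) hY1
    have h2 := mul_le_mul_of_nonneg_right (floor_mul_coeffSum_le Y y) hX1
    rw [hU]
    linarith
  have hVle : V ≤ (X + Y) * c * d := by
    have h1 := mul_le_mul_of_nonneg_right (floor_mul_coeffMax_le X x) hY0
    have h2 := mul_le_mul_of_nonneg_right (floor_mul_coeffMax_le Y y) hX0
    rw [hV]
    linarith
  have b1 : r * L * U ≤ r * L ^ 2 * U := by gcongr; nlinarith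
  have b2 : r * U ≤ r * L ^ 2 * U := by
    gcongr; exact le_mul_of_one_le_right (by linarith) (by nlinarith)
  have b3 : L ^ 2 * U ≤ r * L ^ 2 * U := by
    gcongr; exact le_mul_of_one_le_left (by positivity) hs
  have b4 : L ^ 3 * V ≤ L ^ 4 * V := by
    gcongr
    · linarith
    · norm_num
  have b5 : k * (r * U) ≤ k * (r * L ^ 2 * U) := by gcongr
  have b6 : 0 ≤ L ^ 4 * V := by positivity
  calc _ ≤ (19296 + 21 * k) * (r * L ^ 2 * U + L ^ 4 * V) := by
        have b8 : 0 ≤ k * (L ^ 4 * V) := by positivity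
        linarith
    _ ≤ (19296 + 21 * k) * (r * L ^ 2 * ((X + Y) * a * b) +
          L ^ 4 * ((X + Y) * c * d)) := by gcongr
    _ = _ := by ring

/-- Both vertical sides contribute a main term: on the right, `ζ(1 - s) Δ(s) = ζ(s)`, and on the left,
after reflection in the critical line, the roles of `X` and `Y` are exchanged. -/
theorem exists_norm_S₁_sub_le : ∃ C : ℝ, ∀ φ T : ℝ, 107 ≤ T → ∀ X Y : ℝ, X ≤ T → Y ≤ T →
    ∀ x y : ℕ → ℂ, ‖S₁ φ T X Y x y - ((mainTerm T / (2 * Real.pi) : ℝ) : ℂ) *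
      (Complex.exp (-(2 * Complex.I * φ)) * diagSum X Y x y + diagSum Y X y x)‖ ≤
      C * R₁ T X Y x y := by
  obtain ⟨N₀, hN₀⟩ := exists_norm_finsum_gramPoints_sub_le
  obtain ⟨Cz, hCz0, hCz⟩ := exists_norm_riemannZeta_half_le
  refine ⟨19296 + 21 * ((N₀ + 1) * Cz), fun φ T hT X Y hX hY x y => ?_⟩
  obtain ⟨τ₀, hτ₀, τ₁, hτ₁, key⟩ := hN₀ φ T hT
  have hL := two_le_log hT
  have hττ : τ₀ ≤ τ₁ := by linarith [hτ₀.2, hτ₁.1]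
  set f : ℂ → ℂ := fun s => riemannZeta (1 - s) * (dirPoly X x s * dirPoly Y y (1 - s)) with hf
  set σ := 1 + 1 / Real.log T with hσ
  set D₀ := 3 * (⌊X⌋₊ + ⌊Y⌋₊) * coeffSum X x * coeffSum Y y with hD₀
  have hinv0 : 0 < 1 / Real.log T := by positivity
  have hinv : 1 / Real.log T ≤ 1 / 2 := by gcongr
  have hX1 := coeffSum_nonneg X x
  have hY1 := coeffSum_nonneg Y y
  have hX0 := coeffMax_nonneg X x
  have hY0 := coeffMax_nonneg Y y
  have hD₀0 : 0 ≤ D₀ := by positivity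
  have hXY : ∀ u ∈ Set.Icc (1 - σ) σ, ∀ t : ℝ,
      ‖dirPoly X x (u + t * Complex.I) * dirPoly Y y (1 - (u + t * Complex.I))‖ ≤ D₀ :=
    fun u hu t => norm_dirPoly_mul_dirPoly_le hT hX hY x y (by linarith [hu.1]) hu.2 t
  have hfD : ∀ u t : ℝ, 100 ≤ t → f (u + t * Complex.I) * Delta (u + t * Complex.I) =
      riemannZeta (u + t * Complex.I) *
        (dirPoly X x (u + t * Complex.I) * dirPoly Y y (1 - (u + t * Complex.I))) := by
    intro u t ht
    rw [riemannZeta_eq_Delta_mul (add_mul_I_mem_regularSet u (show t ≠ 0 by linarith))]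
    simp only [hf]
    ring
  have hsq : ∀ t ∈ Set.Icc 100 (T + 7), 15 * Real.sqrt t ≤ 30 * Real.sqrt T := fun t ht => by
    have := sqrt_le_two_mul_sqrt hT ht.2
    linarith
  have hmain := key f (fun s hs => by
      have hne : 1 - s ≠ 1 := fun h => by
        have h0 : s = 0 := by linear_combination -h
        have hs' : 0 < s.im := hs
        rw [h0, Complex.zero_im] at hs'
        exact lt_irrefl _ hs'
      refine DifferentiableAt.differentiableWithinAt ?_
      refine DifferentiableAt.fun_mul ?_ (((differentiable_dirPoly X x) s).fun_mul ?_)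
      · exact (differentiableAt_riemannZeta hne).comp s (by fun_prop)
      · exact ((differentiable_dirPoly Y y) (1 - s)).comp s (by fun_prop))
    σ (30 * Real.sqrt T * D₀) (2 * Real.log T * D₀) (Cz * Real.sqrt T * D₀) rfl
    (fun u hu t ht => by
      have hm1 := le_max_left 1 ‖Delta (u + t * Complex.I)‖
      have hm2 := le_max_right 1 ‖Delta (u + t * Complex.I)‖
      -- the functional equation moves `ζ` to the half-plane where it is small
      rcases le_total u (1 / 2) with h | h
      · refine mul_le_mul ?_ hm2 (norm_nonneg _) (by positivity)
        simp only [hf]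
        rw [norm_mul, norm_riemannZeta_one_sub]
        refine mul_le_mul ?_ (hXY u hu t) (norm_nonneg _) (by positivity)
        exact (norm_riemannZeta_le_sqrt (by linarith) (by linarith [hu.1])
          (by linarith [ht.1])).trans (hsq t ht)
      · rw [← norm_mul, hfD u t ht.1, norm_mul]
        refine (mul_le_mul ((norm_riemannZeta_le_sqrt h (by linarith [hu.2])
          (by linarith [ht.1])).trans (hsq t ht)) (hXY u hu t) (norm_nonneg _)
          (by positivity)).trans ?_
        exact le_mul_of_one_le_right (by positivity) hm1)
    (fun t ht => by
      rw [hfD σ t ht.1, norm_mul]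
      exact mul_le_mul (norm_riemannZeta_le_two_mul_log hT hσ t)
        (hXY σ ⟨by linarith, le_rfl⟩ t) (norm_nonneg _) (by positivity))
    (fun t ht => by
      simp only [hf]
      rw [norm_mul, norm_riemannZeta_one_sub, sub_sub_cancel]
      exact mul_le_mul (norm_riemannZeta_le_two_mul_log hT hσ t)
        (hXY (1 - σ) ⟨le_rfl, by linarith⟩ t) (norm_nonneg _) (by positivity))
    (fun t ht => by
      simp only [hf]
      rw [norm_mul]
      refine mul_le_mul (hCz T t hT ht) ?_ (norm_nonneg _) (by positivity)
      rw [half_add_eq]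
      exact hXY (1 / 2) ⟨by linarith, by linarith⟩ t)
  have hS : ∑ᶠ t ∈ gramPoints φ T, f (1 / 2 + Complex.I * t) = S₁ φ T X Y x y := by
    unfold S₁
    simp only [hf, one_sub_half_add, mul_assoc]
  have hIr : (∫ t in τ₀..τ₁, Lam (σ + t * Complex.I) *
      (f (σ + t * Complex.I) * Delta (σ + t * Complex.I))) =
      ∫ t in τ₀..τ₁, Lam (σ + t * Complex.I) * riemannZeta (σ + t * Complex.I) *
        (dirPoly X x (σ + t * Complex.I) * dirPoly Y y (1 - (σ + t * Complex.I))) := by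
    refine intervalIntegral.integral_congr fun t ht => ?_
    rw [Set.uIcc_of_le hττ] at ht
    rw [hfD σ t (hτ₀.1.trans ht.1), mul_assoc]
  have hIl : (∫ t in τ₀..τ₁, Lam (σ + t * Complex.I) *
      starRingEnd ℂ (f (((1 - σ : ℝ) : ℂ) + t * Complex.I))) =
      ∫ t in τ₀..τ₁, Lam (σ + t * Complex.I) * riemannZeta (σ + t * Complex.I) *
        (dirPoly Y (fun n => starRingEnd ℂ (y n)) (σ + t * Complex.I) *
          dirPoly X (fun n => starRingEnd ℂ (x n)) (1 - (σ + t * Complex.I))) := by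
    refine intervalIntegral.integral_congr fun t _ => ?_
    have e : starRingEnd ℂ (1 - starRingEnd ℂ (1 - ((σ : ℂ) + t * Complex.I))) =
        (σ : ℂ) + t * Complex.I := by
      rw [map_sub, map_one, Complex.conj_conj, sub_sub_cancel]
    simp only [hf]
    rw [← conj_one_sub, map_mul, map_mul, conj_dirPoly, conj_dirPoly, ← riemannZeta_conj, e,
      Complex.conj_conj]
    ring
  have hMr := norm_zetaMoment_sub_le hτ₀.1 hτ₀.2 hT hτ₁.1 hτ₁.2 hX hY x y hσ
  have hMl := norm_zetaMoment_sub_le hτ₀.1 hτ₀.2 hT hτ₁.1 hτ₁.2 hY hX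
    (fun n => starRingEnd ℂ (y n)) (fun n => starRingEnd ℂ (x n)) hσ
  rw [coeffSum_conj, coeffSum_conj, coeffMax_conj, coeffMax_conj, ← hIl, ← Complex.norm_conj,
    map_sub, map_mul, conj_diagSum_conj, Complex.conj_ofReal] at hMl
  rw [← hIr] at hMr
  rw [hS] at hmain
  set Ir := ∫ t in τ₀..τ₁, Lam (σ + t * Complex.I) *
      (f (σ + t * Complex.I) * Delta (σ + t * Complex.I))
  set Il := starRingEnd ℂ (∫ t in τ₀..τ₁, Lam (σ + t * Complex.I) *
      starRingEnd ℂ (f (((1 - σ : ℝ) : ℂ) + t * Complex.I)))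
  rw [← Complex.exp_neg] at hmain
  set w' := Complex.exp (-(2 * Complex.I * φ)) with hw'
  have hw'1 : ‖w'‖ = 1 := by rw [hw', Complex.norm_exp]; simp
  refine norm_sub_div_two_pi_le (le_trans ?_ (b := 8 * (30 * Real.sqrt T * D₀ * Real.log T) +
    96 * (2 * Real.log T * D₀ * Real.log T * Real.sqrt T) +
    7 * ((N₀ + 1) * (Cz * Real.sqrt T * D₀)) +
    18000 * (⌊Y⌋₊ * Real.log T ^ 2 * coeffSum X x * coeffSum Y y +
        ⌊Y⌋₊ * Real.log T ^ 3 * coeffMax X x * coeffMax Y y) +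
    18000 * (⌊X⌋₊ * Real.log T ^ 2 * coeffSum Y y * coeffSum X x +
        ⌊X⌋₊ * Real.log T ^ 3 * coeffMax Y y * coeffMax X x)) ?_)
  · have e : 2 * Real.pi * S₁ φ T X Y x y - mainTerm T * (w' * diagSum X Y x y + diagSum Y X y x) =
        (2 * Real.pi * S₁ φ T X Y x y - (w' * Ir + Il)) +
          w' * (Ir - mainTerm T * diagSum X Y x y) + (Il - mainTerm T * diagSum Y X y x) := by
      ring
    rw [e]
    refine (norm_add₃_le).trans (add_le_add_three hmain ?_ hMl)
    rw [norm_mul, hw'1, one_mul]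
    exact hMr
  · refine le_trans (le_of_eq ?_) (error_le_mul_R₁ hT X Y x y
      (mul_nonneg (by positivity : (0 : ℝ) ≤ N₀ + 1) hCz0))
    rw [hD₀]
    ring

/-- Collecting the error terms of the formula for `S₂`. -/
theorem error_le_mul_R₂ {T X : ℝ} (hT : 107 ≤ T) (hX : X ≤ T) (x : ℕ → ℂ) {k : ℝ} (hk : 0 ≤ k) :
    4548 * (Real.log T * (⌊X⌋₊ * coeffSum X x ^ 2)) +
      720 * (Real.sqrt T * (Real.log T * (⌊X⌋₊ * coeffSum X x ^ 2))) +
      42 * (k * (⌊X⌋₊ * coeffSum X x ^ 2)) +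
      4500 * (Real.log T ^ 2 * (⌊X⌋₊ * coeffMax X x * coeffMax X x)) ≤
    (10536 + 84 * k) * R₂ T X x := by
  have hX1 := coeffSum_nonneg X x
  have hX0 := coeffMax_nonneg X x
  have hQ0 := coeffSqSum_nonneg X x
  have hL := two_le_log hT
  have hs : 1 ≤ Real.sqrt T := Real.one_le_sqrt.2 (by linarith)
  have hcs := coeffSum_sq_le hT hX x
  have hQle := floor_mul_coeffSqSum_le X x
  have hMle := mul_le_mul_of_nonneg_right (floor_mul_coeffMax_le X x) hX0
  unfold R₂
  set L := Real.log T
  set r := Real.sqrt T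
  set a := coeffSum X x with ha
  set c := coeffMax X x with hc
  set W := (⌊X⌋₊ : ℝ) * coeffSqSum X x with hW
  set V := (⌊X⌋₊ : ℝ) * c * c with hV
  have hW0 : 0 ≤ W := by positivity
  have hV0 : 0 ≤ V := by positivity
  have hA : (⌊X⌋₊ : ℝ) * a ^ 2 ≤ 2 * L * W := by
    calc (⌊X⌋₊ : ℝ) * a ^ 2 ≤ ⌊X⌋₊ * (2 * L * coeffSqSum X x) := by gcongr
      _ = _ := by rw [hW]; ring
  set A := (⌊X⌋₊ : ℝ) * a ^ 2 with hAdef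
  have hA0 : 0 ≤ A := by positivity
  have hLA : L * A ≤ 2 * (L ^ 2 * W) := by
    calc L * A ≤ L * (2 * L * W) := by gcongr
      _ = _ := by ring
  have hA' : A ≤ 2 * (L ^ 2 * W) := by nlinarith
  have hrW : L ^ 2 * W ≤ r * (L ^ 2 * W) := le_mul_of_one_le_left (by positivity) hs
  have b1 : r * (L * A) ≤ r * (2 * (L ^ 2 * W)) := by gcongr
  have b2 : k * A ≤ k * (2 * (r * (L ^ 2 * W))) := by
    gcongr
    linarith
  have b4 : L ^ 2 * V ≤ L ^ 3 * V := by
    gcongr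
    · linarith
    · norm_num
  have b6 : 0 ≤ L ^ 3 * V := by positivity
  have b7 : 0 ≤ k * (L ^ 3 * V) := by positivity
  calc _ ≤ (10536 + 84 * k) * (r * (L ^ 2 * W) + L ^ 3 * V) := by
        linarith
    _ ≤ (10536 + 84 * k) * (r * (L ^ 2 * (X * coeffSqSum X x)) +
          L ^ 3 * (X * c * c)) := by gcongr
    _ = _ := by ring

/-- Here only the left side of the contour contributes a main term; on the right, `Δ` is small. -/
theorem exists_abs_S₂_sub_le : ∃ C : ℝ, ∀ φ T : ℝ, 107 ≤ T → ∀ X : ℝ, X ≤ T → ∀ x : ℕ → ℂ,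
    |S₂ φ T X x - mainTerm T / (2 * Real.pi) * coeffSqSum X x| ≤ C * R₂ T X x := by
  obtain ⟨N₀, hN₀⟩ := exists_norm_finsum_gramPoints_sub_le
  refine ⟨10536 + 84 * (N₀ + 1), fun φ T hT X hX x => ?_⟩
  obtain ⟨τ₀, hτ₀, τ₁, hτ₁, key⟩ := hN₀ φ T hT
  have hL := two_le_log hT
  have hττ : τ₀ ≤ τ₁ := by linarith [hτ₀.2, hτ₁.1]
  set f : ℂ → ℂ := fun s => dirPoly X x s * dirPoly X (fun n => starRingEnd ℂ (x n)) (1 - s) with hf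
  set σ := 1 + 1 / Real.log T with hσ
  set D₀ := 6 * (⌊X⌋₊ * coeffSum X x ^ 2) with hD₀
  have hinv0 : 0 < 1 / Real.log T := by positivity
  have hinv : 1 / Real.log T ≤ 1 / 2 := by gcongr
  have hX1 := coeffSum_nonneg X x
  have hX0 := coeffMax_nonneg X x
  have hQ0 := coeffSqSum_nonneg X x
  have hD₀0 : 0 ≤ D₀ := by positivity
  have hfle : ∀ u ∈ Set.Icc (1 - σ) σ, ∀ t : ℝ, ‖f (u + t * Complex.I)‖ ≤ D₀ := by
    intro u hu t
    refine (norm_dirPoly_mul_dirPoly_le hT hX hX x _ (by linarith [hu.1]) hu.2 t).trans ?_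
    rw [coeffSum_conj, hD₀]
    exact le_of_eq (by ring)
  have hmain := key f (((differentiable_dirPoly X x).fun_mul
      ((differentiable_dirPoly X _).comp (by fun_prop))).differentiableOn) σ D₀ D₀ D₀ rfl
    (fun u hu t ht => mul_le_mul (hfle u hu t) (le_max_right _ _) (norm_nonneg _) hD₀0)
    (fun t ht => by
      rw [norm_mul]
      have := norm_Delta_le_half (σ := σ) (by linarith) (by linarith) ht.1
      exact (mul_le_mul (hfle σ ⟨by linarith, le_rfl⟩ t) (this.trans (by norm_num : _ ≤ (1 : ℝ)))
        (norm_nonneg _) hD₀0).trans (mul_one _).le)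
    (fun t ht => hfle _ ⟨le_rfl, by linarith⟩ t)
    (fun t ht => by
      rw [half_add_eq]
      exact hfle (1 / 2) ⟨by linarith, by linarith⟩ t)
  have hS : ∑ᶠ t ∈ gramPoints φ T, f (1 / 2 + Complex.I * t) = ((S₂ φ T X x : ℝ) : ℂ) := by
    unfold S₂
    have := AddMonoidHom.map_finsum_mem (fun t : ℝ => ‖dirPoly X x (1 / 2 + Complex.I * t)‖ ^ 2)
      (Complex.ofRealHom : ℝ →+ ℂ) (finite_gramPoints φ T)
    refine Eq.trans ?_ this.symm
    refine finsum_mem_congr rfl fun t _ => ?_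
    simp only [hf]
    rw [one_sub_half_add, ← conj_half_add, ← conj_dirPoly, Complex.mul_conj,
      Complex.normSq_eq_norm_sq]
    rfl
  have hIr : ‖∫ t in τ₀..τ₁, Lam (σ + t * Complex.I) *
      (f (σ + t * Complex.I) * Delta (σ + t * Complex.I))‖ ≤
      24 * (D₀ * Real.log T * Real.sqrt T) := by
    have hlog : Real.log τ₁ ≤ 2 * Real.log T :=
      log_le_two_mul_log hT (by linarith [hτ₁.1]) hτ₁.2
    refine (norm_integral_le_of_norm_le_div_sqrt (C := 6 * (D₀ * Real.log T))
      (by linarith [hτ₀.1]) hττ (by positivity) fun t ht => ?_).trans ?_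
    · have ht100 := hτ₀.1.trans ht.1
      rw [norm_mul, norm_mul]
      calc _ ≤ 2 * Real.log T * (D₀ * (3 / Real.sqrt t)) := by
            gcongr
            · exact (norm_Lam_le_log (by linarith) (by linarith) ht100).trans
                ((Real.log_le_log (by linarith) ht.2).trans hlog)
            · exact hfle σ ⟨by linarith, le_rfl⟩ t
            · exact norm_Delta_le_div_sqrt (by linarith) (by linarith) ht100
        _ = _ := by ring
    · calc _ ≤ 2 * (6 * (D₀ * Real.log T)) * (2 * Real.sqrt T) := by
            gcongr
            exact sqrt_le_two_mul_sqrt hT hτ₁.2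
        _ = _ := by ring
  have hIl : (∫ t in τ₀..τ₁, Lam (σ + t * Complex.I) *
      starRingEnd ℂ (f (((1 - σ : ℝ) : ℂ) + t * Complex.I))) =
      ∫ t in τ₀..τ₁, Lam (σ + t * Complex.I) * (dirPoly X x (σ + t * Complex.I) *
          dirPoly X (fun n => starRingEnd ℂ (x n)) (1 - (σ + t * Complex.I))) := by
    refine intervalIntegral.integral_congr fun t _ => ?_
    have e : starRingEnd ℂ (1 - starRingEnd ℂ (1 - ((σ : ℂ) + t * Complex.I))) =
        (σ : ℂ) + t * Complex.I := by
      rw [map_sub, map_one, Complex.conj_conj, sub_sub_cancel]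
    simp only [hf]
    rw [← conj_one_sub, map_mul, conj_dirPoly, conj_dirPoly, e, Complex.conj_conj]
    simp only [Complex.conj_conj]
    rw [mul_comm (dirPoly X x _)]
  have hMl := norm_moment_sub_le hτ₀.1 hτ₀.2 hT hτ₁.1 hτ₁.2 hX x
    (fun n => starRingEnd ℂ (x n)) hσ
  have hdiag : ∑ n ∈ Finset.Icc 1 ⌊X⌋₊, x n * starRingEnd ℂ (x n) / n =
      ((coeffSqSum X x : ℝ) : ℂ) := by
    unfold coeffSqSum
    push_cast
    refine Finset.sum_congr rfl fun n _ => ?_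
    rw [Complex.mul_conj, Complex.normSq_eq_norm_sq]
    push_cast
    rfl
  rw [coeffSum_conj, coeffMax_conj, ← hIl, hdiag, ← Complex.norm_conj, map_sub, map_mul,
    Complex.conj_ofReal, Complex.conj_ofReal] at hMl
  rw [hS] at hmain
  set Ir := ∫ t in τ₀..τ₁, Lam (σ + t * Complex.I) *
      (f (σ + t * Complex.I) * Delta (σ + t * Complex.I))
  set Il := starRingEnd ℂ (∫ t in τ₀..τ₁, Lam (σ + t * Complex.I) *
      starRingEnd ℂ (f (((1 - σ : ℝ) : ℂ) + t * Complex.I)))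
  rw [← Complex.exp_neg] at hmain
  set w' := Complex.exp (-(2 * Complex.I * φ)) with hw'
  have hw'1 : ‖w'‖ = 1 := by rw [hw', Complex.norm_exp]; simp
  rw [← Real.norm_eq_abs, ← Complex.norm_real]
  push_cast
  have hcast : ((mainTerm T : ℂ) / (2 * Real.pi)) = ((mainTerm T / (2 * Real.pi) : ℝ) : ℂ) := by
    push_cast; rfl
  rw [hcast]
  refine norm_sub_div_two_pi_le (le_trans ?_ (b := 8 * (D₀ * Real.log T) +
    96 * (D₀ * Real.log T * Real.sqrt T) + 7 * ((N₀ + 1) * D₀) +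
    24 * (D₀ * Real.log T * Real.sqrt T) +
    4500 * (⌊X⌋₊ * Real.log T * coeffSum X x * coeffSum X x +
        ⌊X⌋₊ * Real.log T ^ 2 * coeffMax X x * coeffMax X x)) ?_)
  · have e : 2 * Real.pi * (S₂ φ T X x : ℂ) - mainTerm T * (coeffSqSum X x : ℂ) =
        (2 * Real.pi * (S₂ φ T X x : ℂ) - (w' * Ir + Il)) +
          w' * Ir + (Il - mainTerm T * (coeffSqSum X x : ℂ)) := by
      ring
    rw [e]
    refine (norm_add₃_le).trans (add_le_add_three hmain ?_ hMl)
    rw [norm_mul, hw'1, one_mul]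
    exact hIr
  · refine le_trans (le_of_eq ?_) (error_le_mul_R₂ hT hX x (by positivity : (0 : ℝ) ≤ N₀ + 1))
    rw [hD₀]
    ring

end ZetaMoments

theorem proposition1 :
    (∀ φ ∈ Set.Ico (0 : ℝ) Real.pi, ∀ T : ℝ, (ZetaMoments.gramPoints φ T).Finite) ∧
    (∃ C T₀ : ℝ, ∀ φ ∈ Set.Ico (0 : ℝ) Real.pi, ∀ T : ℝ, T₀ ≤ T →
      ∀ X Y : ℝ, X ≤ T → Y ≤ T → ∀ x y : ℕ → ℂ,
        ‖ZetaMoments.S₁ φ T X Y x y -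
            ((T / (2 * Real.pi) * Real.log (T / (2 * Real.pi * Real.exp 1)) : ℝ) : ℂ) *
              (Complex.exp (-(2 * Complex.I * φ)) * ZetaMoments.diagSum X Y x y +
                ZetaMoments.diagSum Y X y x)‖ ≤
          C * ZetaMoments.R₁ T X Y x y) ∧
    (∃ C T₀ : ℝ, ∀ φ ∈ Set.Ico (0 : ℝ) Real.pi, ∀ T : ℝ, T₀ ≤ T →
      ∀ X : ℝ, X ≤ T → ∀ x : ℕ → ℂ,
        |ZetaMoments.S₂ φ T X x -
            T / (2 * Real.pi) * Real.log (T / (2 * Real.pi * Real.exp 1)) *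
              ZetaMoments.coeffSqSum X x| ≤
          C * ZetaMoments.R₂ T X x) := by
  have hmain : ∀ T : ℝ, T / (2 * Real.pi) * Real.log (T / (2 * Real.pi * Real.exp 1)) =
      ZetaMoments.mainTerm T / (2 * Real.pi) := fun T => by
    unfold ZetaMoments.mainTerm
    ring
  simp only [hmain]
  obtain ⟨C₁, h₁⟩ := ZetaMoments.exists_norm_S₁_sub_le
  obtain ⟨C₂, h₂⟩ := ZetaMoments.exists_abs_S₂_sub_le
  exact ⟨fun φ _ T => ZetaMoments.finite_gramPoints φ T,
    ⟨C₁, 107, fun φ _ => h₁ φ⟩, ⟨C₂, 107, fun φ _ => h₂ φ⟩⟩
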